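/- Conventions. A pseudo-hyperKähler manifold \((M,g,I,J,K)\) is a smooth manifold with a smooth non-degenerate symmetric metric \(g\) of any signature and integrable complex structures \(I,J,K\) with \(IJ=K=-JI\), such that for each \(A\in\{I,J,K\}\) we have \(g(A\cdot,A\cdot)=g\) and the two-form \(\omega_A=g(A\cdot,\cdot)\) is closed. A tri-holomorphic isometry is a vector field \(X\) with \(L_Xg=0\) and \(L_XI=L_XJ=L_XK=0\); it is locally free if it has no zeros. Put \(\|X\|^2=g(X,X)\), \(\alpha_0=g(X,\cdot)\), \(\alpha_A=g(AX,\cdot)\) for \(A=I,J,K\), and \(g_{\mathbb HX}=\alpha_0^2+\alpha_I^2+\alpha_J^2+\alpha_K^2\). If \(\beta=b_1\alpha_I+b_2\alpha_J+b_3\alpha_K\), put \({*}_3\beta=b_1\,\alpha_J\wedge\alpha_K+b_2\,\alpha_K\wedge\alpha_I+b_3\,\alpha_I\wedge\alpha_J\). A twist \(W\) of \(M\) with respect to \((X,a,F)\), where \(a\) is a nowhere zero smooth function and \(F\) a two-form with \(da=-F(X,\cdot)\), is given by a principal circle bundle \(\pi_M\colon P\to M\) (period \(2\pi\)) with principal vector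 field \(Z\) and a connection one-form \(\theta\), \(\theta(Z)=1\), of curvature \(d\theta=\pi_M^*F\), such that \(X'=\widetilde X+aZ\) (with \(\widetilde X\) the horizontal lift of \(X\)) generates a circle action on \(P\), and a smooth quotient \(\pi_W\colon P\to W=P/\langle X'\rangle\). Tensors on \(W\) and \(M\) are \(\mathcal H\)-related if they correspond under the isomorphisms \(T_{\pi_W(p)}W\cong\ker\theta_p\cong T_{\pi_M(p)}M\) given by the projections, for all \(p\in P\). Theorem 6.1. Let \((M,g,I,J,K)\) be a connected pseudo-hyperKähler manifold with \(\dim M>4\), and let \(X\) be a locally free tri-holomorphic isometry (\(X\) may be null at some or all points). Let \(f,h\) be smooth functions on \(M\), put \(\tilde g=f\,g+h\,g_{\mathbb HX}\), and let \(W\) be a twist of \(M\) with respect to \((X,a,F)\), with a smooth \((0,2)\)-tensor field \(g_W\) and smooth endomorphism fields \(I_W,J_W,K_W\) that are \(\mathcal H\)-related to \(\tilde g\), \(I\), \(J\), \(K\), respectively. Then \((W,g_W,I_W,J_W,K_W)\) is pseudo-hyperKähler if and only if there are non-zero constants \(c,\lambda\) and a smooth function \(h_1\) on \(M\) such that \[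 \tilde g=c\,(g+h_1\,g_{\mathbb HX}),\qquad a=\lambda(1+h_1\|X\|^2),\qquad F=\lambda\bigl(d(h_1\alpha_0)+{*}_3dh_1\bigr), \] where \(dh_1\in\operatorname{span}\{\alpha_I,\alpha_J,\alpha_K\}\) at every point and \(d\,{*}_3dh_1=0\). -/

import Mathlib

open scoped Manifold ContDiff

noncomputable section

namespace PHKTwist

/-- The model space `ℝⁿ`. All manifolds below are manifolds without boundary modelled on it. -/
abbrev Model (n : ℕ) : Type := EuclideanSpace ℝ (Fin n)

section Tensors

variable (n : ℕ) (M : Type*) [TopologicalSpace M] [ChartedSpace (Model n) M]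

/-- (Not necessarily smooth) vector fields. -/
abbrev VField : Type _ := ∀ x : M, TangentSpace 𝓘(ℝ, Model n) x

/-- (Not necessarily smooth) fields of covectors. -/
abbrev CovField : Type _ := ∀ x : M, TangentSpace 𝓘(ℝ, Model n) x →L[ℝ] ℝ

/-- (Not necessarily smooth) fields of bilinear forms, i.e. `(0,2)`-tensor fields. -/
abbrev BilinField : Type _ :=
  ∀ x : M, TangentSpace 𝓘(ℝ, Model n) x →L[ℝ] TangentSpace 𝓘(ℝ, Model n) x →L[ℝ] ℝ

/-- (Not necessarily smooth) fields of endomorphisms of the tangent spaces. -/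
abbrev EndField : Type _ :=
  ∀ x : M, TangentSpace 𝓘(ℝ, Model n) x →L[ℝ] TangentSpace 𝓘(ℝ, Model n) x

/-- (Not necessarily smooth) exterior `k`-forms. -/
abbrev KForm (k : ℕ) : Type _ := ∀ x : M, TangentSpace 𝓘(ℝ, Model n) x [⋀^Fin k]→L[ℝ] ℝ

end Tensors

section Calculus

variable {n : ℕ} {M : Type*} [TopologicalSpace M] [ChartedSpace (Model n) M]
  [IsManifold 𝓘(ℝ, Model n) ∞ M]

/-- Smoothness of a vector field on a neighbourhood of a point. -/
def SmoothVFieldAt (X : VField n M) (x : M) : Prop :=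
  ContMDiffAt 𝓘(ℝ, Model n) 𝓘(ℝ, Model n).tangent ∞
    (fun y ↦ (⟨y, X y⟩ : TangentBundle 𝓘(ℝ, Model n) M)) x

/-- Smooth vector fields. -/
def SmoothVField (X : VField n M) : Prop := ∀ x, SmoothVFieldAt X x

/-- Smooth covector fields (sections of the cotangent bundle). -/
def SmoothCov (β : CovField n M) : Prop :=
  ContMDiff 𝓘(ℝ, Model n) (𝓘(ℝ, Model n).prod 𝓘(ℝ, Model n →L[ℝ] ℝ)) ∞
    (fun x ↦ Bundle.TotalSpace.mk' (Model n →L[ℝ] ℝ)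
      (E := fun x : M ↦ TangentSpace 𝓘(ℝ, Model n) x →L[ℝ] Bundle.Trivial M ℝ x) x (β x))

/-- Smooth `(0,2)`-tensor fields. -/
def SmoothBilin (g : BilinField n M) : Prop :=
  ContMDiff 𝓘(ℝ, Model n) (𝓘(ℝ, Model n).prod 𝓘(ℝ, Model n →L[ℝ] Model n →L[ℝ] ℝ)) ∞
    (fun x ↦ Bundle.TotalSpace.mk' (Model n →L[ℝ] Model n →L[ℝ] ℝ)
      (E := fun x : M ↦ TangentSpace 𝓘(ℝ, Model n) x →L[ℝ]
        TangentSpace 𝓘(ℝ, Model n) x →L[ℝ] Bundle.Trivial M ℝ x) x (g x))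

/-- Smooth fields of endomorphisms. -/
def SmoothEnd (A : EndField n M) : Prop :=
  ContMDiff 𝓘(ℝ, Model n) (𝓘(ℝ, Model n).prod 𝓘(ℝ, Model n →L[ℝ] Model n)) ∞
    (fun x ↦ Bundle.TotalSpace.mk' (Model n →L[ℝ] Model n)
      (E := fun x : M ↦ TangentSpace 𝓘(ℝ, Model n) x →L[ℝ] TangentSpace 𝓘(ℝ, Model n) x)
      x (A x))

/-- Smooth real functions. -/
def SmoothFun (f : M → ℝ) : Prop := ContMDiff 𝓘(ℝ, Model n) 𝓘(ℝ, ℝ) ∞ f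

/-- The differential of a real function. -/
def dFun (f : M → ℝ) : CovField n M := fun x ↦ mfderiv 𝓘(ℝ, Model n) 𝓘(ℝ, ℝ) f x

/-- The coordinate expression of a `k`-form in the preferred chart at `x₀`: the pull-back of the
form under the inverse of that chart. Only its values on the target of the chart matter. -/
def KForm.inChart {k : ℕ} (η : KForm n M k) (x₀ : M) (y : Model n) :
    Model n [⋀^Fin k]→L[ℝ] ℝ :=
  (η ((extChartAt 𝓘(ℝ, Model n) x₀).symm y)).compContinuousLinearMap
    (mfderiv 𝓘(ℝ, Model n) 𝓘(ℝ, Model n) (extChartAt 𝓘(ℝ, Model n) x₀).symm y)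

/-- A `k`-form is smooth when all its coordinate expressions are. -/
def KForm.Smooth {k : ℕ} (η : KForm n M k) : Prop :=
  ∀ x₀ : M, ContDiffOn ℝ ∞ (η.inChart x₀) (extChartAt 𝓘(ℝ, Model n) x₀).target

/-- The exterior derivative: at `x`, the exterior derivative of the coordinate expression in the
chart at `x`, pulled back to the manifold by that chart. -/
def KForm.d {k : ℕ} (η : KForm n M k) : KForm n M (k + 1) := fun x ↦
  (extDeriv (η.inChart x) (extChartAt 𝓘(ℝ, Model n) x x)).compContinuousLinearMap
    (mfderiv 𝓘(ℝ, Model n) 𝓘(ℝ, Model n) (extChartAt 𝓘(ℝ, Model n) x) x)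

/-- A covector field regarded as a `1`-form. -/
def CovField.toForm (β : CovField n M) : KForm n M 1 := fun x ↦
  ContinuousAlternatingMap.ofSubsingleton ℝ (Model n) ℝ (0 : Fin 1) (β x)

/-- The wedge product `β ∧ γ = β ⊗ γ - γ ⊗ β` of two covectors. -/
def wedge {E : Type*} [NormedAddCommGroup E] [NormedSpace ℝ E] (β γ : E →L[ℝ] ℝ) :
    E [⋀^Fin 2]→L[ℝ] ℝ :=
  ContinuousAlternatingMap.alternatizeUncurryFin
    (β.smulRight (ContinuousAlternatingMap.ofSubsingleton ℝ E ℝ (0 : Fin 1) γ))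

theorem wedge_apply {E : Type*} [NormedAddCommGroup E] [NormedSpace ℝ E] (β γ : E →L[ℝ] ℝ)
    (v : Fin 2 → E) : wedge β γ v = β (v 0) * γ (v 1) - β (v 1) * γ (v 0) := by
  simp [wedge, ContinuousAlternatingMap.alternatizeUncurryFin_apply, Fin.sum_univ_two,
    Fin.removeNth, sub_eq_add_neg]

/-- The wedge product of two covector fields. -/
def CovField.wedge (β γ : CovField n M) : KForm n M 2 := fun x ↦
  PHKTwist.wedge (E := Model n) (β x) (γ x)

end Calculus

section HyperKahler

variable {n : ℕ} {M : Type*} [TopologicalSpace M] [ChartedSpace (Model n) M]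
  [IsManifold 𝓘(ℝ, Model n) ∞ M]

/-- Composition of endomorphism fields and vector fields. -/
def EndField.app (A : EndField n M) (U : VField n M) : VField n M := fun x ↦ A x (U x)

/-- An almost complex structure is integrable: its Nijenhuis tensor vanishes. -/
def Integrable (A : EndField n M) : Prop :=
  ∀ (x : M) (U V : VField n M), SmoothVFieldAt U x → SmoothVFieldAt V x →
    VectorField.mlieBracket 𝓘(ℝ, Model n) (A.app U) (A.app V) x
      - A x (VectorField.mlieBracket 𝓘(ℝ, Model n) (A.app U) V x)
      - A x (VectorField.mlieBracket 𝓘(ℝ, Model n) U (A.app V) x)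
      - VectorField.mlieBracket 𝓘(ℝ, Model n) U V x = 0

/-- A pseudo-Kähler structure: `g` is a smooth metric, i.e. a non-degenerate
symmetric bilinear form of any signature, `A` is an integrable complex structure for which `g` is
Hermitian, and the two-form `η = g(A·,·)` is closed. -/
structure IsPseudoKahler (g : BilinField n M) (A : EndField n M) : Prop where
  smooth_metric : SmoothBilin g
  symm : ∀ x u v, g x u v = g x v u
  nondegenerate : ∀ x u, (∀ v, g x u v = 0) → u = 0
  smooth_complex : SmoothEnd A
  sq : ∀ x u, A x (A x u) = -u
  integrable : Integrable A
  hermitian : ∀ x u v, g x (A x u) (A x v) = g x u v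
  closed : ∃ η : KForm n M 2, (∀ x u v, η x ![u, v] = g x (A x u) v) ∧ ∀ x, η.d x = 0

/-- A pseudo-hyperKähler structure: a metric of arbitrary signature which is
pseudo-Kähler for each of three complex structures with `IJ = K = -JI`. -/
structure IsPseudoHyperKahler (g : BilinField n M) (I J K : EndField n M) : Prop where
  kahler_I : IsPseudoKahler g I
  kahler_J : IsPseudoKahler g J
  kahler_K : IsPseudoKahler g K
  I_J : ∀ x u, I x (J x u) = K x u
  J_I : ∀ x u, J x (I x u) = -K x u

/-- `L_X g = 0`. -/
def IsKilling (g : BilinField n M) (X : VField n M) : Prop :=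
  ∀ (x : M) (U V : VField n M), SmoothVFieldAt U x → SmoothVFieldAt V x →
    dFun (fun y ↦ g y (U y) (V y)) x (X x)
      = g x (VectorField.mlieBracket 𝓘(ℝ, Model n) X U x) (V x)
        + g x (U x) (VectorField.mlieBracket 𝓘(ℝ, Model n) X V x)

/-- `L_X A = 0`. -/
def PreservesEnd (A : EndField n M) (X : VField n M) : Prop :=
  ∀ (x : M) (U : VField n M), SmoothVFieldAt U x →
    VectorField.mlieBracket 𝓘(ℝ, Model n) X (A.app U) x
      = A x (VectorField.mlieBracket 𝓘(ℝ, Model n) X U x)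

/-- A vector field generating tri-holomorphic isometries. -/
structure IsTriholomorphicIsometry (g : BilinField n M) (I J K : EndField n M)
    (X : VField n M) : Prop where
  smooth : SmoothVField X
  killing : IsKilling g X
  pres_I : PreservesEnd I X
  pres_J : PreservesEnd J X
  pres_K : PreservesEnd K X

/-- The covector field `α₀ = X♭ = g(X,·)`. -/
def flat (g : BilinField n M) (X : VField n M) : CovField n M := fun x ↦ g x (X x)

/-- The function `‖X‖² = g(X,X)`, which may have any sign and may vanish. -/
def normSq (g : BilinField n M) (X : VField n M) : M → ℝ := fun x ↦ g x (X x) (X x)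

/-- The square `β² = β ⊗ β` of a covector field. -/
def CovField.sq (β : CovField n M) : BilinField n M := fun x ↦ (β x).smulRight (β x)

/-- `g_{ℍX} = α₀² + α_I² + α_J² + α_K²`, with `α_A = (AX)♭`. -/
def gHX (g : BilinField n M) (I J K : EndField n M) (X : VField n M) : BilinField n M := fun x ↦
  (flat g X).sq x + (flat g (I.app X)).sq x + (flat g (J.app X)).sq x + (flat g (K.app X)).sq x

/-- The elementary quaternionic deformation `f g + h g_{ℍX}`. -/
def elemDeformation (f h : M → ℝ) (g : BilinField n M) (I J K : EndField n M)
    (X : VField n M) : BilinField n M := fun x ↦ f x • g x + h x • gHX g I J K X x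

/-- `β` lies pointwise in the span of `α_I, α_J, α_K` and `σ = *₃β`, where `*₃` is the Hodge star
on that span for the metric and orientation with oriented orthonormal basis `α_I, α_J, α_K`:
if `β = b₁ α_I + b₂ α_J + b₃ α_K` then
`*₃β = b₁ α_J ∧ α_K + b₂ α_K ∧ α_I + b₃ α_I ∧ α_J`. -/
def IsStarThree (αI αJ αK β : CovField n M) (σ : KForm n M 2) : Prop :=
  ∀ x, ∃ b₁ b₂ b₃ : ℝ, β x = b₁ • αI x + b₂ • αJ x + b₃ • αK x ∧
    σ x = b₁ • αJ.wedge αK x + b₂ • αK.wedge αI x + b₃ • αI.wedge αJ x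

end HyperKahler

section TwistConstruction

/-- A smooth action of the circle `ℝ / Tℤ` on `P`, written as a `T`-periodic flow `φ`, with
generating vector field `Y`. -/
structure IsCircleAction {m : ℕ} {P : Type*} [TopologicalSpace P] [ChartedSpace (Model m) P]
    [IsManifold 𝓘(ℝ, Model m) ∞ P] (T : ℝ) (φ : ℝ → P → P) (Y : VField m P) : Prop where
  period_pos : 0 < T
  smooth : ContMDiff (𝓘(ℝ, ℝ).prod 𝓘(ℝ, Model m)) 𝓘(ℝ, Model m) ∞
    (fun q : ℝ × P ↦ φ q.1 q.2)
  zero : ∀ p, φ 0 p = p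
  add : ∀ s t p, φ (s + t) p = φ s (φ t p)
  periodic : ∀ p, φ T p = p
  generator : ∀ p, IsMIntegralCurve (I := 𝓘(ℝ, Model m)) (fun t ↦ φ t p) Y

/-- `π : P → B` is the smooth quotient of `P` by the action `φ`: a surjective submersion whose
fibres are the orbits. -/
structure IsSmoothQuotient {m n : ℕ} {P : Type*} [TopologicalSpace P] [ChartedSpace (Model m) P]
    {B : Type*} [TopologicalSpace B] [ChartedSpace (Model n) B]
    (φ : ℝ → P → P) (π : P → B) : Prop where
  smooth : ContMDiff 𝓘(ℝ, Model m) 𝓘(ℝ, Model n) ∞ π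
  surjective : Function.Surjective π
  submersion : ∀ p, Function.Surjective (mfderiv 𝓘(ℝ, Model m) 𝓘(ℝ, Model n) π p)
  fibre : ∀ p q, π p = π q ↔ ∃ t, φ t p = q

/-- `W` is a twist of `M` with respect to the twist data `(X, a, F)`, via the double fibration
`M ← P → W`: here `πM : P → M` is a principal circle bundle with principal vector field `Z` and
connection one-form `θ` with curvature `F`, the function `a` satisfies `da = - X ⌟ F` and has no
zeros, the vector field `X' = X̃ + a Z` (with `X̃` the `θ`-horizontal lift of `X`) generates a
circle action, and `πW : P → W` is the quotient by it. -/
structure Twist {n : ℕ} (M P W : Type*)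
    [TopologicalSpace M] [ChartedSpace (Model n) M] [IsManifold 𝓘(ℝ, Model n) ∞ M]
    [TopologicalSpace P] [ChartedSpace (Model (n + 1)) P] [IsManifold 𝓘(ℝ, Model (n + 1)) ∞ P]
    [TopologicalSpace W] [ChartedSpace (Model n) W] [IsManifold 𝓘(ℝ, Model n) ∞ W]
    (X : VField n M) (a : M → ℝ) (F : KForm n M 2) where
  /-- projection to `M` -/
  πM : P → M
  /-- projection to `W` -/
  πW : P → W
  /-- principal action -/
  ψ : ℝ → P → P
  /-- principal vector field -/
  Z : VField (n + 1) P
  /-- connection form -/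
  θ : CovField (n + 1) P
  /-- horizontal lift of `X` -/
  Xtilde : VField (n + 1) P
  /-- period of the lifted action -/
  T : ℝ
  /-- lifted action -/
  χ : ℝ → P → P
  smooth_a : SmoothFun (n := n) a
  a_ne_zero : ∀ x, a x ≠ 0
  smooth_F : F.Smooth
  da_eq : ∀ x v, dFun a x v = - F x ![X x, v]
  principal_action : IsCircleAction (2 * Real.pi) ψ Z
  principal_free : ∀ t p, ψ t p = p → ∃ k : ℤ, t = k * (2 * Real.pi)
  principal_quotient : IsSmoothQuotient (m := n + 1) (n := n) ψ πM
  smooth_θ : SmoothCov θ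
  θ_Z : ∀ p, θ p (Z p) = 1
  θ_invariant : ∀ t p v,
    θ (ψ t p) (mfderiv 𝓘(ℝ, Model (n + 1)) 𝓘(ℝ, Model (n + 1)) (ψ t) p v) = θ p v
  curvature : ∀ p, θ.toForm.d p = (F (πM p)).compContinuousLinearMap
    (mfderiv 𝓘(ℝ, Model (n + 1)) 𝓘(ℝ, Model n) πM p)
  Xtilde_horizontal : ∀ p, θ p (Xtilde p) = 0
  Xtilde_lift : ∀ p, mfderiv 𝓘(ℝ, Model (n + 1)) 𝓘(ℝ, Model n) πM p (Xtilde p) = X (πM p)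
  lifted_action : IsCircleAction T χ (fun p ↦ Xtilde p + a (πM p) • Z p)
  lifted_quotient : IsSmoothQuotient (m := n + 1) (n := n) χ πW

variable {n : ℕ} {M P W : Type*}
    [TopologicalSpace M] [ChartedSpace (Model n) M] [IsManifold 𝓘(ℝ, Model n) ∞ M]
    [TopologicalSpace P] [ChartedSpace (Model (n + 1)) P] [IsManifold 𝓘(ℝ, Model (n + 1)) ∞ P]
    [TopologicalSpace W] [ChartedSpace (Model n) W] [IsManifold 𝓘(ℝ, Model n) ∞ W]
    {X : VField n M} {a : M → ℝ} {F : KForm n M 2}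

/-- A bilinear form on `W` and one on `M` are `ℋ`-related: their pull-backs to `P` agree on the
horizontal distribution `ℋ = ker θ`. -/
def Twist.RelatedBilin (τ : Twist M P W X a F) (gW : BilinField n W) (g : BilinField n M) : Prop :=
  ∀ (p : P) (u v : TangentSpace 𝓘(ℝ, Model (n + 1)) p), τ.θ p u = 0 → τ.θ p v = 0 →
    gW (τ.πW p) (mfderiv 𝓘(ℝ, Model (n + 1)) 𝓘(ℝ, Model n) τ.πW p u)
        (mfderiv 𝓘(ℝ, Model (n + 1)) 𝓘(ℝ, Model n) τ.πW p v)
      = g (τ.πM p) (mfderiv 𝓘(ℝ, Model (n + 1)) 𝓘(ℝ, Model n) τ.πM p u)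
        (mfderiv 𝓘(ℝ, Model (n + 1)) 𝓘(ℝ, Model n) τ.πM p v)

/-- An endomorphism field on `W` and one on `M` are `ℋ`-related: they correspond under the
identifications `T_{πW(p)}W ≅ ℋ_p ≅ T_{πM(p)}M` given by the projections. -/
def Twist.RelatedEnd (τ : Twist M P W X a F) (AW : EndField n W) (A : EndField n M) : Prop :=
  ∀ (p : P) (u v : TangentSpace 𝓘(ℝ, Model (n + 1)) p), τ.θ p u = 0 → τ.θ p v = 0 →
    mfderiv 𝓘(ℝ, Model (n + 1)) 𝓘(ℝ, Model n) τ.πM p v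
        = A (τ.πM p) (mfderiv 𝓘(ℝ, Model (n + 1)) 𝓘(ℝ, Model n) τ.πM p u) →
      mfderiv 𝓘(ℝ, Model (n + 1)) 𝓘(ℝ, Model n) τ.πW p v
        = AW (τ.πW p) (mfderiv 𝓘(ℝ, Model (n + 1)) 𝓘(ℝ, Model n) τ.πW p u)

end TwistConstruction

end PHKTwist

end

open PHKTwist

/-! For `(A, B, C)` a cyclic permutation of `(I, J, K)`, the fundamental form of the deformed metric
is `ω̃_A = f ω_A + h (α₀ ∧ α_A + α_B ∧ α_C)`, and its contraction with `X` is `k a α_A`, where `k =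
(f + h‖X‖²)/a`. The pull-back to `P` of the corresponding form on `W` agrees with `ω̃_A` on `ker θ`
and kills the lifted generator `X̃ + aZ`, so it equals `ω̃_A - k θ ∧ α_A`
(`Twist.RelatedForm.pullback_eq`). Each `α_A` is closed by Cartan's formula, and `dθ = F`.
Differentiating and restricting to `ker θ`, the form on `W` is closed exactly when `df ∧ ω_A + dh ∧
(α₀ ∧ α_A + α_B ∧ α_C) + h dα₀ ∧ α_A = k F ∧ α_A` (`TwistEquation`, `kahlerForm_closed_iff`).
Integrability on `W` comes for free: closedness of two fundamental forms makes the Nijenhuis tensor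
of the third structure vanish (`nijenhuis_eq_zero_of_closed`). What remains is non-degeneracy and
three equations that are algebraic at each point.

These are solved in `DualFrame.solve_twistEquations`. On `ker α_A ∩ ker α_B` only `df ∧ ω_A`
survives, and a dimension count for isotropic subspaces in dimension at least 8 forces `df = 0`.
Then `dh` lies in the span of `α_I, α_J, α_K`. The two-form `kF - h dα₀ - dh ∧ α₀ - *₃dh` has zero
wedge product with each of `α_I, α_J, α_K`, hence vanishes. Null vectors cause no trouble, because
the argument uses vectors dual to `α₀, α_I, α_J, α_K` and never divides by `‖X‖²`.

Globally, `f` is a constant `c` by connectedness. Contracting the formula for `kF` with `X` gives `k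
da = d(h‖X‖²) = d(ka)`, so `k` is also constant. With `h₁ = h/c` and `λ = c/k` the stated formulas
follow, and `*₃dh₁` is closed because `F` and `d(h₁α₀)` are. Conversely, the formulas solve the
three equations, and `a ≠ 0` makes the deformed metric non-degenerate. -/

noncomputable section

namespace PHKTwist

open scoped Topology

/-! ### Tensor fields and Lie brackets in the preferred charts. -/

section Coordinates

open Set Filter Topology VectorField

variable {n : ℕ} {M : Type*} [TopologicalSpace M] [ChartedSpace (Model n) M]

/-- The derivative of the inverse of the preferred chart at `x₀`. -/
def frame (x₀ : M) (y : Model n) : Model n →L[ℝ] Model n :=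
  mfderiv 𝓘(ℝ, Model n) 𝓘(ℝ, Model n) (extChartAt 𝓘(ℝ, Model n) x₀).symm y

/-- The derivative of the preferred chart at `x₀`. -/
def coframe (x₀ z : M) : Model n →L[ℝ] Model n :=
  mfderiv 𝓘(ℝ, Model n) 𝓘(ℝ, Model n) (extChartAt 𝓘(ℝ, Model n) x₀) z

/-- The vector field with constant coefficients in the preferred chart at `x₀`. -/
def coordField (x₀ : M) (u : Model n) : VField n M := fun z ↦
  frame x₀ (extChartAt 𝓘(ℝ, Model n) x₀ z) u

/-- The value of a vector field, as an element of the model space. -/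
def VField.val (U : VField n M) (x : M) : Model n := U x

/-- The value of a bilinear form, as a bilinear form on the model space. -/
def BilinField.val (g : BilinField n M) (x : M) : Model n →L[ℝ] Model n →L[ℝ] ℝ := g x

/-- The value of a covector field, as a covector on the model space. -/
def CovField.val (β : CovField n M) (x : M) : Model n →L[ℝ] ℝ := β x

/-- The value of an endomorphism field, as an endomorphism of the model space. -/
def EndField.val (A : EndField n M) (x : M) : Model n →L[ℝ] Model n := A x

/-- The value of a form, as a form on the model space. -/
def KForm.val {k : ℕ} (η : KForm n M k) (x : M) : Model n [⋀^Fin k]→L[ℝ] ℝ := η x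

/-- A vector field in the coordinates at `x₀`. -/
def VField.inChart (U : VField n M) (x₀ : M) (y : Model n) : Model n :=
  coframe x₀ ((extChartAt 𝓘(ℝ, Model n) x₀).symm y) (U.val ((extChartAt 𝓘(ℝ, Model n) x₀).symm y))

/-- A bilinear form in the coordinates at `x₀`. -/
def BilinField.inChart (g : BilinField n M) (x₀ : M) (y : Model n) :
    Model n →L[ℝ] Model n →L[ℝ] ℝ :=
  (g.val ((extChartAt 𝓘(ℝ, Model n) x₀).symm y)).bilinearComp (frame x₀ y) (frame x₀ y)

/-- A covector field in the coordinates at `x₀`. -/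
def CovField.inChart (β : CovField n M) (x₀ : M) (y : Model n) : Model n →L[ℝ] ℝ :=
  (β.val ((extChartAt 𝓘(ℝ, Model n) x₀).symm y)).comp (frame x₀ y)

/-- An endomorphism field in the coordinates at `x₀`. -/
def EndField.inChart (A : EndField n M) (x₀ : M) (y : Model n) : Model n →L[ℝ] Model n :=
  (coframe x₀ ((extChartAt 𝓘(ℝ, Model n) x₀).symm y)).comp
    ((A.val ((extChartAt 𝓘(ℝ, Model n) x₀).symm y)).comp (frame x₀ y))

theorem extChartAt_target_mem_nhds_model (x₀ : M) :
    (extChartAt 𝓘(ℝ, Model n) x₀).target ∈ 𝓝 (extChartAt 𝓘(ℝ, Model n) x₀ x₀) :=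
  extChartAt_target_mem_nhds (I := 𝓘(ℝ, Model n)) x₀

theorem contDiffAt_comp_extChartAt_symm {F : Type*} [NormedAddCommGroup F] [NormedSpace ℝ F]
    {φ : M → F} {x₀ : M} (hφ : ContMDiffAt 𝓘(ℝ, Model n) 𝓘(ℝ, F) ∞ φ x₀) :
    ContDiffAt ℝ ∞ (fun y ↦ φ ((extChartAt 𝓘(ℝ, Model n) x₀).symm y))
      (extChartAt 𝓘(ℝ, Model n) x₀ x₀) := by
  have h := (contMDiffAt_iff.1 hφ).2
  rwa [ModelWithCorners.range_eq_univ, contDiffWithinAt_univ] at h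

theorem coordField_symm (x₀ : M) (u : Model n) {y : Model n}
    (hy : y ∈ (extChartAt 𝓘(ℝ, Model n) x₀).target) :
    coordField x₀ u ((extChartAt 𝓘(ℝ, Model n) x₀).symm y) = frame x₀ y u := by
  unfold coordField
  rw [(extChartAt 𝓘(ℝ, Model n) x₀).right_inv hy]

theorem dFun_apply_eq {φ : M → ℝ} {x₀ : M} (hφ : MDifferentiableAt 𝓘(ℝ, Model n) 𝓘(ℝ, ℝ) φ x₀)
    (u : Model n) :
    dFun (n := n) φ x₀ u = fderiv ℝ (fun y ↦ φ ((extChartAt 𝓘(ℝ, Model n) x₀).symm y))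
      (extChartAt 𝓘(ℝ, Model n) x₀ x₀) u := by
  unfold dFun
  rw [hφ.mfderiv]
  simp only [ModelWithCorners.range_eq_univ, fderivWithin_univ]
  rfl

/-- Expanding in a basis of the finite-dimensional source writes `φ` as a finite sum of fixed
continuous linear maps applied to its values on basis vectors. -/
theorem contDiffAt_clm_of_apply {E F G : Type*} [NormedAddCommGroup E] [NormedSpace ℝ E]
    [NormedAddCommGroup F] [NormedSpace ℝ F] [FiniteDimensional ℝ F]
    [NormedAddCommGroup G] [NormedSpace ℝ G] {r : WithTop ℕ∞} {φ : E → F →L[ℝ] G} {x : E}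
    (h : ∀ u, ContDiffAt ℝ r (fun y ↦ φ y u) x) : ContDiffAt ℝ r φ x := by
  let b := Module.finBasis ℝ F
  have key : φ = fun y ↦ ∑ i, (ContinuousLinearMap.smulRightL ℝ F G
      (LinearMap.toContinuousLinearMap (b.coord i))) (φ y (b i)) := by
    funext y
    ext v
    conv_lhs => rw [← b.sum_repr v, map_sum]
    simp
  rw [key]
  exact ContDiffAt.sum fun i _ ↦ (ContinuousLinearMap.contDiff _).contDiffAt.comp x (h (b i))

variable [IsManifold 𝓘(ℝ, Model n) ∞ M]

theorem isManifold_one : IsManifold 𝓘(ℝ, Model n) 1 M :=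
  IsManifold.of_le (n := ∞) (by norm_cast)

theorem coframe_frame (x₀ : M) {y : Model n} (hy : y ∈ (extChartAt 𝓘(ℝ, Model n) x₀).target)
    (u : Model n) : coframe x₀ ((extChartAt 𝓘(ℝ, Model n) x₀).symm y) (frame x₀ y u) = u := by
  have := isManifold_one (M := M) (n := n)
  have h := mfderiv_extChartAt_comp_mfderivWithin_extChartAt_symm (I := 𝓘(ℝ, Model n)) hy
  rw [ModelWithCorners.range_eq_univ, mfderivWithin_univ] at h
  exact DFunLike.congr_fun h u

theorem frame_coframe (x₀ : M) {y : Model n} (hy : y ∈ (extChartAt 𝓘(ℝ, Model n) x₀).target)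
    (u : Model n) : frame x₀ y (coframe x₀ ((extChartAt 𝓘(ℝ, Model n) x₀).symm y) u) = u := by
  have := isManifold_one (M := M) (n := n)
  have h := mfderivWithin_extChartAt_symm_comp_mfderiv_extChartAt (I := 𝓘(ℝ, Model n)) hy
  rw [ModelWithCorners.range_eq_univ, mfderivWithin_univ] at h
  exact DFunLike.congr_fun h u

/-- The tangent space at `x₀` is identified with the model through the preferred chart at `x₀`
itself, so the derivative of that chart at its centre is the identity. Computations at the centre
therefore need no change of frame. -/
theorem frame_self (x₀ : M) (u : Model n) :
    frame x₀ (extChartAt 𝓘(ℝ, Model n) x₀ x₀) u = u := by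
  have := isManifold_one (M := M) (n := n)
  have h := mfderivWithin_range_extChartAt_symm (I := 𝓘(ℝ, Model n)) (x := x₀)
  rw [ModelWithCorners.range_eq_univ, mfderivWithin_univ] at h
  exact DFunLike.congr_fun h u

theorem coframe_self (x₀ : M) (u : Model n) : coframe x₀ x₀ u = u := by
  have := isManifold_one (M := M) (n := n)
  have h := mfderiv_extChartAt_self (I := 𝓘(ℝ, Model n)) (x := x₀)
  exact DFunLike.congr_fun h u

/-- Near `x₀` the trivialization of the tangent bundle is the derivative of the chart at `x₀`. -/
theorem smoothVFieldAt_iff (U : VField n M) (x₀ : M) :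
    SmoothVFieldAt U x₀ ↔
      ContMDiffAt 𝓘(ℝ, Model n) 𝓘(ℝ, Model n) ∞ (fun z ↦ coframe x₀ z (U z)) x₀ := by
  have := isManifold_one (M := M) (n := n)
  unfold SmoothVFieldAt
  refine (Bundle.contMDiffAt_section (E := fun x : M ↦ TangentSpace 𝓘(ℝ, Model n) x)
    (F := Model n) (IB := 𝓘(ℝ, Model n)) (n := ∞) (s := U) x₀).trans ?_
  have hn : ∀ᶠ z in 𝓝 x₀, z ∈ (chartAt (Model n) x₀).source :=
    (chartAt (Model n) x₀).open_source.mem_nhds (mem_chart_source _ _)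
  have key : (fun z ↦ coframe x₀ z (U z)) =ᶠ[𝓝 x₀]
      fun z ↦ (trivializationAt (Model n) (TangentSpace 𝓘(ℝ, Model n) (M := M)) x₀ ⟨z, U z⟩).2 := by
    filter_upwards [hn] with z hz
    have h := TangentBundle.continuousLinearMapAt_trivializationAt (I := 𝓘(ℝ, Model n)) hz
    have h2 := DFunLike.congr_fun h (U z)
    rw [Bundle.Trivialization.continuousLinearMapAt_apply,
      Bundle.Trivialization.coe_linearMapAt_of_mem _ (by simpa using hz)] at h2
    exact h2.symm
  exact ⟨fun h ↦ h.congr_of_eventuallyEq key, fun h ↦ h.congr_of_eventuallyEq key.symm⟩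

theorem SmoothVFieldAt.contDiffAt {U : VField n M} {x₀ : M} (h : SmoothVFieldAt U x₀) :
    ContDiffAt ℝ ∞ (U.inChart x₀) (extChartAt 𝓘(ℝ, Model n) x₀ x₀) :=
  contDiffAt_comp_extChartAt_symm ((smoothVFieldAt_iff U x₀).1 h)

theorem coordField_smooth (x₀ : M) (u : Model n) : SmoothVFieldAt (coordField x₀ u) x₀ := by
  rw [smoothVFieldAt_iff]
  refine (contMDiffAt_const (c := u)).congr_of_eventuallyEq ?_
  filter_upwards [extChartAt_source_mem_nhds (I := 𝓘(ℝ, Model n)) x₀] with z hz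
  have h := coframe_frame x₀ ((extChartAt 𝓘(ℝ, Model n) x₀).map_source hz) u
  rwa [(extChartAt 𝓘(ℝ, Model n) x₀).left_inv hz] at h

theorem coordField_inChart (x₀ : M) (u : Model n) :
    (coordField x₀ u).inChart x₀ =ᶠ[𝓝 (extChartAt 𝓘(ℝ, Model n) x₀ x₀)] fun _ ↦ u := by
  filter_upwards [extChartAt_target_mem_nhds_model x₀] with y hy
  exact (congrArg (coframe x₀ _) (coordField_symm x₀ u hy)).trans (coframe_frame x₀ hy u)

theorem coordField_self (x₀ : M) (u : Model n) : coordField x₀ u x₀ = u := frame_self x₀ u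

theorem VField.inChart_self (U : VField n M) (x₀ : M) :
    U.inChart x₀ (extChartAt 𝓘(ℝ, Model n) x₀ x₀) = U.val x₀ := by
  unfold VField.inChart
  rw [extChartAt_to_inv]
  exact coframe_self x₀ _

theorem frame_inChart (U : VField n M) (x₀ : M) {y : Model n}
    (hy : y ∈ (extChartAt 𝓘(ℝ, Model n) x₀).target) :
    frame x₀ y (U.inChart x₀ y) = U.val ((extChartAt 𝓘(ℝ, Model n) x₀).symm y) :=
  frame_coframe x₀ hy _

theorem SmoothEnd.app_smoothAt {A : EndField n M} (hA : SmoothEnd A) {U : VField n M} {x₀ : M}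
    (hU : SmoothVFieldAt U x₀) : SmoothVFieldAt (A.app U) x₀ :=
  ContMDiffAt.clm_bundle_apply (E₁ := fun x : M ↦ TangentSpace 𝓘(ℝ, Model n) x)
    (E₂ := fun x : M ↦ TangentSpace 𝓘(ℝ, Model n) x) (F₁ := Model n) (F₂ := Model n) (hA x₀) hU

theorem SmoothBilin.apply_smoothAt {g : BilinField n M} (hg : SmoothBilin g) {U V : VField n M}
    {x₀ : M} (hU : SmoothVFieldAt U x₀) (hV : SmoothVFieldAt V x₀) :
    ContMDiffAt 𝓘(ℝ, Model n) 𝓘(ℝ, ℝ) ∞ (fun x ↦ g x (U x) (V x)) x₀ := by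
  have h := ContMDiffAt.clm_bundle_apply₂ (E₁ := fun x : M ↦ TangentSpace 𝓘(ℝ, Model n) x)
    (E₂ := fun x : M ↦ TangentSpace 𝓘(ℝ, Model n) x) (E₃ := Bundle.Trivial M ℝ)
    (F₁ := Model n) (F₂ := Model n) (F₃ := ℝ) (hg x₀) hU hV
  exact (Bundle.contMDiffAt_section (E := Bundle.Trivial M ℝ)
    (F := ℝ) (IB := 𝓘(ℝ, Model n)) (n := ∞) (s := fun x ↦ g x (U x) (V x)) x₀).1 h

theorem SmoothCov.apply_smoothAt {β : CovField n M} (hβ : SmoothCov β) {U : VField n M}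
    {x₀ : M} (hU : SmoothVFieldAt U x₀) :
    ContMDiffAt 𝓘(ℝ, Model n) 𝓘(ℝ, ℝ) ∞ (fun x ↦ β x (U x)) x₀ := by
  have h := ContMDiffAt.clm_bundle_apply (E₁ := fun x : M ↦ TangentSpace 𝓘(ℝ, Model n) x)
    (E₂ := Bundle.Trivial M ℝ) (F₁ := Model n) (F₂ := ℝ) (hβ x₀) hU
  exact (Bundle.contMDiffAt_section (E := Bundle.Trivial M ℝ)
    (F := ℝ) (IB := 𝓘(ℝ, Model n)) (n := ∞) (s := fun x ↦ β x (U x)) x₀).1 h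

/-- Coordinate fields are smooth near the centre, and the matrix entries of the chart expression are
the values of `g` on them. -/
theorem SmoothBilin.contDiffAt {g : BilinField n M} (hg : SmoothBilin g) (x₀ : M) :
    ContDiffAt ℝ ∞ (g.inChart x₀) (extChartAt 𝓘(ℝ, Model n) x₀ x₀) := by
  refine contDiffAt_clm_of_apply fun u ↦ contDiffAt_clm_of_apply fun v ↦ ?_
  refine (contDiffAt_comp_extChartAt_symm
    (hg.apply_smoothAt (coordField_smooth x₀ u) (coordField_smooth x₀ v))).congr_of_eventuallyEq ?_
  filter_upwards [extChartAt_target_mem_nhds_model x₀] with y hy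
  rw [coordField_symm x₀ u hy, coordField_symm x₀ v hy]
  rfl

theorem SmoothCov.contDiffAt {β : CovField n M} (hβ : SmoothCov β) (x₀ : M) :
    ContDiffAt ℝ ∞ (β.inChart x₀) (extChartAt 𝓘(ℝ, Model n) x₀ x₀) := by
  refine contDiffAt_clm_of_apply fun u ↦ ?_
  refine (contDiffAt_comp_extChartAt_symm
    (hβ.apply_smoothAt (coordField_smooth x₀ u))).congr_of_eventuallyEq ?_
  filter_upwards [extChartAt_target_mem_nhds_model x₀] with y hy
  rw [coordField_symm x₀ u hy]
  rfl

theorem SmoothEnd.contDiffAt {A : EndField n M} (hA : SmoothEnd A) (x₀ : M) :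
    ContDiffAt ℝ ∞ (A.inChart x₀) (extChartAt 𝓘(ℝ, Model n) x₀ x₀) := by
  refine contDiffAt_clm_of_apply fun u ↦ ?_
  refine (hA.app_smoothAt (coordField_smooth x₀ u)).contDiffAt.congr_of_eventuallyEq ?_
  filter_upwards [extChartAt_target_mem_nhds_model x₀] with y hy
  exact (congrArg (fun w ↦ coframe x₀ _ (A.val _ w)) (coordField_symm x₀ u hy)).symm

theorem EndField.app_inChart (A : EndField n M) (U : VField n M) (x₀ : M) :
    (A.app U).inChart x₀ =ᶠ[𝓝 (extChartAt 𝓘(ℝ, Model n) x₀ x₀)]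
      fun y ↦ A.inChart x₀ y (U.inChart x₀ y) := by
  filter_upwards [extChartAt_target_mem_nhds_model x₀] with y hy
  have h := frame_inChart U x₀ hy
  unfold EndField.inChart
  rw [ContinuousLinearMap.comp_apply, ContinuousLinearMap.comp_apply, h]
  rfl

theorem EndField.inChart_self (A : EndField n M) (x₀ : M) (u : Model n) :
    A.inChart x₀ (extChartAt 𝓘(ℝ, Model n) x₀ x₀) u = A.val x₀ u := by
  unfold EndField.inChart
  rw [ContinuousLinearMap.comp_apply, ContinuousLinearMap.comp_apply, extChartAt_to_inv, frame_self]
  exact coframe_self x₀ _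

theorem BilinField.inChart_self (g : BilinField n M) (x₀ : M) (u v : Model n) :
    g.inChart x₀ (extChartAt 𝓘(ℝ, Model n) x₀ x₀) u v = g.val x₀ u v := by
  unfold BilinField.inChart
  rw [ContinuousLinearMap.bilinearComp_apply, extChartAt_to_inv, frame_self, frame_self]

theorem CovField.inChart_self (β : CovField n M) (x₀ : M) (u : Model n) :
    β.inChart x₀ (extChartAt 𝓘(ℝ, Model n) x₀ x₀) u = β.val x₀ u := by
  unfold CovField.inChart
  rw [ContinuousLinearMap.comp_apply, extChartAt_to_inv, frame_self]

/-- The manifold bracket is the chart bracket pulled back by the derivative of the chart, which is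
the identity at the centre. -/
theorem mlieBracket_eq_inChart (U V : VField n M) (x₀ : M) :
    mlieBracket 𝓘(ℝ, Model n) U V x₀
      = lieBracket ℝ (U.inChart x₀) (V.inChart x₀) (extChartAt 𝓘(ℝ, Model n) x₀ x₀) := by
  have := isManifold_one (M := M) (n := n)
  have key : ∀ U : VField n M,
      mpullbackWithin 𝓘(ℝ, Model n) 𝓘(ℝ, Model n) (extChartAt 𝓘(ℝ, Model n) x₀).symm U
        (range 𝓘(ℝ, Model n)) =ᶠ[𝓝 (extChartAt 𝓘(ℝ, Model n) x₀ x₀)] U.inChart x₀ := by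
    intro U
    filter_upwards [extChartAt_target_mem_nhds_model x₀] with y hy
    rw [mpullbackWithin_apply, ModelWithCorners.range_eq_univ, mfderivWithin_univ]
    have h1 : (mfderiv 𝓘(ℝ, Model n) 𝓘(ℝ, Model n)
        (extChartAt 𝓘(ℝ, Model n) x₀).symm y).IsInvertible := by
      have := isInvertible_mfderivWithin_extChartAt_symm (I := 𝓘(ℝ, Model n)) hy
      rwa [ModelWithCorners.range_eq_univ, mfderivWithin_univ] at this
    exact (h1.inverse_apply_eq).2 (frame_inChart U x₀ hy).symm
  rw [← mlieBracketWithin_univ, mlieBracketWithin_apply, preimage_univ, univ_inter]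
  have h2 : (mfderiv 𝓘(ℝ, Model n) 𝓘(ℝ, Model n)
      (extChartAt 𝓘(ℝ, Model n) x₀) x₀).IsInvertible :=
    isInvertible_mfderiv_extChartAt (mem_extChartAt_source x₀)
  refine (h2.inverse_apply_eq).2 (Eq.trans (b := lieBracket ℝ (U.inChart x₀) (V.inChart x₀)
    (extChartAt 𝓘(ℝ, Model n) x₀ x₀)) ?_ (coframe_self x₀ _).symm)
  have h3 := ((key U).lieBracket_vectorField (𝕜 := ℝ) (key V)).eq_of_nhds
  rw [ModelWithCorners.range_eq_univ] at h3 ⊢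
  exact (congrFun lieBracketWithin_univ _).trans h3

end Coordinates

/-! ### Smoothness of families of alternating forms, tested on vectors. -/

section FormCriterion

variable {E F : Type*} [NormedAddCommGroup E] [NormedSpace ℝ E]
  [NormedAddCommGroup F] [NormedSpace ℝ F] [FiniteDimensional ℝ F]

theorem finiteDimensional_alternating (k : ℕ) : FiniteDimensional ℝ (F [⋀^Fin k]→L[ℝ] ℝ) := by
  let L : (F [⋀^Fin k]→L[ℝ] ℝ) →ₗ[ℝ] MultilinearMap ℝ (fun _ : Fin k ↦ F) ℝ :=
    { toFun := fun f ↦ f.toContinuousMultilinearMap.toMultilinearMap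
      map_add' := fun _ _ ↦ rfl
      map_smul' := fun _ _ ↦ rfl }
  refine FiniteDimensional.of_injective L fun f g h ↦ ?_
  ext v
  exact DFunLike.congr_fun h v

/-- Evaluations at tuples of vectors separate forms, so in finite dimension they span the dual
space. Every coordinate functional is then a combination of evaluations. -/
theorem contDiffAt_alternating_of_apply {k : ℕ} {r : WithTop ℕ∞}
    {φ : E → F [⋀^Fin k]→L[ℝ] ℝ} {x : E} (h : ∀ v, ContDiffAt ℝ r (fun y ↦ φ y v) x) :
    ContDiffAt ℝ r φ x := by
  have := finiteDimensional_alternating (F := F) k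
  let ev : (Fin k → F) → Module.Dual ℝ (F [⋀^Fin k]→L[ℝ] ℝ) := fun v ↦
    { toFun := fun f ↦ f v
      map_add' := fun _ _ ↦ rfl
      map_smul' := fun _ _ ↦ rfl }
  have htop : Submodule.span ℝ (Set.range ev) = ⊤ := by
    rw [← Subspace.dualCoannihilator_dualAnnihilator_eq (W := Submodule.span ℝ (Set.range ev))]
    have : (Submodule.span ℝ (Set.range ev)).dualCoannihilator = ⊥ := by
      refine (Submodule.eq_bot_iff _).2 fun f hf ↦ ?_
      ext v
      exact (Submodule.mem_dualCoannihilator f).1 hf (ev v) (Submodule.subset_span ⟨v, rfl⟩)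
    rw [this, Submodule.dualAnnihilator_bot]
  have hall : ∀ l : Module.Dual ℝ (F [⋀^Fin k]→L[ℝ] ℝ), ContDiffAt ℝ r (fun y ↦ l (φ y)) x := by
    intro l
    have hl : l ∈ Submodule.span ℝ (Set.range ev) := htop ▸ Submodule.mem_top
    induction hl using Submodule.span_induction with
    | mem l hl => obtain ⟨v, rfl⟩ := hl; exact h v
    | zero => exact contDiffAt_const
    | add a b _ _ ha hb => exact ha.add hb
    | smul c a _ ha => exact contDiffAt_const.mul ha
  let b := Module.finBasis ℝ (F [⋀^Fin k]→L[ℝ] ℝ)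
  have key : φ = fun y ↦ ∑ i, b.coord i (φ y) • b i := by
    funext y
    exact (b.sum_repr (φ y)).symm
  rw [key]
  exact ContDiffAt.sum fun i _ ↦ (hall _).smul contDiffAt_const

/-- Multilinear expansion in a basis reduces evaluation on varying vectors to products of
coordinates with evaluations on fixed vectors. -/
theorem contDiffAt_alternating_apply {k : ℕ} {r : WithTop ℕ∞}
    {φ : E → F [⋀^Fin k]→L[ℝ] ℝ} {c : Fin k → E → F} {x : E} (hφ : ContDiffAt ℝ r φ x)
    (hc : ∀ i, ContDiffAt ℝ r (c i) x) :
    ContDiffAt ℝ r (fun y ↦ φ y (fun i ↦ c i y)) x := by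
  let b := Module.finBasis ℝ F
  have key : (fun y ↦ φ y (fun i ↦ c i y)) = fun y ↦
      ∑ s : Fin k → Fin (Module.finrank ℝ F),
        (∏ i, b.coord (s i) (c i y)) * φ y (fun i ↦ b (s i)) := by
    funext y
    have h1 : (fun i ↦ c i y) = fun i ↦ ∑ j, b.coord j (c i y) • b j := by
      funext i
      exact (b.sum_repr (c i y)).symm
    have h2 := (φ y).toContinuousMultilinearMap.toMultilinearMap.map_sum
      (fun i j ↦ b.coord j (c i y) • b j)
    have h3 : φ y (fun i ↦ ∑ j, b.coord j (c i y) • b j) = _ := h2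
    rw [h1, h3]
    refine Finset.sum_congr rfl fun s _ ↦ ?_
    exact (φ y).toContinuousMultilinearMap.toMultilinearMap.map_smul_univ _ _
  rw [key]
  refine ContDiffAt.sum fun s _ ↦ ContDiffAt.mul (contDiffAt_prod fun i _ ↦ ?_) ?_
  · exact (LinearMap.toContinuousLinearMap (b.coord (s i))).contDiff.contDiffAt.comp x (hc i)
  · let ev : (F [⋀^Fin k]→L[ℝ] ℝ) →ₗ[ℝ] ℝ :=
      { toFun := fun f ↦ f (fun i ↦ b (s i))
        map_add' := fun _ _ ↦ rfl
        map_smul' := fun _ _ ↦ rfl }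
    have := finiteDimensional_alternating (F := F) k
    exact (LinearMap.toContinuousLinearMap ev).contDiff.contDiffAt.comp _ hφ

end FormCriterion

theorem minSmoothness_two_le : minSmoothness ℝ 2 ≤ ∞ := by
  rw [minSmoothness_of_isRCLikeNormedField]
  exact ENat.LEInfty.out

/-! ### Exterior derivative, wedge products and pull-back of forms on manifolds. -/

section Forms

open Set Filter Topology

variable {n : ℕ} {M : Type*} [TopologicalSpace M] [ChartedSpace (Model n) M]

/-- Smoothness of a form near a point, tested in the preferred chart. -/
def KForm.SmoothAt {k : ℕ} (η : KForm n M k) (x : M) : Prop :=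
  ContDiffAt ℝ ∞ (η.inChart x) (extChartAt 𝓘(ℝ, Model n) x x)

/-- The derivative of a map, as a linear map between the model spaces. -/
def dMap {m : ℕ} {P : Type*} [TopologicalSpace P] [ChartedSpace (Model m) P]
    (φ : P → M) (p : P) : Model m →L[ℝ] Model n :=
  mfderiv 𝓘(ℝ, Model m) 𝓘(ℝ, Model n) φ p

/-- The pull-back of a form. -/
def KForm.pullback {k m : ℕ} {P : Type*} [TopologicalSpace P] [ChartedSpace (Model m) P]
    (η : KForm n M k) (φ : P → M) : KForm m P k := fun p ↦
  (η (φ p)).compContinuousLinearMap (mfderiv 𝓘(ℝ, Model m) 𝓘(ℝ, Model n) φ p)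

theorem KForm.inChart_apply {k : ℕ} (η : KForm n M k) (x₀ : M) (y : Model n)
    (v : Fin k → Model n) : η.inChart x₀ y v
      = η.val ((extChartAt 𝓘(ℝ, Model n) x₀).symm y) (fun i ↦ frame x₀ y (v i)) := rfl

theorem KForm.pullback_apply {k m : ℕ} {P : Type*} [TopologicalSpace P] [ChartedSpace (Model m) P]
    (η : KForm n M k) (φ : P → M) (p : P) (v : Fin k → Model m) :
    (η.pullback φ).val p v = η.val (φ p) (fun i ↦ dMap φ p (v i)) :=
  rfl

theorem KForm.Smooth.smoothAt {k : ℕ} {η : KForm n M k} (h : η.Smooth) (x : M) : η.SmoothAt x :=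
  (h x).contDiffAt (extChartAt_target_mem_nhds_model x)

theorem KForm.SmoothAt.differentiableAt {k : ℕ} {η : KForm n M k} {x : M} (h : η.SmoothAt x) :
    DifferentiableAt ℝ (η.inChart x) (extChartAt 𝓘(ℝ, Model n) x x) :=
  ContDiffAt.differentiableAt h (by simp)

theorem KForm.smoothAt_of_apply {k : ℕ} {η : KForm n M k} {x : M}
    (h : ∀ v, ContDiffAt ℝ ∞ (fun y ↦ η.inChart x y v) (extChartAt 𝓘(ℝ, Model n) x x)) :
    η.SmoothAt x :=
  contDiffAt_alternating_of_apply h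

theorem KForm.SmoothAt.apply {k : ℕ} {η : KForm n M k} {x : M} (h : η.SmoothAt x)
    (v : Fin k → Model n) :
    ContDiffAt ℝ ∞ (fun y ↦ η.inChart x y v) (extChartAt 𝓘(ℝ, Model n) x x) :=
  contDiffAt_alternating_apply (c := fun i _ ↦ v i) h fun _ ↦ contDiffAt_const

theorem KForm.add_inChart {k : ℕ} (η ζ : KForm n M k) (x₀ : M) :
    KForm.inChart (fun x ↦ η x + ζ x) x₀ = fun y ↦ η.inChart x₀ y + ζ.inChart x₀ y := rfl

theorem KForm.SmoothAt.add {k : ℕ} {η ζ : KForm n M k} {x : M} (hη : η.SmoothAt x)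
    (hζ : ζ.SmoothAt x) : KForm.SmoothAt (fun x ↦ η x + ζ x) x :=
  ContDiffAt.add hη hζ

theorem KForm.SmoothAt.smul {k : ℕ} {s : M → ℝ} {η : KForm n M k} {x : M}
    (hs : ContMDiffAt 𝓘(ℝ, Model n) 𝓘(ℝ, ℝ) ∞ s x) (hη : η.SmoothAt x) :
    KForm.SmoothAt (fun x ↦ s x • η x) x :=
  ContDiffAt.smul (contDiffAt_comp_extChartAt_symm hs) hη

theorem CovField.toForm_inChart (β : CovField n M) (x₀ : M) (y : Model n) (v : Fin 1 → Model n) :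
    β.toForm.inChart x₀ y v = β.inChart x₀ y (v 0) := rfl

theorem CovField.wedge_inChart (β γ : CovField n M) (x₀ : M) (y : Model n) (v : Fin 2 → Model n) :
    (β.wedge γ).inChart x₀ y v = β.inChart x₀ y (v 0) * γ.inChart x₀ y (v 1)
      - β.inChart x₀ y (v 1) * γ.inChart x₀ y (v 0) := by
  rw [KForm.inChart_apply]
  exact PHKTwist.wedge_apply (E := Model n) _ _ _

theorem CovField.toForm_smoothAt_iff (β : CovField n M) (x : M) : β.toForm.SmoothAt x ↔
    ContDiffAt ℝ ∞ (β.inChart x) (extChartAt 𝓘(ℝ, Model n) x x) :=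
  ⟨fun h ↦ contDiffAt_clm_of_apply fun u ↦ h.apply ![u],
    fun h ↦ KForm.smoothAt_of_apply fun _ ↦ h.clm_apply contDiffAt_const⟩

theorem CovField.wedge_smoothAt {β γ : CovField n M} {x : M} (hβ : β.toForm.SmoothAt x)
    (hγ : γ.toForm.SmoothAt x) : (β.wedge γ).SmoothAt x := by
  rw [CovField.toForm_smoothAt_iff] at hβ hγ
  refine KForm.smoothAt_of_apply fun v ↦ ?_
  simp only [CovField.wedge_inChart]
  exact ((hβ.clm_apply contDiffAt_const).mul (hγ.clm_apply contDiffAt_const)).sub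
    ((hβ.clm_apply contDiffAt_const).mul (hγ.clm_apply contDiffAt_const))

theorem dMap_eq_fderiv {m : ℕ} {P : Type*} [TopologicalSpace P]
    [ChartedSpace (Model m) P] {φ : P → M} {p : P}
    (hφ : MDifferentiableAt 𝓘(ℝ, Model m) 𝓘(ℝ, Model n) φ p) :
    dMap φ p = fderiv ℝ (writtenInExtChartAt 𝓘(ℝ, Model m) 𝓘(ℝ, Model n) p φ)
      (extChartAt 𝓘(ℝ, Model m) p p) := by
  unfold dMap
  rw [hφ.mfderiv, ModelWithCorners.range_eq_univ, fderivWithin_univ]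

theorem frame_modelSpace (y z u : Model n) : frame (M := Model n) y z u = u := by
  have h : frame (M := Model n) y z = fderiv ℝ (extChartAt 𝓘(ℝ, Model n) y).symm z :=
    mfderiv_eq_fderiv
  rw [h, extChartAt_model_space_eq_id]
  exact DFunLike.congr_fun fderiv_id u

theorem contDiffAt_writtenInExtChartAt {m : ℕ} {P : Type*} [TopologicalSpace P]
    [ChartedSpace (Model m) P] {φ : P → M} {p : P}
    (hφ : ContMDiffAt 𝓘(ℝ, Model m) 𝓘(ℝ, Model n) ∞ φ p) :
    ContDiffAt ℝ ∞ (writtenInExtChartAt 𝓘(ℝ, Model m) 𝓘(ℝ, Model n) p φ)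
      (extChartAt 𝓘(ℝ, Model m) p p) := by
  have h := (contMDiffAt_iff.1 hφ).2
  rwa [ModelWithCorners.range_eq_univ, contDiffWithinAt_univ] at h

theorem writtenInExtChartAt_self {m : ℕ} {P : Type*} [TopologicalSpace P]
    [ChartedSpace (Model m) P] (φ : P → M) (p : P) :
    writtenInExtChartAt 𝓘(ℝ, Model m) 𝓘(ℝ, Model n) p φ (extChartAt 𝓘(ℝ, Model m) p p)
      = extChartAt 𝓘(ℝ, Model n) (φ p) (φ p) := by
  simp only [writtenInExtChartAt, Function.comp_apply, extChartAt_to_inv]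

variable [IsManifold 𝓘(ℝ, Model n) ∞ M]

theorem KForm.inChart_self {k : ℕ} (η : KForm n M k) (x : M) :
    η.inChart x (extChartAt 𝓘(ℝ, Model n) x x) = η.val x := by
  ext v
  rw [KForm.inChart_apply, extChartAt_to_inv]
  simp only [frame_self]

theorem KForm.d_eq {k : ℕ} (η : KForm n M k) (x : M) :
    η.d.val x = extDeriv (η.inChart x) (extChartAt 𝓘(ℝ, Model n) x x) := by
  ext v
  change extDeriv (η.inChart x) (extChartAt 𝓘(ℝ, Model n) x x) (fun i ↦ coframe x x (v i)) = _
  simp only [coframe_self]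

theorem KForm.d_apply_one {η : KForm n M 1} {x : M} (h : η.SmoothAt x) (u v : Model n) :
    η.d.val x ![u, v] = fderiv ℝ (fun y ↦ η.inChart x y ![v]) (extChartAt 𝓘(ℝ, Model n) x x) u
      - fderiv ℝ (fun y ↦ η.inChart x y ![u]) (extChartAt 𝓘(ℝ, Model n) x x) v := by
  rw [KForm.d_eq, extDeriv_apply h.differentiableAt, Fin.sum_univ_two]
  have h0 : (0 : Fin 2).removeNth ![u, v] = ![v] := by
    ext i; fin_cases i; rfl
  have h1 : (1 : Fin 2).removeNth ![u, v] = ![u] := by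
    ext i; fin_cases i; rfl
  rw [h0, h1]
  simp [sub_eq_add_neg]

theorem KForm.d_apply_two {η : KForm n M 2} {x : M} (h : η.SmoothAt x) (u v w : Model n) :
    η.d.val x ![u, v, w]
      = fderiv ℝ (fun y ↦ η.inChart x y ![v, w]) (extChartAt 𝓘(ℝ, Model n) x x) u
      - fderiv ℝ (fun y ↦ η.inChart x y ![u, w]) (extChartAt 𝓘(ℝ, Model n) x x) v
      + fderiv ℝ (fun y ↦ η.inChart x y ![u, v]) (extChartAt 𝓘(ℝ, Model n) x x) w := by
  rw [KForm.d_eq, extDeriv_apply h.differentiableAt, Fin.sum_univ_three]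
  have h0 : (0 : Fin 3).removeNth ![u, v, w] = ![v, w] := by
    ext i; fin_cases i <;> rfl
  have h1 : (1 : Fin 3).removeNth ![u, v, w] = ![u, w] := by
    ext i; fin_cases i <;> rfl
  have h2 : (2 : Fin 3).removeNth ![u, v, w] = ![u, v] := by
    ext i; fin_cases i <;> rfl
  rw [h0, h1, h2]
  simp [sub_eq_add_neg]

theorem KForm.d_add {k : ℕ} {η ζ : KForm n M k} {x : M} (hη : η.SmoothAt x)
    (hζ : ζ.SmoothAt x) : KForm.d (fun x ↦ η x + ζ x) x = η.d x + ζ.d x := by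
  change KForm.val (KForm.d _) x = η.d.val x + ζ.d.val x
  rw [KForm.d_eq, KForm.d_eq, KForm.d_eq, KForm.add_inChart]
  exact extDeriv_fun_add hη.differentiableAt hζ.differentiableAt

theorem KForm.d_const_smul {k : ℕ} (c : ℝ) (η : KForm n M k) (x : M) :
    KForm.d (fun x ↦ c • η x) x = c • η.d x := by
  change KForm.val (KForm.d _) x = c • η.d.val x
  rw [KForm.d_eq, KForm.d_eq]
  exact extDeriv_fun_smul c (η.inChart x)

theorem fderiv_smul_inChart {k : ℕ} {s : M → ℝ} {η : KForm n M k} {x : M}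
    (hs : ContMDiffAt 𝓘(ℝ, Model n) 𝓘(ℝ, ℝ) ∞ s x) (hη : η.SmoothAt x) (v : Fin k → Model n)
    (u : Model n) :
    fderiv ℝ (fun y ↦ KForm.inChart (fun x ↦ s x • η x) x y v) (extChartAt 𝓘(ℝ, Model n) x x) u
      = dFun (n := n) s x u * η.val x v + s x *
        fderiv ℝ (fun y ↦ η.inChart x y v) (extChartAt 𝓘(ℝ, Model n) x x) u := by
  have h1 := (contDiffAt_comp_extChartAt_symm hs).differentiableAt (by simp)
  have h2 := (hη.apply v).differentiableAt (by simp)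
  have h3 := fderiv_fun_mul h1 h2
  rw [dFun_apply_eq (hs.mdifferentiableAt (by simp))]
  change fderiv ℝ (fun y ↦ s ((extChartAt 𝓘(ℝ, Model n) x).symm y) * η.inChart x y v) _ u = _
  rw [h3, extChartAt_to_inv, KForm.inChart_self]
  simp only [add_apply, smul_apply, smul_eq_mul]
  ring

theorem KForm.d_smul_one {s : M → ℝ} {η : KForm n M 1} {x : M}
    (hs : ContMDiffAt 𝓘(ℝ, Model n) 𝓘(ℝ, ℝ) ∞ s x) (hη : η.SmoothAt x) (u v : Model n) :
    KForm.val (KForm.d (fun x ↦ s x • η x)) x ![u, v]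
      = dFun (n := n) s x u * η.val x ![v] - dFun (n := n) s x v * η.val x ![u]
        + s x * η.d.val x ![u, v] := by
  rw [KForm.d_apply_one (hη.smul hs), KForm.d_apply_one hη]
  simp only [fderiv_smul_inChart hs hη]
  ring

theorem KForm.d_smul_two {s : M → ℝ} {η : KForm n M 2} {x : M}
    (hs : ContMDiffAt 𝓘(ℝ, Model n) 𝓘(ℝ, ℝ) ∞ s x) (hη : η.SmoothAt x) (u v w : Model n) :
    KForm.val (KForm.d (fun x ↦ s x • η x)) x ![u, v, w]
      = dFun (n := n) s x u * η.val x ![v, w] - dFun (n := n) s x v * η.val x ![u, w]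
        + dFun (n := n) s x w * η.val x ![u, v] + s x * η.d.val x ![u, v, w] := by
  rw [KForm.d_apply_two (hη.smul hs), KForm.d_apply_two hη]
  simp only [fderiv_smul_inChart hs hη]
  ring

theorem KForm.d_wedge {β γ : CovField n M} {x : M} (hβ : β.toForm.SmoothAt x)
    (hγ : γ.toForm.SmoothAt x) (u v w : Model n) :
    (β.wedge γ).d.val x ![u, v, w]
      = β.toForm.d.val x ![u, v] * γ.val x w - β.toForm.d.val x ![u, w] * γ.val x v
        + β.toForm.d.val x ![v, w] * γ.val x u
        - (β.val x u * γ.toForm.d.val x ![v, w] - β.val x v * γ.toForm.d.val x ![u, w]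
          + β.val x w * γ.toForm.d.val x ![u, v]) := by
  rw [KForm.d_apply_two (CovField.wedge_smoothAt hβ hγ)]
  simp only [KForm.d_apply_one hβ, KForm.d_apply_one hγ, CovField.wedge_inChart,
    CovField.toForm_inChart]
  rw [CovField.toForm_smoothAt_iff] at hβ hγ
  have hb : ∀ u, DifferentiableAt ℝ (fun y ↦ β.inChart x y u) (extChartAt 𝓘(ℝ, Model n) x x) :=
    fun u ↦ (hβ.clm_apply contDiffAt_const).differentiableAt (by simp)
  have hc : ∀ u, DifferentiableAt ℝ (fun y ↦ γ.inChart x y u) (extChartAt 𝓘(ℝ, Model n) x x) :=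
    fun u ↦ (hγ.clm_apply contDiffAt_const).differentiableAt (by simp)
  have key : ∀ a b c : Model n, fderiv ℝ (fun y ↦ β.inChart x y a * γ.inChart x y b
      - β.inChart x y b * γ.inChart x y a) (extChartAt 𝓘(ℝ, Model n) x x) c
      = β.val x a * fderiv ℝ (fun y ↦ γ.inChart x y b) (extChartAt 𝓘(ℝ, Model n) x x) c
        + fderiv ℝ (fun y ↦ β.inChart x y a) (extChartAt 𝓘(ℝ, Model n) x x) c * γ.val x b
        - (β.val x b * fderiv ℝ (fun y ↦ γ.inChart x y a) (extChartAt 𝓘(ℝ, Model n) x x) c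
        + fderiv ℝ (fun y ↦ β.inChart x y b) (extChartAt 𝓘(ℝ, Model n) x x) c * γ.val x a) := by
    intro a b c
    rw [fderiv_fun_sub ((hb a).fun_mul (hc b)) ((hb b).fun_mul (hc a)), fderiv_fun_mul (hb a) (hc b),
      fderiv_fun_mul (hb b) (hc a)]
    simp only [sub_apply, add_apply,
      smul_apply, smul_eq_mul, CovField.inChart_self]
    ring
  simp only [Matrix.cons_val_zero, Matrix.cons_val_one, key]
  ring

/-- This is the chain rule in charts. It turns naturality of `d` on the manifold into naturality of
`extDeriv` on the model space. -/
theorem KForm.pullback_inChart {k m : ℕ} {P : Type*} [TopologicalSpace P]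
    [ChartedSpace (Model m) P] [IsManifold 𝓘(ℝ, Model m) ∞ P] (η : KForm n M k) {φ : P → M} {p : P}
    (hφ : ContinuousAt φ p)
    (hφ' : ∀ᶠ q in 𝓝 p, MDifferentiableAt 𝓘(ℝ, Model m) 𝓘(ℝ, Model n) φ q) :
    (η.pullback φ).inChart p =ᶠ[𝓝 (extChartAt 𝓘(ℝ, Model m) p p)] fun y ↦
      (η.inChart (φ p) (writtenInExtChartAt 𝓘(ℝ, Model m) 𝓘(ℝ, Model n) p φ y)).compContinuousLinearMap
        (fderiv ℝ (writtenInExtChartAt 𝓘(ℝ, Model m) 𝓘(ℝ, Model n) p φ) y) := by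
  have hsymm : Tendsto (extChartAt 𝓘(ℝ, Model m) p).symm (𝓝 (extChartAt 𝓘(ℝ, Model m) p p))
      (𝓝 p) := by
    have := (continuousAt_extChartAt_symm (I := 𝓘(ℝ, Model m)) p).tendsto
    rwa [extChartAt_to_inv] at this
  have hsrc : ∀ᶠ q in 𝓝 p, φ q ∈ (extChartAt 𝓘(ℝ, Model n) (φ p)).source :=
    hφ (extChartAt_source_mem_nhds (I := 𝓘(ℝ, Model n)) (φ p))
  filter_upwards [extChartAt_target_mem_nhds_model p, hsymm.eventually hsrc,
    hsymm.eventually hφ'] with y hy hy1 hy2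
  have hM := isManifold_one (M := M) (n := n)
  have hP := isManifold_one (M := P) (n := m)
  have hd1 : MDifferentiableAt 𝓘(ℝ, Model m) 𝓘(ℝ, Model m) (extChartAt 𝓘(ℝ, Model m) p).symm y := by
    have := mdifferentiableWithinAt_extChartAt_symm (I := 𝓘(ℝ, Model m)) hy
    rwa [ModelWithCorners.range_eq_univ, mdifferentiableWithinAt_univ] at this
  have hd2 : MDifferentiableAt 𝓘(ℝ, Model n) 𝓘(ℝ, Model n) (extChartAt 𝓘(ℝ, Model n) (φ p))
      (φ ((extChartAt 𝓘(ℝ, Model m) p).symm y)) :=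
    mdifferentiableAt_extChartAt (by rwa [extChartAt_source] at hy1)
  have h3 : HasFDerivAt (writtenInExtChartAt 𝓘(ℝ, Model m) 𝓘(ℝ, Model n) p φ)
      ((coframe (φ p) (φ ((extChartAt 𝓘(ℝ, Model m) p).symm y))).comp
        ((dMap φ ((extChartAt 𝓘(ℝ, Model m) p).symm y)).comp (frame p y))) y :=
    hasMFDerivAt_iff_hasFDerivAt.1
      (hd2.hasMFDerivAt.comp y (hy2.hasMFDerivAt.comp y hd1.hasMFDerivAt))
  ext v
  rw [KForm.inChart_apply, KForm.pullback_apply, ContinuousAlternatingMap.compContinuousLinearMap_apply,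
    KForm.inChart_apply]
  have h5 : (extChartAt 𝓘(ℝ, Model n) (φ p)).symm
      (writtenInExtChartAt 𝓘(ℝ, Model m) 𝓘(ℝ, Model n) p φ y)
      = φ ((extChartAt 𝓘(ℝ, Model m) p).symm y) :=
    (extChartAt 𝓘(ℝ, Model n) (φ p)).left_inv hy1
  rw [h5]
  congr 1
  funext i
  have h6 := frame_coframe (φ p) ((extChartAt 𝓘(ℝ, Model n) (φ p)).map_source hy1)
    (dMap φ ((extChartAt 𝓘(ℝ, Model m) p).symm y) (frame p y (v i)))
  rw [(extChartAt 𝓘(ℝ, Model n) (φ p)).left_inv hy1] at h6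
  rw [Function.comp_apply, h3.fderiv]
  exact h6.symm

section Pullback

variable {k m : ℕ} {P : Type*} [TopologicalSpace P]
    [ChartedSpace (Model m) P] [IsManifold 𝓘(ℝ, Model m) ∞ P]
    {η : KForm n M k} {φ : P → M} {p : P}

theorem KForm.SmoothAt.pullback (hη : η.SmoothAt (φ p))
    (hφ : ContMDiffAt 𝓘(ℝ, Model m) 𝓘(ℝ, Model n) ∞ φ p)
    (hφ' : ∀ᶠ q in 𝓝 p, MDifferentiableAt 𝓘(ℝ, Model m) 𝓘(ℝ, Model n) φ q) :
    (η.pullback (m := m) φ).SmoothAt p := by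
  refine KForm.smoothAt_of_apply fun v ↦ ?_
  have h1 := contDiffAt_writtenInExtChartAt hφ
  have h2 : ContDiffAt ℝ ∞ (fderiv ℝ (writtenInExtChartAt 𝓘(ℝ, Model m) 𝓘(ℝ, Model n) p φ))
      (extChartAt 𝓘(ℝ, Model m) p p) := h1.fderiv_right (by simp)
  have h3 : ContDiffAt ℝ ∞ (fun y ↦ η.inChart (φ p)
      (writtenInExtChartAt 𝓘(ℝ, Model m) 𝓘(ℝ, Model n) p φ y)) (extChartAt 𝓘(ℝ, Model m) p p) := by
    refine ContDiffAt.comp (g := η.inChart (φ p)) _ ?_ h1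
    rw [writtenInExtChartAt_self]
    exact hη
  have h4 : ContDiffAt ℝ ∞ (fun y ↦ (η.inChart (φ p)
      (writtenInExtChartAt 𝓘(ℝ, Model m) 𝓘(ℝ, Model n) p φ y)) (fun i ↦
        fderiv ℝ (writtenInExtChartAt 𝓘(ℝ, Model m) 𝓘(ℝ, Model n) p φ) y (v i)))
      (extChartAt 𝓘(ℝ, Model m) p p) :=
    contDiffAt_alternating_apply h3 fun i ↦ h2.clm_apply contDiffAt_const
  refine h4.congr_of_eventuallyEq ?_
  filter_upwards [η.pullback_inChart hφ.continuousAt hφ'] with y hy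
  rw [hy]
  rfl

theorem KForm.d_pullback (hη : η.SmoothAt (φ p))
    (hφ : ContMDiffAt 𝓘(ℝ, Model m) 𝓘(ℝ, Model n) ∞ φ p)
    (hφ' : ∀ᶠ q in 𝓝 p, MDifferentiableAt 𝓘(ℝ, Model m) 𝓘(ℝ, Model n) φ q) :
    (η.pullback (m := m) φ).d p = η.d.pullback φ p := by
  have h1 := contDiffAt_writtenInExtChartAt hφ
  change (η.pullback φ).d.val p = (η.d.pullback φ).val p
  rw [KForm.d_eq, (η.pullback_inChart hφ.continuousAt hφ').extDeriv_eq,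
    extDeriv_pullback (by rw [writtenInExtChartAt_self]; exact hη.differentiableAt) h1
      (minSmoothness_two_le), writtenInExtChartAt_self, ← KForm.d_eq]
  ext v
  rw [KForm.pullback_apply, ContinuousAlternatingMap.compContinuousLinearMap_apply,
    ← dMap_eq_fderiv (hφ.mdifferentiableAt (by simp))]
  rfl

end Pullback

/-- `KForm.d` uses a different chart at every point, so its expression in one fixed chart has to be
identified. This chart independence is naturality of `d` under the inverse of the chart at `x₀`,
viewed as a map out of the model space. -/
theorem KForm.d_inChart {k : ℕ} {η : KForm n M k} (hη : ∀ x, η.SmoothAt x) (x₀ : M) {y : Model n}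
    (hy : y ∈ (extChartAt 𝓘(ℝ, Model n) x₀).target) :
    η.d.inChart x₀ y = extDeriv (η.inChart x₀) y := by
  have h1 : ContMDiffAt 𝓘(ℝ, Model n) 𝓘(ℝ, Model n) ∞ (extChartAt 𝓘(ℝ, Model n) x₀).symm y :=
    (contMDiffOn_extChartAt_symm x₀).contMDiffAt
      ((isOpen_extChartAt_target (I := 𝓘(ℝ, Model n)) x₀).mem_nhds hy)
  have h2 : ∀ᶠ z in 𝓝 y, MDifferentiableAt 𝓘(ℝ, Model n) 𝓘(ℝ, Model n)
      (extChartAt 𝓘(ℝ, Model n) x₀).symm z := by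
    filter_upwards [(isOpen_extChartAt_target (I := 𝓘(ℝ, Model n)) x₀).mem_nhds hy] with z hz
    exact ((contMDiffOn_extChartAt_symm (n := ∞) x₀).contMDiffAt
      ((isOpen_extChartAt_target (I := 𝓘(ℝ, Model n)) x₀).mem_nhds hz)).mdifferentiableAt (by simp)
  have h3 := KForm.d_pullback (hη _) h1 h2
  change (η.pullback (extChartAt 𝓘(ℝ, Model n) x₀).symm).d.val y = η.d.inChart x₀ y at h3
  rw [← h3, KForm.d_eq]
  have h4 : (η.pullback (extChartAt 𝓘(ℝ, Model n) x₀).symm).inChart y = η.inChart x₀ := by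
    funext z
    ext v
    rw [KForm.inChart_apply, KForm.pullback_apply]
    simp only [frame_modelSpace]
    rw [extChartAt_model_space_eq_id]
    rfl
  rw [h4, extChartAt_model_space_eq_id]
  rfl

theorem KForm.SmoothAt.d {k : ℕ} {η : KForm n M k} (hη : ∀ x, η.SmoothAt x) (x : M) :
    η.d.SmoothAt x := by
  have hc : ContDiff ℝ ∞ (ContinuousAlternatingMap.alternatizeUncurryFinCLM ℝ (Model n) ℝ (n := k)) :=
    ContinuousLinearMap.contDiff _
  have h : ContDiffAt ℝ ∞ (extDeriv (η.inChart x)) (extChartAt 𝓘(ℝ, Model n) x x) :=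
    hc.contDiffAt.comp _ ((hη x).fderiv_right (m := ∞) (by simp))
  refine h.congr_of_eventuallyEq ?_
  filter_upwards [extChartAt_target_mem_nhds_model x] with y hy
  exact KForm.d_inChart hη x hy

theorem KForm.d_d {k : ℕ} {η : KForm n M k} (hη : ∀ x, η.SmoothAt x) (x : M) :
    η.d.d x = 0 := by
  change η.d.d.val x = 0
  have h : η.d.inChart x =ᶠ[𝓝 (extChartAt 𝓘(ℝ, Model n) x x)] extDeriv (η.inChart x) := by
    filter_upwards [extChartAt_target_mem_nhds_model x] with y hy
    exact KForm.d_inChart hη x hy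
  rw [KForm.d_eq, h.extDeriv_eq]
  exact extDeriv_extDeriv_apply (hη x) (minSmoothness_two_le)

end Forms

/-! ### Hitchin's lemma: closed fundamental forms give integrability. -/

section FlatHitchin

open Filter Topology

variable {E : Type*} [NormedAddCommGroup E] [NormedSpace ℝ E]

theorem fderiv_clm_apply_apply {G F : Type*} [NormedAddCommGroup G] [NormedSpace ℝ G]
    [NormedAddCommGroup F] [NormedSpace ℝ F]
    {A : E → F →L[ℝ] G} {U : E → F} {x : E} (hA : DifferentiableAt ℝ A x)
    (hU : DifferentiableAt ℝ U x) (w : E) :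
    fderiv ℝ (fun y ↦ A y (U y)) x w = fderiv ℝ A x w (U x) + A x (fderiv ℝ U x w) := by
  rw [fderiv_clm_apply hA hU]
  simp [add_comm]

/-- If `B_J = B_K(I·,·)` and `B_K` are closed, with `B_K` non-degenerate, then the Nijenhuis tensor
of the almost complex structure `I` vanishes. -/
theorem nijenhuis_eq_zero_of_closed {ωJ ωK : E → E →L[ℝ] E →L[ℝ] ℝ} {I : E → E →L[ℝ] E} {x : E}
    (hJ : DifferentiableAt ℝ ωJ x) (hK : DifferentiableAt ℝ ωK x) (hI : DifferentiableAt ℝ I x)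
    (hrel : ∀ᶠ y in 𝓝 x, ∀ u v, ωK y (I y u) v = ωJ y u v)
    (hsq : ∀ᶠ y in 𝓝 x, ∀ u, I y (I y u) = -u)
    (haJ : ∀ᶠ y in 𝓝 x, ∀ u v, ωJ y u v = -ωJ y v u)
    (haK : ∀ᶠ y in 𝓝 x, ∀ u v, ωK y u v = -ωK y v u)
    (hcJ : ∀ u v w, fderiv ℝ ωJ x u v w - fderiv ℝ ωJ x v u w + fderiv ℝ ωJ x w u v = 0)
    (hcK : ∀ u v w, fderiv ℝ ωK x u v w - fderiv ℝ ωK x v u w + fderiv ℝ ωK x w u v = 0)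
    (hnd : ∀ u, (∀ w, ωK x u w = 0) → u = 0) (u v : E) :
    fderiv ℝ I x (I x u) v - fderiv ℝ I x (I x v) u + I x (fderiv ℝ I x v u)
      - I x (fderiv ℝ I x u v) = 0 := by
  have hap : ∀ {B : E → E →L[ℝ] E →L[ℝ] ℝ}, DifferentiableAt ℝ B x → ∀ a b w : E,
      fderiv ℝ (fun y ↦ B y a b) x w = fderiv ℝ B x w a b := by
    intro B hB a b w
    rw [fderiv_clm_apply_apply (hB.clm_apply (differentiableAt_const a)) (differentiableAt_const b),
      fderiv_clm_apply_apply hB (differentiableAt_const a)]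
    simp
  have hIap : ∀ a w : E, fderiv ℝ (fun y ↦ I y a) x w = fderiv ℝ I x w a := by
    intro a w
    rw [fderiv_clm_apply_apply hI (differentiableAt_const a)]
    simp
  have dI : ∀ a, DifferentiableAt ℝ (fun y ↦ I y a) x := fun a ↦
    hI.clm_apply (differentiableAt_const a)
  have h1 : ∀ w a b, fderiv ℝ ωK x w (I x a) b + ωK x (fderiv ℝ I x w a) b
      = fderiv ℝ ωJ x w a b := by
    intro w a b
    have e : (fun y ↦ ωK y (I y a) b) =ᶠ[𝓝 x] fun y ↦ ωJ y a b := by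
      filter_upwards [hrel] with y hy using hy a b
    rw [← hap hJ, ← e.fderiv_eq, fderiv_clm_apply_apply (hK.clm_apply (dI a))
      (differentiableAt_const b), fderiv_clm_apply_apply hK (dI a), hIap]
    simp
  have h2 : ∀ w a, fderiv ℝ I x w (I x a) = - I x (fderiv ℝ I x w a) := by
    intro w a
    have e : (fun y ↦ I y (I y a)) =ᶠ[𝓝 x] fun _ ↦ -a := by
      filter_upwards [hsq] with y hy using hy a
    have h := fderiv_clm_apply_apply hI (dI a) w
    rw [e.fderiv_eq, hIap] at h
    simp only [fderiv_fun_const, Pi.zero_apply, zero_apply] at h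
    exact eq_neg_of_add_eq_zero_left h.symm
  have hneg : ∀ {B : E → E →L[ℝ] E →L[ℝ] ℝ}, DifferentiableAt ℝ B x →
      (∀ᶠ y in 𝓝 x, ∀ u v, B y u v = -B y v u) → ∀ w a b,
      fderiv ℝ B x w a b = - fderiv ℝ B x w b a := by
    intro B hB h w a b
    have e : (fun y ↦ B y a b) =ᶠ[𝓝 x] fun y ↦ -B y b a := by
      filter_upwards [h] with y hy using hy a b
    rw [← hap hB, e.fderiv_eq, fderiv_fun_neg, neg_apply, hap hB]
  have h3 := hneg hJ haJ
  have hrel0 := hrel.self_of_nhds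
  have hsq0 := hsq.self_of_nhds
  have haJ0 := haJ.self_of_nhds
  have haK0 := haK.self_of_nhds
  have h4 : ∀ a b, ωK x (I x a) b = ωK x a (I x b) := fun a b ↦ by
    rw [hrel0, haJ0, ← hrel0, haK0]
    simp
  have h5 : ∀ w a b, fderiv ℝ ωJ x w (I x a) b
      = - fderiv ℝ ωK x w a b - ωK x (fderiv ℝ I x w a) (I x b) := by
    intro w a b
    rw [← h1, hsq0, h2, ← h4]
    simp [sub_eq_add_neg]
  -- The Nijenhuis expression is paired with `w` by the non-degenerate `ωK`. Closedness of `ωJ` on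
  -- `(Iu, v, w)` and `(Iv, u, w)`, and of `ωK` on `(Iu, Iv, w)` and `(u, v, w)`, together with the
  -- derivatives of `ωK(I·,·) = ωJ` and `I² = -1`, cancels every term.
  refine hnd _ fun w ↦ ?_
  have e1 := h1 (I x u) v w
  have e2 := h1 (I x v) u w
  have e5 := h1 w u (I x v)
  have c1 := hcJ (I x u) v w
  have c2 := hcJ (I x v) u w
  have c3 := hcK (I x u) (I x v) w
  have c4 := hcK u v w
  have f1 := h5 w u v
  have f2 := h5 v u w
  have f3 := h5 u v w
  have f4 := h3 w (I x v) u
  simp only [map_sub, map_add, sub_apply, add_apply, h4]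
  linear_combination e1 - e2 + e5 + c1 - c2 - c3 + c4 - f1 + f2 - f3 + f4

end FlatHitchin

/-! ### Fundamental two-forms of almost hyper-Hermitian structures. -/

section TwoForms

open Set Filter Topology VectorField

variable {n : ℕ} {M : Type*} [TopologicalSpace M] [ChartedSpace (Model n) M]

/-- The antisymmetric part of a bilinear form, as a `2`-form. -/
def skewForm {E : Type*} [NormedAddCommGroup E] [NormedSpace ℝ E] (B : E →L[ℝ] E →L[ℝ] ℝ) :
    E [⋀^Fin 2]→L[ℝ] ℝ :=
  (1 / 2 : ℝ) • ContinuousAlternatingMap.alternatizeUncurryFin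
    ((ContinuousAlternatingMap.ofSubsingletonLIE (𝕜 := ℝ) (E := E) (F := ℝ) (0 : Fin 1)).toContinuousLinearEquiv.toContinuousLinearMap.comp
      B)

theorem skewForm_apply {E : Type*} [NormedAddCommGroup E] [NormedSpace ℝ E]
    (B : E →L[ℝ] E →L[ℝ] ℝ) (u v : E) : skewForm B ![u, v] = (1 / 2) * (B u v - B v u) := by
  simp [skewForm, ContinuousAlternatingMap.alternatizeUncurryFin_apply, Fin.sum_univ_two,
    Fin.removeNth, sub_eq_add_neg, ContinuousAlternatingMap.ofSubsingletonLIE]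

theorem alternating_two_ext {E : Type*} [NormedAddCommGroup E] [NormedSpace ℝ E]
    {η ζ : E [⋀^Fin 2]→L[ℝ] ℝ} (h : ∀ u v, η ![u, v] = ζ ![u, v]) : η = ζ := by
  ext w
  have : w = ![w 0, w 1] := by
    funext i
    fin_cases i <;> rfl
  rw [this, h]

theorem alternating_three_ext {E : Type*} [NormedAddCommGroup E] [NormedSpace ℝ E]
    {η ζ : E [⋀^Fin 3]→L[ℝ] ℝ} (h : ∀ u v w, η ![u, v, w] = ζ ![u, v, w]) : η = ζ := by
  ext w
  have : w = ![w 0, w 1, w 2] := by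
    funext i
    fin_cases i <;> rfl
  rw [this, h]

/-- The fundamental two-form `g(A·,·)`. -/
def kahlerForm (g : BilinField n M) (A : EndField n M) : KForm n M 2 := fun x ↦
  skewForm (E := Model n) ((g.val x).comp (A.val x))

theorem kahlerForm_val (g : BilinField n M) (A : EndField n M) (x : M) (u v : Model n) :
    (kahlerForm g A).val x ![u, v]
      = (1 / 2) * (g.val x (A.val x u) v - g.val x (A.val x v) u) :=
  skewForm_apply _ _ _

/-- An almost hyper-Hermitian structure for a metric of arbitrary signature. -/
structure AlmostHyperHermitian [IsManifold 𝓘(ℝ, Model n) ∞ M]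
    (g : BilinField n M) (I J K : EndField n M) : Prop where
  smooth_g : SmoothBilin g
  smooth_I : SmoothEnd I
  smooth_J : SmoothEnd J
  smooth_K : SmoothEnd K
  symm : ∀ x u v, g.val x u v = g.val x v u
  nondegenerate : ∀ x u, (∀ v, g.val x u v = 0) → u = 0
  sq_I : ∀ x u, I.val x (I.val x u) = -u
  sq_J : ∀ x u, J.val x (J.val x u) = -u
  sq_K : ∀ x u, K.val x (K.val x u) = -u
  herm_I : ∀ x u v, g.val x (I.val x u) (I.val x v) = g.val x u v
  herm_J : ∀ x u v, g.val x (J.val x u) (J.val x v) = g.val x u v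
  herm_K : ∀ x u v, g.val x (K.val x u) (K.val x v) = g.val x u v
  I_J : ∀ x u, I.val x (J.val x u) = K.val x u
  J_I : ∀ x u, J.val x (I.val x u) = -K.val x u

variable [IsManifold 𝓘(ℝ, Model n) ∞ M]

namespace AlmostHyperHermitian

variable {g : BilinField n M} {I J K : EndField n M} (h : AlmostHyperHermitian g I J K)
include h

theorem J_K (x : M) (u : Model n) : J.val x (K.val x u) = I.val x u := by
  rw [← h.I_J, h.J_I, ← h.I_J, h.sq_J]
  simp

theorem K_J (x : M) (u : Model n) : K.val x (J.val x u) = -I.val x u := by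
  rw [← h.I_J, h.sq_J]
  simp

/-- Cyclic symmetry: results proved for `I` are transferred to `J` and `K` by applying this once or
twice. -/
theorem rotate : AlmostHyperHermitian g J K I :=
  ⟨h.smooth_g, h.smooth_J, h.smooth_K, h.smooth_I, h.symm, h.nondegenerate, h.sq_J, h.sq_K, h.sq_I,
    h.herm_J, h.herm_K, h.herm_I, h.J_K, h.K_J⟩

theorem skew_I (x : M) (u v : Model n) : g.val x (I.val x u) v = - g.val x u (I.val x v) := by
  rw [← h.herm_I x (I.val x u) v, h.sq_I]
  simp

/-- The antisymmetrization built into `kahlerForm` changes nothing here, since `g(I·,·)` is already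
skew. -/
theorem kahlerForm_I (x : M) (u v : Model n) :
    (kahlerForm g I).val x ![u, v] = g.val x (I.val x u) v := by
  rw [kahlerForm_val, h.skew_I x v, h.symm x v]
  ring

end AlmostHyperHermitian

end TwoForms

/-! ### Pseudo-hyperKähler structures and tri-holomorphic isometries in coordinates. -/

section Structures

open Set Filter Topology VectorField

variable {n : ℕ} {M : Type*} [TopologicalSpace M] [ChartedSpace (Model n) M]
  [IsManifold 𝓘(ℝ, Model n) ∞ M]

/-- The bilinear form `g(A·,·)` in the coordinates at `x₀`. -/
def kahlerChart (g : BilinField n M) (A : EndField n M) (x₀ : M) (y : Model n) :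
    Model n →L[ℝ] Model n →L[ℝ] ℝ := (g.inChart x₀ y).comp (A.inChart x₀ y)

theorem kahlerChart_apply (g : BilinField n M) (A : EndField n M) (x₀ : M) {y : Model n}
    (hy : y ∈ (extChartAt 𝓘(ℝ, Model n) x₀).target) (u v : Model n) :
    kahlerChart g A x₀ y u v = g.val ((extChartAt 𝓘(ℝ, Model n) x₀).symm y)
      (A.val ((extChartAt 𝓘(ℝ, Model n) x₀).symm y) (frame x₀ y u)) (frame x₀ y v) := by
  unfold kahlerChart BilinField.inChart EndField.inChart
  rw [ContinuousLinearMap.comp_apply, ContinuousLinearMap.bilinearComp_apply,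
    ContinuousLinearMap.comp_apply, ContinuousLinearMap.comp_apply, frame_coframe x₀ hy]

theorem kahlerChart_self (g : BilinField n M) (A : EndField n M) (x : M) (u v : Model n) :
    kahlerChart g A x (extChartAt 𝓘(ℝ, Model n) x x) u v = g.val x (A.val x u) v := by
  rw [kahlerChart_apply g A x (mem_extChartAt_target x), extChartAt_to_inv, frame_self, frame_self]

theorem kahlerChart_contDiffAt {g : BilinField n M} {A : EndField n M} (hg : SmoothBilin g)
    (hA : SmoothEnd A) (x : M) :
    ContDiffAt ℝ ∞ (kahlerChart g A x) (extChartAt 𝓘(ℝ, Model n) x x) :=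
  (hg.contDiffAt x).clm_comp (hA.contDiffAt x)

theorem kahlerForm_smoothAt {g : BilinField n M} {A : EndField n M} (hg : SmoothBilin g)
    (hA : SmoothEnd A) (x : M) : (kahlerForm g A).SmoothAt x := by
  refine KForm.smoothAt_of_apply fun v ↦ ?_
  have hB := kahlerChart_contDiffAt hg hA x
  have h : ContDiffAt ℝ ∞ (fun y ↦ (1 / 2) * (kahlerChart g A x y (v 0) (v 1)
      - kahlerChart g A x y (v 1) (v 0))) (extChartAt 𝓘(ℝ, Model n) x x) :=
    contDiffAt_const.mul
      (((hB.clm_apply contDiffAt_const).clm_apply contDiffAt_const).sub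
        ((hB.clm_apply contDiffAt_const).clm_apply contDiffAt_const))
  refine h.congr_of_eventuallyEq ?_
  filter_upwards [extChartAt_target_mem_nhds_model x] with y hy
  rw [kahlerChart_apply g A x hy, kahlerChart_apply g A x hy, KForm.inChart_apply, ← kahlerForm_val]
  congr 1
  funext i
  fin_cases i <;> rfl

theorem fderiv_apply_apply {B : Model n → Model n →L[ℝ] Model n →L[ℝ] ℝ} {y₀ : Model n}
    (hB : DifferentiableAt ℝ B y₀) (w u v : Model n) :
    fderiv ℝ (fun y ↦ B y u v) y₀ w = fderiv ℝ B y₀ w u v := by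
  rw [fderiv_clm_apply_apply (hB.clm_apply (differentiableAt_const u)) (differentiableAt_const v),
    fderiv_clm_apply_apply hB (differentiableAt_const u)]
  simp

namespace AlmostHyperHermitian

variable {g : BilinField n M} {I J K : EndField n M} (h : AlmostHyperHermitian g I J K)
include h

theorem kahlerForm_inChart (x : M) : ∀ᶠ y in 𝓝 (extChartAt 𝓘(ℝ, Model n) x x), ∀ u v,
    (kahlerForm g I).inChart x y ![u, v] = kahlerChart g I x y u v := by
  filter_upwards [extChartAt_target_mem_nhds_model x] with y hy u v
  rw [kahlerChart_apply g I x hy, KForm.inChart_apply, ← h.kahlerForm_I]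
  congr 1
  funext i
  fin_cases i <;> rfl

theorem fderiv_kahlerForm (x : M) (w u v : Model n) :
    fderiv ℝ (fun y ↦ (kahlerForm g I).inChart x y ![u, v]) (extChartAt 𝓘(ℝ, Model n) x x) w
      = fderiv ℝ (kahlerChart g I x) (extChartAt 𝓘(ℝ, Model n) x x) w u v := by
  rw [← fderiv_apply_apply
    ((kahlerChart_contDiffAt h.smooth_g h.smooth_I x).differentiableAt (by simp))]
  have e : (fun y ↦ (kahlerForm g I).inChart x y ![u, v])
      =ᶠ[𝓝 (extChartAt 𝓘(ℝ, Model n) x x)] fun y ↦ kahlerChart g I x y u v := by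
    filter_upwards [h.kahlerForm_inChart x] with y hy using hy u v
  rw [e.fderiv_eq]

theorem d_kahlerForm (x : M) (u v w : Model n) :
    (kahlerForm g I).d.val x ![u, v, w]
      = fderiv ℝ (kahlerChart g I x) (extChartAt 𝓘(ℝ, Model n) x x) u v w
        - fderiv ℝ (kahlerChart g I x) (extChartAt 𝓘(ℝ, Model n) x x) v u w
        + fderiv ℝ (kahlerChart g I x) (extChartAt 𝓘(ℝ, Model n) x x) w u v := by
  rw [KForm.d_apply_two (kahlerForm_smoothAt h.smooth_g h.smooth_I x), h.fderiv_kahlerForm,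
    h.fderiv_kahlerForm, h.fderiv_kahlerForm]

theorem skew_chart (x : M) {y : Model n} (hy : y ∈ (extChartAt 𝓘(ℝ, Model n) x).target)
    (u v : Model n) : kahlerChart g I x y u v = - kahlerChart g I x y v u := by
  rw [kahlerChart_apply g I x hy, kahlerChart_apply g I x hy, h.skew_I, h.symm]

theorem nijenhuis_chart (hJ : ∀ x, (kahlerForm g J).d x = 0) (hK : ∀ x, (kahlerForm g K).d x = 0)
    (x : M) (u v : Model n) :
    fderiv ℝ (I.inChart x) (extChartAt 𝓘(ℝ, Model n) x x) (I.val x u) v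
      - fderiv ℝ (I.inChart x) (extChartAt 𝓘(ℝ, Model n) x x) (I.val x v) u
      + I.val x (fderiv ℝ (I.inChart x) (extChartAt 𝓘(ℝ, Model n) x x) v u)
      - I.val x (fderiv ℝ (I.inChart x) (extChartAt 𝓘(ℝ, Model n) x x) u v) = 0 := by
  have key := nijenhuis_eq_zero_of_closed (ωJ := kahlerChart g J x) (ωK := kahlerChart g K x)
    (I := I.inChart x) (x := extChartAt 𝓘(ℝ, Model n) x x)
    ((kahlerChart_contDiffAt h.smooth_g h.smooth_J x).differentiableAt (by simp))
    ((kahlerChart_contDiffAt h.smooth_g h.smooth_K x).differentiableAt (by simp))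
    ((h.smooth_I.contDiffAt x).differentiableAt (by simp))
  have hframe : ∀ {y}, y ∈ (extChartAt 𝓘(ℝ, Model n) x).target → ∀ a, frame x y (I.inChart x y a)
      = I.val ((extChartAt 𝓘(ℝ, Model n) x).symm y) (frame x y a) := by
    intro y hy a
    unfold EndField.inChart
    rw [ContinuousLinearMap.comp_apply, ContinuousLinearMap.comp_apply, frame_coframe x hy]
  have := key
    (by
      filter_upwards [extChartAt_target_mem_nhds_model x] with y hy a b
      rw [kahlerChart_apply g J x hy, kahlerChart_apply g K x hy, hframe hy, h.rotate.rotate.I_J])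
    (by
      filter_upwards [extChartAt_target_mem_nhds_model x] with y hy a
      have h1 : I.inChart x y (I.inChart x y a)
          = coframe x ((extChartAt 𝓘(ℝ, Model n) x).symm y)
            (I.val ((extChartAt 𝓘(ℝ, Model n) x).symm y) (frame x y (I.inChart x y a))) := rfl
      rw [h1, hframe hy, h.sq_I, map_neg, coframe_frame x hy])
    (by
      filter_upwards [extChartAt_target_mem_nhds_model x] with y hy a b
      exact h.rotate.skew_chart x hy a b)
    (by
      filter_upwards [extChartAt_target_mem_nhds_model x] with y hy a b
      exact h.rotate.rotate.skew_chart x hy a b)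
    (fun a b c ↦ by
      rw [← h.rotate.d_kahlerForm]
      exact DFunLike.congr_fun (hJ x) ![a, b, c])
    (fun a b c ↦ by
      rw [← h.rotate.rotate.d_kahlerForm]
      exact DFunLike.congr_fun (hK x) ![a, b, c])
    (fun a ha ↦ by
      simp only [kahlerChart_self] at ha
      have h1 := h.nondegenerate x _ ha
      have h2 := h.sq_K x a
      rw [h1, map_zero] at h2
      exact neg_eq_zero.1 h2.symm)
    u v
  simp only [EndField.inChart_self] at this
  exact this

/-- The derivatives of `U` and `V` cancel by `I² = -1`. What is left involves only the derivative of
`I`, and `nijenhuis_chart` makes it vanish. -/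
theorem integrable (hJ : ∀ x, (kahlerForm g J).d x = 0) (hK : ∀ x, (kahlerForm g K).d x = 0) :
    Integrable I := by
  intro x U V hU hV
  have dI := (h.smooth_I.contDiffAt x).differentiableAt (by simp)
  have dU := hU.contDiffAt.differentiableAt (by simp)
  have dV := hV.contDiffAt.differentiableAt (by simp)
  have hN := h.nijenhuis_chart hJ hK x (U.val x) (V.val x)
  have eU := I.app_inChart U x
  have eV := I.app_inChart V x
  have e1 := (eU.lieBracket_vectorField (𝕜 := ℝ) eV).eq_of_nhds
  have e2 := (eU.lieBracket_vectorField (𝕜 := ℝ) (EventuallyEq.refl _ (V.inChart x))).eq_of_nhds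
  have e3 := ((EventuallyEq.refl _ (U.inChart x)).lieBracket_vectorField (𝕜 := ℝ) eV).eq_of_nhds
  rw [mlieBracket_eq_inChart, mlieBracket_eq_inChart, mlieBracket_eq_inChart,
    mlieBracket_eq_inChart, e1, e2, e3]
  simp only [lieBracket_eq, fderiv_clm_apply_apply dI dU, fderiv_clm_apply_apply dI dV,
    EndField.inChart_self, VField.inChart_self]
  have hsq := h.sq_I x
  generalize fderiv ℝ (I.inChart x) (extChartAt 𝓘(ℝ, Model n) x x) = S at *
  generalize fderiv ℝ (U.inChart x) (extChartAt 𝓘(ℝ, Model n) x x) = DU at *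
  generalize fderiv ℝ (V.inChart x) (extChartAt 𝓘(ℝ, Model n) x x) = DV at *
  change (S (I.val x (U.val x)) (V.val x) + I.val x (DV (I.val x (U.val x)))
      - (S (I.val x (V.val x)) (U.val x) + I.val x (DU (I.val x (V.val x)))))
    - I.val x (DV (I.val x (U.val x)) - (S (V.val x) (U.val x) + I.val x (DU (V.val x))))
    - I.val x (S (U.val x) (V.val x) + I.val x (DV (U.val x)) - DU (I.val x (V.val x)))
    - (DV (U.val x) - DU (V.val x)) = 0
  simp only [map_sub, map_add, hsq]
  rw [← hN]
  abel

theorem isPseudoHyperKahler (hI : ∀ x, (kahlerForm g I).d x = 0)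
    (hJ : ∀ x, (kahlerForm g J).d x = 0) (hK : ∀ x, (kahlerForm g K).d x = 0) :
    IsPseudoHyperKahler g I J K where
  kahler_I := ⟨h.smooth_g, h.symm, h.nondegenerate, h.smooth_I, h.sq_I, h.integrable hJ hK,
    h.herm_I, _, h.kahlerForm_I, hI⟩
  kahler_J := ⟨h.smooth_g, h.symm, h.nondegenerate, h.smooth_J, h.sq_J, h.rotate.integrable hK hI,
    h.herm_J, _, h.rotate.kahlerForm_I, hJ⟩
  kahler_K := ⟨h.smooth_g, h.symm, h.nondegenerate, h.smooth_K, h.sq_K,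
    h.rotate.rotate.integrable hI hJ, h.herm_K, _, h.rotate.rotate.kahlerForm_I, hK⟩
  I_J := h.I_J
  J_I := h.J_I

end AlmostHyperHermitian

theorem IsPseudoHyperKahler.almostHyperHermitian {g : BilinField n M} {I J K : EndField n M}
    (h : IsPseudoHyperKahler g I J K) : AlmostHyperHermitian g I J K :=
  ⟨h.kahler_I.smooth_metric, h.kahler_I.smooth_complex, h.kahler_J.smooth_complex,
    h.kahler_K.smooth_complex, h.kahler_I.symm, h.kahler_I.nondegenerate, h.kahler_I.sq,
    h.kahler_J.sq, h.kahler_K.sq, h.kahler_I.hermitian, h.kahler_J.hermitian,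
    h.kahler_K.hermitian, h.I_J, h.J_I⟩

/-- The closed form in the definition is only asserted to exist, but a two-form is determined by its
values on pairs. -/
theorem IsPseudoKahler.d_kahlerForm {g : BilinField n M} {A B C : EndField n M}
    (h : IsPseudoKahler g A) (h' : AlmostHyperHermitian g A B C) (x : M) :
    (kahlerForm g A).d x = 0 := by
  obtain ⟨η, h1, h2⟩ := h.closed
  have : kahlerForm g A = η := by
    funext y
    exact alternating_two_ext (E := Model n) fun u v ↦
      (h'.kahlerForm_I y u v).trans (h1 y u v).symm
  rw [this, h2]

theorem IsPseudoHyperKahler.rotate {g : BilinField n M} {I J K : EndField n M}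
    (h : IsPseudoHyperKahler g I J K) : IsPseudoHyperKahler g J K I :=
  ⟨h.kahler_J, h.kahler_K, h.kahler_I, h.almostHyperHermitian.J_K, h.almostHyperHermitian.K_J⟩

theorem IsPseudoHyperKahler.d_kahlerForm {g : BilinField n M} {I J K : EndField n M}
    (h : IsPseudoHyperKahler g I J K) (x : M) : (kahlerForm g I).d x = 0 :=
  h.kahler_I.d_kahlerForm h.almostHyperHermitian x

theorem IsTriholomorphicIsometry.rotate {g : BilinField n M} {I J K : EndField n M}
    {X : VField n M} (h : IsTriholomorphicIsometry g I J K X) :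
    IsTriholomorphicIsometry g J K I X :=
  ⟨h.smooth, h.killing, h.pres_J, h.pres_K, h.pres_I⟩

/-- The exterior derivative of the `1`-form `B(X,·)` in coordinates. -/
theorem d_contraction {β : CovField n M} {x : M} {B : Model n → Model n →L[ℝ] Model n →L[ℝ] ℝ}
    {U : Model n → Model n} (hB : ContDiffAt ℝ ∞ B (extChartAt 𝓘(ℝ, Model n) x x))
    (hU : ContDiffAt ℝ ∞ U (extChartAt 𝓘(ℝ, Model n) x x))
    (hβ : ∀ᶠ y in 𝓝 (extChartAt 𝓘(ℝ, Model n) x x), ∀ u, β.inChart x y u = B y (U y) u) :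
    β.toForm.SmoothAt x ∧ ∀ u v, β.toForm.d.val x ![u, v]
      = fderiv ℝ B (extChartAt 𝓘(ℝ, Model n) x x) u (U (extChartAt 𝓘(ℝ, Model n) x x)) v
        + B (extChartAt 𝓘(ℝ, Model n) x x) (fderiv ℝ U (extChartAt 𝓘(ℝ, Model n) x x) u) v
        - fderiv ℝ B (extChartAt 𝓘(ℝ, Model n) x x) v (U (extChartAt 𝓘(ℝ, Model n) x x)) u
        - B (extChartAt 𝓘(ℝ, Model n) x x) (fderiv ℝ U (extChartAt 𝓘(ℝ, Model n) x x) v) u := by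
  have hs : β.toForm.SmoothAt x := by
    rw [CovField.toForm_smoothAt_iff]
    refine (hB.clm_apply hU).congr_of_eventuallyEq ?_
    filter_upwards [hβ] with y hy
    ext u
    exact hy u
  refine ⟨hs, fun u v ↦ ?_⟩
  have dB := hB.differentiableAt (by simp)
  have dU := hU.differentiableAt (by simp)
  have key : ∀ a b, fderiv ℝ (fun y ↦ β.inChart x y a) (extChartAt 𝓘(ℝ, Model n) x x) b
      = fderiv ℝ B (extChartAt 𝓘(ℝ, Model n) x x) b (U (extChartAt 𝓘(ℝ, Model n) x x)) a
        + B (extChartAt 𝓘(ℝ, Model n) x x) (fderiv ℝ U (extChartAt 𝓘(ℝ, Model n) x x) b) a := by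
    intro a b
    have e : (fun y ↦ β.inChart x y a) =ᶠ[𝓝 (extChartAt 𝓘(ℝ, Model n) x x)]
        fun y ↦ B y (U y) a := by
      filter_upwards [hβ] with y hy using hy a
    rw [e.fderiv_eq, fderiv_clm_apply_apply (dB.clm_apply dU) (differentiableAt_const a),
      fderiv_clm_apply_apply dB dU]
    simp
  rw [KForm.d_apply_one hs]
  simp only [CovField.toForm_inChart, Matrix.cons_val_zero, key]
  ring

theorem mlieBracket_coordField (X : VField n M) (x : M) (u : Model n) :
    mlieBracket 𝓘(ℝ, Model n) X (coordField x u) x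
      = - fderiv ℝ (X.inChart x) (extChartAt 𝓘(ℝ, Model n) x x) u := by
  have e := ((EventuallyEq.refl _ (X.inChart x)).lieBracket_vectorField (𝕜 := ℝ)
    (coordField_inChart x u)).eq_of_nhds
  have h : lieBracket ℝ (X.inChart x) (fun _ ↦ u) (extChartAt 𝓘(ℝ, Model n) x x)
      = - fderiv ℝ (X.inChart x) (extChartAt 𝓘(ℝ, Model n) x x) u := by
    simp only [lieBracket_eq, fderiv_fun_const, Pi.zero_apply, zero_apply, zero_sub]
  exact (mlieBracket_eq_inChart _ _ _).trans (e.trans h)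

/-- The Killing equation is tested on fields `U`, `V` with constant coefficients in the chart, whose
brackets with `X` are `-DX(u)` and `-DX(v)`. -/
theorem fderiv_metric_of_killing {g : BilinField n M} {X : VField n M} (hg : SmoothBilin g)
    (hX : IsKilling g X) (x : M) (u v : Model n) :
    fderiv ℝ (g.inChart x) (extChartAt 𝓘(ℝ, Model n) x x) (X.val x) u v
      = - g.val x (fderiv ℝ (X.inChart x) (extChartAt 𝓘(ℝ, Model n) x x) u) v
        - g.val x u (fderiv ℝ (X.inChart x) (extChartAt 𝓘(ℝ, Model n) x x) v) := by
  have hu := coordField_smooth x u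
  have hv := coordField_smooth x v
  have h := (dFun_apply_eq ((hg.apply_smoothAt hu hv).mdifferentiableAt (by simp))
    (X.val x)).symm.trans (hX x _ _ hu hv)
  rw [mlieBracket_coordField, mlieBracket_coordField, coordField_self, coordField_self] at h
  have e : (fun y ↦ g ((extChartAt 𝓘(ℝ, Model n) x).symm y)
      (coordField x u ((extChartAt 𝓘(ℝ, Model n) x).symm y))
      (coordField x v ((extChartAt 𝓘(ℝ, Model n) x).symm y)))
      =ᶠ[𝓝 (extChartAt 𝓘(ℝ, Model n) x x)] fun y ↦ g.inChart x y u v := by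
    filter_upwards [extChartAt_target_mem_nhds_model x] with y hy
    rw [coordField_symm x u hy, coordField_symm x v hy]
    rfl
  rw [e.fderiv_eq] at h
  refine (fderiv_apply_apply ((hg.contDiffAt x).differentiableAt (by simp)) _ _ _).symm.trans
    (h.trans ?_)
  change g.val x (-_) _ + g.val x _ (-_) = _
  rw [map_neg, map_neg, neg_apply]
  ring

/-- This is `L_X ω_A = 0` in coordinates: the Killing equation is applied to `AU` and `V`, and `A`
is then pulled out of the bracket. -/
theorem fderiv_kahlerChart_of_preserves {g : BilinField n M} {A : EndField n M} {X : VField n M}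
    (hg : SmoothBilin g) (hA : SmoothEnd A) (hX : IsKilling g X) (hXA : PreservesEnd A X) (x : M)
    (u v : Model n) :
    fderiv ℝ (kahlerChart g A x) (extChartAt 𝓘(ℝ, Model n) x x) (X.val x) u v
      = - g.val x (A.val x (fderiv ℝ (X.inChart x) (extChartAt 𝓘(ℝ, Model n) x x) u)) v
        - g.val x (A.val x u) (fderiv ℝ (X.inChart x) (extChartAt 𝓘(ℝ, Model n) x x) v) := by
  have hu := coordField_smooth x u
  have hAu := hA.app_smoothAt hu
  have hv := coordField_smooth x v
  have h := (dFun_apply_eq ((hg.apply_smoothAt hAu hv).mdifferentiableAt (by simp))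
    (X.val x)).symm.trans (hX x _ _ hAu hv)
  rw [hXA x _ hu,
    mlieBracket_coordField, mlieBracket_coordField, coordField_self] at h
  have e : (fun y ↦ g ((extChartAt 𝓘(ℝ, Model n) x).symm y)
      (A.app (coordField x u) ((extChartAt 𝓘(ℝ, Model n) x).symm y))
      (coordField x v ((extChartAt 𝓘(ℝ, Model n) x).symm y)))
      =ᶠ[𝓝 (extChartAt 𝓘(ℝ, Model n) x x)] fun y ↦ kahlerChart g A x y u v := by
    filter_upwards [extChartAt_target_mem_nhds_model x] with y hy
    rw [kahlerChart_apply g A x hy]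
    unfold EndField.app
    rw [coordField_symm x u hy, coordField_symm x v hy]
    rfl
  rw [e.fderiv_eq] at h
  refine (fderiv_apply_apply ((kahlerChart_contDiffAt hg hA x).differentiableAt (by simp))
    _ _ _).symm.trans (h.trans ?_)
  unfold EndField.app
  rw [coordField_self]
  change g.val x (A.val x (-_)) _ + g.val x (A.val x _) (-_) = _
  rw [map_neg, map_neg, map_neg, neg_apply]
  ring

theorem flat_inChart (g : BilinField n M) (X : VField n M) (x : M) :
    ∀ᶠ y in 𝓝 (extChartAt 𝓘(ℝ, Model n) x x), ∀ u,
      (flat g X).inChart x y u = g.inChart x y (X.inChart x y) u := by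
  filter_upwards [extChartAt_target_mem_nhds_model x] with y hy u
  unfold BilinField.inChart
  rw [ContinuousLinearMap.bilinearComp_apply, frame_inChart X x hy]
  rfl

theorem flat_app_inChart (g : BilinField n M) (A : EndField n M) (X : VField n M) (x : M) :
    ∀ᶠ y in 𝓝 (extChartAt 𝓘(ℝ, Model n) x x), ∀ u,
      (flat g (A.app X)).inChart x y u = kahlerChart g A x y (X.inChart x y) u := by
  filter_upwards [extChartAt_target_mem_nhds_model x] with y hy u
  rw [kahlerChart_apply g A x hy, frame_inChart X x hy]
  rfl

theorem flat_smoothAt {g : BilinField n M} {X : VField n M} (hg : SmoothBilin g)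
    (hX : SmoothVField X) (x : M) : (flat g X).toForm.SmoothAt x :=
  (d_contraction (hg.contDiffAt x) (hX x).contDiffAt (flat_inChart g X x)).1

theorem normSq_smoothAt {g : BilinField n M} {X : VField n M} (hg : SmoothBilin g)
    (hX : SmoothVField X) (x : M) :
    ContMDiffAt 𝓘(ℝ, Model n) 𝓘(ℝ, ℝ) ∞ (normSq g X) x :=
  hg.apply_smoothAt (hX x) (hX x)

/-- `X ⌟ dX♭ = -d‖X‖²` for a Killing field `X`. -/
theorem d_flat_apply {g : BilinField n M} {X : VField n M} (hg : SmoothBilin g)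
    (hsymm : ∀ x u v, g.val x u v = g.val x v u) (hX : SmoothVField X) (hK : IsKilling g X)
    (x : M) (v : Model n) :
    (flat g X).toForm.d.val x ![X.val x, v] = - dFun (n := n) (normSq g X) x v := by
  have h := (d_contraction (hg.contDiffAt x) (hX x).contDiffAt (flat_inChart g X x)).2 (X.val x) v
  have dg := (hg.contDiffAt x).differentiableAt (by simp)
  have dX := (hX x).contDiffAt.differentiableAt (by simp)
  rw [VField.inChart_self, BilinField.inChart_self, BilinField.inChart_self,
    fderiv_metric_of_killing hg hK] at h
  have hN : dFun (n := n) (normSq g X) x v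
      = fderiv ℝ (g.inChart x) (extChartAt 𝓘(ℝ, Model n) x x) v (X.val x) (X.val x)
        + 2 * g.val x (fderiv ℝ (X.inChart x) (extChartAt 𝓘(ℝ, Model n) x x) v) (X.val x) := by
    rw [dFun_apply_eq ((normSq_smoothAt hg hX x).mdifferentiableAt (by simp))]
    have e : (fun y ↦ normSq g X ((extChartAt 𝓘(ℝ, Model n) x).symm y))
        =ᶠ[𝓝 (extChartAt 𝓘(ℝ, Model n) x x)]
        fun y ↦ g.inChart x y (X.inChart x y) (X.inChart x y) := by
      filter_upwards [extChartAt_target_mem_nhds_model x] with y hy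
      unfold BilinField.inChart
      rw [ContinuousLinearMap.bilinearComp_apply, frame_inChart X x hy]
      rfl
    rw [e.fderiv_eq, fderiv_clm_apply_apply (dg.clm_apply dX) dX, fderiv_clm_apply_apply dg dX,
      VField.inChart_self, add_apply, BilinField.inChart_self,
      BilinField.inChart_self, hsymm x (X.val x)]
    ring
  rw [h, hN, hsymm x (X.val x)]
  ring

/-- `α_A = g(AX,·)` is closed. -/
theorem d_flat_app {g : BilinField n M} {I J K : EndField n M} {X : VField n M}
    (hM : IsPseudoHyperKahler g I J K) (hX : IsTriholomorphicIsometry g I J K X) (x : M) :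
    (flat g (I.app X)).toForm.d x = 0 := by
  have hA := hM.almostHyperHermitian
  refine alternating_two_ext (E := Model n) fun u v ↦ ?_
  have h := (d_contraction (kahlerChart_contDiffAt hA.smooth_g hA.smooth_I x)
    (hX.smooth x).contDiffAt (flat_app_inChart g I X x)).2 u v
  -- This is Cartan's formula by hand: `d(X ⌟ ω_I) = L_X ω_I - X ⌟ dω_I`, and both terms on the
  -- right vanish.
  have hd := hA.d_kahlerForm x (X.val x) u v
  have hd0 : (kahlerForm g I).d.val x ![X.val x, u, v] = 0 :=
    DFunLike.congr_fun (hM.d_kahlerForm x) _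
  rw [hd0, fderiv_kahlerChart_of_preserves hA.smooth_g hA.smooth_I hX.killing hX.pres_I] at hd
  rw [VField.inChart_self, kahlerChart_self, kahlerChart_self] at h
  refine h.trans ?_
  have hs : g.val x (I.val x u) (fderiv ℝ (X.inChart x) (extChartAt 𝓘(ℝ, Model n) x x) v)
      = - g.val x (I.val x (fderiv ℝ (X.inChart x) (extChartAt 𝓘(ℝ, Model n) x x) v)) u := by
    rw [hA.skew_I, hA.symm]
  rw [hs] at hd
  change _ = (0 : ℝ)
  linarith

end Structures

/-! ### Quaternionic linear algebra in arbitrary signature. -/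

section LinearAlgebra

variable {E : Type*} [NormedAddCommGroup E] [NormedSpace ℝ E]

/-- A hyper-Hermitian structure of arbitrary signature on a vector space. -/
structure HyperHermitianForm (g : E →L[ℝ] E →L[ℝ] ℝ) (I J K : E →L[ℝ] E) : Prop where
  symm : ∀ u v, g u v = g v u
  nondegenerate : ∀ u, (∀ v, g u v = 0) → u = 0
  sq_I : ∀ u, I (I u) = -u
  sq_J : ∀ u, J (J u) = -u
  sq_K : ∀ u, K (K u) = -u
  herm_I : ∀ u v, g (I u) (I v) = g u v
  herm_J : ∀ u v, g (J u) (J v) = g u v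
  herm_K : ∀ u v, g (K u) (K v) = g u v
  I_J : ∀ u, I (J u) = K u
  J_I : ∀ u, J (I u) = -K u

namespace HyperHermitianForm

variable {g : E →L[ℝ] E →L[ℝ] ℝ} {I J K : E →L[ℝ] E}

theorem J_K (h : HyperHermitianForm g I J K) (u : E) : J (K u) = I u := by
  rw [← h.I_J, h.J_I, ← h.I_J, h.sq_J]
  simp

theorem K_J (h : HyperHermitianForm g I J K) (u : E) : K (J u) = -I u := by
  rw [← h.I_J, h.sq_J]
  simp

theorem rotate (h : HyperHermitianForm g I J K) : HyperHermitianForm g J K I :=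
  ⟨h.symm, h.nondegenerate, h.sq_J, h.sq_K, h.sq_I, h.herm_J, h.herm_K, h.herm_I, h.J_K, h.K_J⟩

theorem skew_I (h : HyperHermitianForm g I J K) (u v : E) : g (I u) v = - g u (I v) := by
  rw [← h.herm_I (I u) v, h.sq_I]
  simp

theorem self_I (h : HyperHermitianForm g I J K) (u : E) : g u (I u) = 0 := by
  have h1 := h.skew_I u u
  rw [h.symm] at h1
  linarith

end HyperHermitianForm

/-- Vectors dual to four covectors. -/
structure DualFrame (a b c d : E →L[ℝ] ℝ) where
  (e₀ e₁ e₂ e₃ : E)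
  a0 : a e₀ = 1
  a1 : a e₁ = 0
  a2 : a e₂ = 0
  a3 : a e₃ = 0
  b0 : b e₀ = 0
  b1 : b e₁ = 1
  b2 : b e₂ = 0
  b3 : b e₃ = 0
  c0 : c e₀ = 0
  c1 : c e₁ = 0
  c2 : c e₂ = 1
  c3 : c e₃ = 0
  d0 : d e₀ = 0
  d1 : d e₁ = 0
  d2 : d e₂ = 0
  d3 : d e₃ = 1

/-- Since `X` may be null, it cannot serve as its own dual vector. Take any `w` with `g(X, w) ≠ 0`,
let `(p, q, r, s)` be its pairings with `X, IX, JX, KX`, and apply to `w` the conjugate quaternion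
`p - qI - rJ - sK`. The result pairs with `X` to `p² + q² + r² + s²` and with the other three to
zero. After normalization it gives `e`, and `e, Ie, Je, Ke` is the dual frame. -/
theorem HyperHermitianForm.exists_dualFrame {g : E →L[ℝ] E →L[ℝ] ℝ} {I J K : E →L[ℝ] E}
    (h : HyperHermitianForm g I J K) {X : E} (hX : X ≠ 0) :
    Nonempty (DualFrame (g X) (g (I X)) (g (J X)) (g (K X))) := by
  have hI := h.skew_I
  have hJ := h.rotate.skew_I
  have hK := h.rotate.rotate.skew_I
  have hIJ := h.I_J
  have hJI := h.J_I
  have hJK := h.J_K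
  have hKJ := h.K_J
  have hKI := h.rotate.J_K
  have hIK := h.rotate.K_J
  obtain ⟨w, hw⟩ : ∃ w, g X w ≠ 0 := by
    by_contra hcon
    push Not at hcon
    exact hX (h.nondegenerate X hcon)
  set p := g X w with hp
  set q := g (I X) w with hq
  set r := g (J X) w with hr
  set s := g (K X) w with hs
  have hpos : p ^ 2 + q ^ 2 + r ^ 2 + s ^ 2 ≠ 0 := by positivity
  have gI : g X (I w) = -q := by rw [hq, hI]; ring
  have gJ : g X (J w) = -r := by rw [hr, hJ]; ring
  have gK : g X (K w) = -s := by rw [hs, hK]; ring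
  have v1 : g X (p • w - q • I w - r • J w - s • K w) = p ^ 2 + q ^ 2 + r ^ 2 + s ^ 2 := by
    simp only [map_sub, map_smul, smul_eq_mul, gI, gJ, gK, ← hp]
    ring
  have i1 : g (I X) (I w) = p := h.herm_I X w
  have i2 : g (I X) (J w) = s := by
    rw [hI, hIJ, gK, neg_neg]
  have i3 : g (I X) (K w) = -r := by
    rw [hI, hIK, map_neg, gJ]; ring
  have j1 : g (J X) (I w) = -s := by rw [hJ, hJI, map_neg, gK]; ring
  have j2 : g (J X) (J w) = p := h.herm_J X w
  have j3 : g (J X) (K w) = q := by rw [hJ, hJK, gI]; ring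
  have k1 : g (K X) (I w) = r := by rw [hK, hKI, gJ]; ring
  have k2 : g (K X) (J w) = -q := by rw [hK, hKJ, map_neg, gI]; ring
  have k3 : g (K X) (K w) = p := h.herm_K X w
  have v2 : g (I X) (p • w - q • I w - r • J w - s • K w) = 0 := by
    simp only [map_sub, map_smul, smul_eq_mul, i1, i2, i3, ← hq]
    ring
  have v3 : g (J X) (p • w - q • I w - r • J w - s • K w) = 0 := by
    simp only [map_sub, map_smul, smul_eq_mul, j1, j2, j3, ← hr]
    ring
  have v4 : g (K X) (p • w - q • I w - r • J w - s • K w) = 0 := by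
    simp only [map_sub, map_smul, smul_eq_mul, k1, k2, k3, ← hs]
    ring
  obtain ⟨e, e0, e1, e2, e3⟩ : ∃ e, g X e = 1 ∧ g (I X) e = 0 ∧ g (J X) e = 0 ∧ g (K X) e = 0 :=
    ⟨(p ^ 2 + q ^ 2 + r ^ 2 + s ^ 2)⁻¹ • (p • w - q • I w - r • J w - s • K w),
      by rw [map_smul, v1, smul_eq_mul, inv_mul_cancel₀ hpos], by rw [map_smul, v2, smul_zero],
      by rw [map_smul, v3, smul_zero], by rw [map_smul, v4, smul_zero]⟩
  have f1 : g X (I e) = 0 := by rw [← neg_eq_zero, ← hI, e1]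
  have f2 : g X (J e) = 0 := by rw [← neg_eq_zero, ← hJ, e2]
  have f3 : g X (K e) = 0 := by rw [← neg_eq_zero, ← hK, e3]
  exact ⟨⟨e, I e, J e, K e, e0, f1, f2, f3, e1, by rw [h.herm_I, e0],
    by rw [hI, hIJ, f3, neg_zero], by rw [hI, hIK, map_neg, f2, neg_zero, neg_zero], e2,
    by rw [hJ, hJI, map_neg, f3, neg_zero, neg_zero], by rw [h.herm_J, e0],
    by rw [hJ, hJK, f1, neg_zero], e3, by rw [hK, hKI, f2, neg_zero],
    by rw [hK, hKJ, map_neg, f1, neg_zero, neg_zero], by rw [h.herm_K, e0]⟩⟩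

/-- Applying the conjugate quaternion to a relation `(t₀ + t₁I + t₂J + t₃K) w = 0` gives `(t₀² + t₁²
+ t₂² + t₃²) w = 0`. -/
theorem HyperHermitianForm.linearIndependent {g : E →L[ℝ] E →L[ℝ] ℝ} {I J K : E →L[ℝ] E}
    (h : HyperHermitianForm g I J K) {w : E} (hw : w ≠ 0) :
    LinearIndependent ℝ ![w, I w, J w, K w] := by
  rw [Fintype.linearIndependent_iff]
  intro t ht
  simp only [Fin.sum_univ_four, Matrix.cons_val_zero, Matrix.cons_val_one, Matrix.cons_val] at ht
  have hI := congrArg I ht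
  have hJ := congrArg J ht
  have hK := congrArg K ht
  simp only [map_add, map_smul, map_zero, h.sq_I, h.sq_J, h.sq_K, h.I_J, h.J_I, h.J_K, h.K_J,
    h.rotate.J_K, h.rotate.K_J] at hI hJ hK
  have key : (t 0 ^ 2 + t 1 ^ 2 + t 2 ^ 2 + t 3 ^ 2) • w = 0 := by
    have : (t 0 ^ 2 + t 1 ^ 2 + t 2 ^ 2 + t 3 ^ 2) • w
        = t 0 • (t 0 • w + t 1 • I w + t 2 • J w + t 3 • K w)
          - t 1 • (t 0 • I w + t 1 • -w + t 2 • K w + t 3 • -J w)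
          - t 2 • (t 0 • J w + t 1 • -K w + t 2 • -w + t 3 • I w)
          - t 3 • (t 0 • K w + t 1 • J w + t 2 • -I w + t 3 • -w) := by
      module
    rw [this, ht, hI, hJ, hK]
    simp
  have h0 : t 0 ^ 2 + t 1 ^ 2 + t 2 ^ 2 + t 3 ^ 2 = 0 := (smul_eq_zero.1 key).resolve_right hw
  intro i
  fin_cases i <;> simp only [Fin.zero_eta, Fin.mk_one, Fin.reduceFinMk] <;> nlinarith [sq_nonneg (t 0), sq_nonneg (t 1), sq_nonneg (t 2), sq_nonneg (t 3)]

variable [FiniteDimensional ℝ E]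

theorem exists_ne_zero_of_four_lt_finrank (hn : 4 < Module.finrank ℝ E) (a b c d : E →L[ℝ] ℝ) :
    ∃ w, w ≠ 0 ∧ a w = 0 ∧ b w = 0 ∧ c w = 0 ∧ d w = 0 := by
  let T : E →ₗ[ℝ] (Fin 4 → ℝ) := LinearMap.pi ![a.toLinearMap, b.toLinearMap, c.toLinearMap,
    d.toLinearMap]
  have h1 := T.finrank_range_add_finrank_ker
  have h2 : Module.finrank ℝ (LinearMap.range T) ≤ 4 := by
    simpa using Submodule.finrank_le (LinearMap.range T)
  have h3 : 0 < Module.finrank ℝ (LinearMap.ker T) := by omega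
  obtain ⟨⟨w, hw⟩, hne⟩ := Module.finrank_pos_iff_exists_ne_zero.1 h3
  have hw' := LinearMap.mem_ker.1 hw
  exact ⟨w, fun h ↦ hne (by ext; exact h), congrFun hw' 0, congrFun hw' 1, congrFun hw' 2,
    congrFun hw' 3⟩

/-- The common kernel of the four covectors has codimension exactly 4 by the dual frame, and it is
stable under `I, J, K`. Being non-zero, it contains some `w, Iw, Jw, Kw`, so it has dimension at
least 4. -/
theorem HyperHermitianForm.eight_le_finrank {g : E →L[ℝ] E →L[ℝ] ℝ} {I J K : E →L[ℝ] E}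
    (h : HyperHermitianForm g I J K) (hn : 4 < Module.finrank ℝ E) {X : E} (hX : X ≠ 0) :
    8 ≤ Module.finrank ℝ E := by
  obtain ⟨D⟩ := h.exists_dualFrame hX
  obtain ⟨w, hw, w0, w1, w2, w3⟩ := exists_ne_zero_of_four_lt_finrank hn (g X) (g (I X)) (g (J X))
    (g (K X))
  let T : E →ₗ[ℝ] (Fin 4 → ℝ) := LinearMap.pi ![(g X).toLinearMap, (g (I X)).toLinearMap,
    (g (J X)).toLinearMap, (g (K X)).toLinearMap]
  have hT : Function.Surjective T := by
    intro y
    refine ⟨y 0 • D.e₀ + y 1 • D.e₁ + y 2 • D.e₂ + y 3 • D.e₃, ?_⟩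
    funext i
    fin_cases i <;> simp [T, D.a0, D.a1, D.a2, D.a3, D.b0, D.b1, D.b2, D.b3, D.c0, D.c1, D.c2,
      D.c3, D.d0, D.d1, D.d2, D.d3]
  have h1 := T.finrank_range_add_finrank_ker
  rw [LinearMap.range_eq_top.2 hT, finrank_top, Module.finrank_fin_fun] at h1
  have hmem : ∀ v, g X v = 0 → g (I X) v = 0 → g (J X) v = 0 → g (K X) v = 0 →
      v ∈ LinearMap.ker T := by
    intro v v0 v1 v2 v3
    rw [LinearMap.mem_ker]
    funext i
    fin_cases i
    exacts [v0, v1, v2, v3]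
  have hI := h.skew_I
  have hJ := h.rotate.skew_I
  have hK := h.rotate.rotate.skew_I
  have gI : g X (I w) = 0 := by rw [← neg_eq_zero, ← hI, w1]
  have gJ : g X (J w) = 0 := by rw [← neg_eq_zero, ← hJ, w2]
  have gK : g X (K w) = 0 := by rw [← neg_eq_zero, ← hK, w3]
  have mI : I w ∈ LinearMap.ker T := hmem _ gI (by rw [h.herm_I, w0])
    (by rw [hJ, h.J_I, map_neg, gK]; simp) (by rw [hK, h.rotate.J_K, gJ]; simp)
  have mJ : J w ∈ LinearMap.ker T := hmem _ gJ (by rw [hI, h.I_J, gK]; simp)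
    (by rw [h.herm_J, w0]) (by rw [hK, h.K_J, map_neg, gI]; simp)
  have mK : K w ∈ LinearMap.ker T := hmem _ gK (by rw [hI, h.rotate.K_J, map_neg, gJ]; simp)
    (by rw [hJ, h.J_K, gI]; simp) (by rw [h.herm_K, w0])
  have hsub : Submodule.span ℝ (Set.range ![w, I w, J w, K w]) ≤ LinearMap.ker T := by
    rw [Submodule.span_le]
    rintro _ ⟨i, rfl⟩
    fin_cases i
    exacts [hmem _ w0 w1 w2 w3, mI, mJ, mK]
  have h2 := Submodule.finrank_mono hsub
  rw [finrank_span_eq_card (h.linearIndependent hw), Fintype.card_fin] at h2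
  omega

/-- A non-degenerate `B` embeds an isotropic `U` into its own annihilator. -/
theorem two_mul_finrank_le_of_isotropic (B : E →L[ℝ] E →L[ℝ] ℝ)
    (hB : ∀ u, (∀ v, B u v = 0) → u = 0) (U : Submodule ℝ E)
    (hU : ∀ u ∈ U, ∀ v ∈ U, B u v = 0) : 2 * Module.finrank ℝ U ≤ Module.finrank ℝ E := by
  let L : U →ₗ[ℝ] U.dualAnnihilator :=
    { toFun := fun u ↦ ⟨(B u).toLinearMap,
        (Submodule.mem_dualAnnihilator _).2 fun v hv ↦ hU u u.2 v hv⟩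
      map_add' := fun u v ↦ by ext; simp
      map_smul' := fun c u ↦ by ext; simp }
  have hL : Function.Injective L := by
    refine (injective_iff_map_eq_zero L).2 fun u hu ↦ ?_
    ext
    refine hB u fun v ↦ ?_
    exact DFunLike.congr_fun (congrArg Subtype.val hu) v
  have h1 := LinearMap.finrank_le_finrank_of_injective hL
  have h2 := Subspace.finrank_add_finrank_dualAnnihilator_eq U
  omega

/-- Inserting a vector `u` with `φ u ≠ 0` into `φ ∧ B = 0` shows that `B` vanishes on `ker a ∩ ker b
∩ ker φ`, a subspace of codimension at most 3. Isotropy would then give `2(n - 3) ≤ n`, so `n ≤ 6`.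
-/
theorem eq_zero_on_ker_of_wedge_eq_zero (hn : 8 ≤ Module.finrank ℝ E) (B : E →L[ℝ] E →L[ℝ] ℝ)
    (hB : ∀ u, (∀ v, B u v = 0) → u = 0) (φ a b : E →L[ℝ] ℝ)
    (H : ∀ u v w, a u = 0 → b u = 0 → a v = 0 → b v = 0 → a w = 0 → b w = 0 →
      φ u * B v w - φ v * B u w + φ w * B u v = 0) {u : E} (ha : a u = 0) (hb : b u = 0) :
    φ u = 0 := by
  by_contra hφ
  let T : E →ₗ[ℝ] (Fin 3 → ℝ) := LinearMap.pi ![a.toLinearMap, b.toLinearMap, φ.toLinearMap]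
  have h1 := T.finrank_range_add_finrank_ker
  have h2 : Module.finrank ℝ (LinearMap.range T) ≤ 3 := by
    simpa using Submodule.finrank_le (LinearMap.range T)
  have h3 := two_mul_finrank_le_of_isotropic B hB (LinearMap.ker T) (by
    intro v hv w hw
    rw [LinearMap.mem_ker] at hv hw
    have v0 : a v = 0 := congrFun hv 0
    have v1 : b v = 0 := congrFun hv 1
    have v2 : φ v = 0 := congrFun hv 2
    have w0 : a w = 0 := congrFun hw 0
    have w1 : b w = 0 := congrFun hw 1
    have w2 : φ w = 0 := congrFun hw 2
    have := H u v w ha hb v0 v1 w0 w1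
    rw [v2, w2] at this
    simpa [hφ] using this)
  omega

end LinearAlgebra

/-! ### Solving the twist equations at a point. -/

section PointwiseEquations

variable {E : Type*} [NormedAddCommGroup E] [NormedSpace ℝ E]

/-- A linear form vanishing on `ker b ∩ ker c ∩ ker d` is a combination of `b`, `c`, `d`. -/
theorem DualFrame.eq_combination {a b c d : E →L[ℝ] ℝ} (D : DualFrame a b c d) (L : E →ₗ[ℝ] ℝ)
    (h : ∀ v, b v = 0 → c v = 0 → d v = 0 → L v = 0) (v : E) :
    L v = L D.e₁ * b v + L D.e₂ * c v + L D.e₃ * d v := by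
  have := h (v - b v • D.e₁ - c v • D.e₂ - d v • D.e₃)
    (by simp [D.b1, D.b2, D.b3]) (by simp [D.c1, D.c2, D.c3]) (by simp [D.d1, D.d2, D.d3])
  simp only [map_sub, map_smul, smul_eq_mul] at this
  linarith

theorem alternating_two_swap (η : E [⋀^Fin 2]→L[ℝ] ℝ) (u v : E) : η ![u, v] = - η ![v, u] := by
  have h := η.toAlternatingMap.map_swap ![v, u] (i := 0) (j := 1) (by decide)
  have e : (![v, u] ∘ Equiv.swap 0 1 : Fin 2 → E) = ![u, v] := by
    funext i
    fin_cases i <;> rfl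
  rw [e] at h
  exact h

/-- A two-form vanishing on each of the kernels of `b`, `c`, `d` is zero. -/
theorem DualFrame.eq_zero_of_ker {a b c d : E →L[ℝ] ℝ} (D : DualFrame a b c d)
    (η : E [⋀^Fin 2]→L[ℝ] ℝ) (hb : ∀ u v, b u = 0 → b v = 0 → η ![u, v] = 0)
    (hc : ∀ u v, c u = 0 → c v = 0 → η ![u, v] = 0)
    (hd : ∀ u v, d u = 0 → d v = 0 → η ![u, v] = 0) : η = 0 := by
  let L : E → E →ₗ[ℝ] ℝ := fun v ↦
    { toFun := fun u ↦ η ![u, v]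
      map_add' := fun x y ↦ η.cons_add ![v] x y
      map_smul' := fun t x ↦ η.cons_smul ![v] t x }
  have hL : ∀ u v, L v u = η ![u, v] := fun _ _ ↦ rfl
  have hsw : ∀ u v, L v u = - L u v := fun u v ↦ alternating_two_swap η u v
  -- Any two of `e₁, e₂, e₃` lie in a common kernel, and so do each of them and a vector of `ker b ∩
  -- ker c ∩ ker d`. Up to such a vector, every vector is a combination of `e₁, e₂, e₃`.
  have step : ∀ w, L w D.e₁ = 0 → L w D.e₂ = 0 → L w D.e₃ = 0 →
      (∀ v, b v = 0 → c v = 0 → d v = 0 → L w v = 0) → ∀ v, L w v = 0 := by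
    intro w h1 h2 h3 h4 v
    rw [D.eq_combination (L w) h4 v, h1, h2, h3]
    ring
  have s0 : ∀ w, b w = 0 → c w = 0 → d w = 0 → ∀ v, L w v = 0 := fun w w1 w2 w3 ↦
    step w (hc _ _ D.c1 w2) (hb _ _ D.b2 w1) (hb _ _ D.b3 w1) fun v v1 _ _ ↦ hb _ _ v1 w1
  have s1 : ∀ v, L D.e₁ v = 0 := step _ (hc _ _ D.c1 D.c1) (hd _ _ D.d2 D.d1) (hc _ _ D.c3 D.c1)
    fun v _ v2 _ ↦ hc _ _ v2 D.c1
  have s2 : ∀ v, L D.e₂ v = 0 := step _ (hd _ _ D.d1 D.d2) (hb _ _ D.b2 D.b2) (hb _ _ D.b3 D.b2)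
    fun v v1 _ _ ↦ hb _ _ v1 D.b2
  have s3 : ∀ v, L D.e₃ v = 0 := step _ (hc _ _ D.c1 D.c3) (hb _ _ D.b2 D.b3) (hb _ _ D.b3 D.b3)
    fun v v1 _ _ ↦ hb _ _ v1 D.b3
  refine alternating_two_ext fun u v ↦ ?_
  change L v u = 0
  refine step v ?_ ?_ ?_ (fun w w1 w2 w3 ↦ ?_) u
  · rw [hsw, s1, neg_zero]
  · rw [hsw, s2, neg_zero]
  · rw [hsw, s3, neg_zero]
  · rw [hsw, s0 w w1 w2 w3, neg_zero]

/-- The `3`-form equation satisfied by the twist of the fundamental form with contraction `b`, where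
`c`, `d` are the contractions of the two other fundamental forms. -/
def TwistEquation (B : E →L[ℝ] E →L[ℝ] ℝ) (a b c d φ ψ : E →L[ℝ] ℝ) (h k : ℝ)
    (G F : E [⋀^Fin 2]→L[ℝ] ℝ) : Prop :=
  ∀ u v w, φ u * B v w - φ v * B u w + φ w * B u v
    + (ψ u * (wedge a b ![v, w] + wedge c d ![v, w]) - ψ v * (wedge a b ![u, w] + wedge c d ![u, w])
      + ψ w * (wedge a b ![u, v] + wedge c d ![u, v]))
    + h * (G ![u, v] * b w - G ![u, w] * b v + G ![v, w] * b u)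
    = k * (F ![u, v] * b w - F ![u, w] * b v + F ![v, w] * b u)

/-- After wedging with `b`, the star terms containing `b` disappear, and `p c ∧ d ∧ b` matches `ψ ∧
c ∧ d = p b ∧ c ∧ d`. The form `B` is arbitrary because its coefficient `φ` is zero. -/
theorem twistEquation_of_formula {B : E →L[ℝ] E →L[ℝ] ℝ} {a b c d φ ψ : E →L[ℝ] ℝ} {h k p q r : ℝ}
    {G F : E [⋀^Fin 2]→L[ℝ] ℝ} (hφ : φ = 0) (hψ : ∀ v, ψ v = p * b v + q * c v + r * d v)
    (hF : ∀ u v, k * F ![u, v] = h * G ![u, v] + wedge ψ a ![u, v] + (p * wedge c d ![u, v]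
      + q * wedge d b ![u, v] + r * wedge b c ![u, v])) :
    TwistEquation B a b c d φ ψ h k G F := by
  intro u v w
  have e : ∀ u v w, k * (F ![u, v] * b w - F ![u, w] * b v + F ![v, w] * b u)
      = (k * F ![u, v]) * b w - (k * F ![u, w]) * b v + (k * F ![v, w]) * b u := by
    intro u v w
    ring
  rw [e]
  simp only [hF, wedge_apply, Matrix.cons_val_zero, Matrix.cons_val_one, hψ, hφ, zero_apply]
  ring

variable [FiniteDimensional ℝ E]

/-- The three twist equations force `φ = 0` and determine `ψ` and `kF`. -/
theorem DualFrame.solve_twistEquations {a b c d : E →L[ℝ] ℝ} (D : DualFrame a b c d)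
    (hn : 8 ≤ Module.finrank ℝ E) {B₁ B₂ B₃ : E →L[ℝ] E →L[ℝ] ℝ}
    (hB₁ : ∀ u, (∀ v, B₁ u v = 0) → u = 0) (hB₂ : ∀ u, (∀ v, B₂ u v = 0) → u = 0)
    {φ ψ : E →L[ℝ] ℝ} {h k : ℝ} {G F : E [⋀^Fin 2]→L[ℝ] ℝ}
    (H₁ : TwistEquation B₁ a b c d φ ψ h k G F) (H₂ : TwistEquation B₂ a c d b φ ψ h k G F)
    (H₃ : TwistEquation B₃ a d b c φ ψ h k G F) :
    φ = 0 ∧ ∃ p q r : ℝ, (∀ v, ψ v = p * b v + q * c v + r * d v) ∧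
      ∀ u v, k * F ![u, v] = h * G ![u, v] + wedge ψ a ![u, v] + (p * wedge c d ![u, v]
        + q * wedge d b ![u, v] + r * wedge b c ![u, v]) := by
  simp only [TwistEquation, wedge_apply, Matrix.cons_val_zero, Matrix.cons_val_one] at H₁ H₂ H₃
  -- On `ker b ∩ ker c` every term except `φ ∧ B₁` contains a vanishing factor. The other two pairs
  -- of kernels are treated alike.
  have hbc : ∀ u, b u = 0 → c u = 0 → φ u = 0 := fun u ↦
    eq_zero_on_ker_of_wedge_eq_zero hn B₁ hB₁ φ b c fun u v w u1 u2 v1 v2 w1 w2 ↦ by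
      have := H₁ u v w
      simp only [u1, u2, v1, v2, w1, w2] at this
      linarith
  have hbd : ∀ u, b u = 0 → d u = 0 → φ u = 0 := fun u ↦
    eq_zero_on_ker_of_wedge_eq_zero hn B₁ hB₁ φ b d fun u v w u1 u2 v1 v2 w1 w2 ↦ by
      have := H₁ u v w
      simp only [u1, u2, v1, v2, w1, w2] at this
      linarith
  have hcd : ∀ u, c u = 0 → d u = 0 → φ u = 0 := fun u ↦
    eq_zero_on_ker_of_wedge_eq_zero hn B₂ hB₂ φ c d fun u v w u1 u2 v1 v2 w1 w2 ↦ by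
      have := H₂ u v w
      simp only [u1, u2, v1, v2, w1, w2] at this
      linarith
  have hφ : φ = 0 := by
    ext v
    have := D.eq_combination φ.toLinearMap (fun v v1 v2 _ ↦ hbc v v1 v2) v
    change φ v = φ D.e₁ * b v + φ D.e₂ * c v + φ D.e₃ * d v at this
    rw [this, hcd _ D.c1 D.d1, hbd _ D.b2 D.d2, hbc _ D.b3 D.c3]
    simp
  have hψ : ∀ v, ψ v = ψ D.e₁ * b v + ψ D.e₂ * c v + ψ D.e₃ * d v :=
    D.eq_combination ψ.toLinearMap fun v v1 v2 v3 ↦ by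
      have := H₁ v D.e₂ D.e₃
      simp only [hφ, v1, v2, v3, D.a2, D.a3, D.b2, D.b3, D.c2, D.c3, D.d2, D.d3, zero_apply] at this
      change ψ v = 0
      linarith
  refine ⟨hφ, ψ D.e₁, ψ D.e₂, ψ D.e₃, hψ, ?_⟩
  -- `η` is the error in the claimed formula for `kF`. The first equation amounts to `η ∧ b = 0`, so
  -- inserting `e₁` shows that `η` vanishes on pairs from `ker b`. The other two equations do the
  -- same for `c` and `d`.
  let η : E [⋀^Fin 2]→L[ℝ] ℝ := k • F - h • G - wedge ψ a - (ψ D.e₁ • wedge c d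
    + ψ D.e₂ • wedge d b + ψ D.e₃ • wedge b c)
  have hη : ∀ u v, η ![u, v] = k * F ![u, v] - h * G ![u, v] - wedge ψ a ![u, v]
      - (ψ D.e₁ * wedge c d ![u, v] + ψ D.e₂ * wedge d b ![u, v] + ψ D.e₃ * wedge b c ![u, v]) :=
    fun _ _ ↦ rfl
  have h0 : η = 0 := by
    refine D.eq_zero_of_ker η (fun u v hu hv ↦ ?_) (fun u v hu hv ↦ ?_) fun u v hu hv ↦ ?_
    · have := H₁ u v D.e₁
      simp only [hφ, hu, hv, D.a1, D.b1, D.c1, D.d1, zero_apply] at this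
      simp only [hη, wedge_apply, Matrix.cons_val_zero, Matrix.cons_val_one, hu, hv]
      linarith
    · have := H₂ u v D.e₂
      simp only [hφ, hu, hv, D.a2, D.b2, D.c2, D.d2, zero_apply] at this
      simp only [hη, wedge_apply, Matrix.cons_val_zero, Matrix.cons_val_one, hu, hv]
      linarith
    · have := H₃ u v D.e₃
      simp only [hφ, hu, hv, D.a3, D.b3, D.c3, D.d3, zero_apply] at this
      simp only [hη, wedge_apply, Matrix.cons_val_zero, Matrix.cons_val_one, hu, hv]
      linarith
  intro u v
  have h1 : η ![u, v] = 0 := by rw [h0]; rfl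
  rw [hη] at h1
  linarith

end PointwiseEquations

/-! ### Linear algebra of two projections from one horizontal space. -/

section HorizontalSpaces

variable {E V V' : Type*} [NormedAddCommGroup E] [NormedSpace ℝ E] [NormedAddCommGroup V]
  [NormedSpace ℝ V] [NormedAddCommGroup V'] [NormedSpace ℝ V']

/-- By dimension, `ker D` is the line through `y`, and this line meets `ker t` only in zero. -/
theorem eq_zero_of_horizontal [FiniteDimensional ℝ E] {D : E →L[ℝ] V} {t : E →L[ℝ] ℝ}
    (hD : Function.Surjective D) (hE : Module.finrank ℝ E = Module.finrank ℝ V + 1) {y : E}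
    (hy : D y = 0) (ty : t y ≠ 0) {u : E} (hu : D u = 0) (tu : t u = 0) : u = 0 := by
  have h1 := D.toLinearMap.finrank_range_add_finrank_ker
  rw [LinearMap.range_eq_top.2 hD, finrank_top] at h1
  have h2 : Module.finrank ℝ (LinearMap.ker D.toLinearMap) = 1 := by omega
  have hy0 : (⟨y, LinearMap.mem_ker.2 hy⟩ : LinearMap.ker D.toLinearMap) ≠ 0 := by
    intro h
    have : y = 0 := congrArg Subtype.val h
    exact ty (by rw [this, map_zero])
  obtain ⟨c, hc⟩ := (finrank_eq_one_iff_of_nonzero' _ hy0).1 h2 ⟨u, LinearMap.mem_ker.2 hu⟩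
  have hc' : c • y = u := congrArg Subtype.val hc
  rw [← hc', map_smul, smul_eq_mul] at tu
  rw [← hc', (mul_eq_zero.1 tu).resolve_right ty, zero_smul]

theorem exists_horizontal {D : E →L[ℝ] V} {t : E →L[ℝ] ℝ} (hD : Function.Surjective D) {y : E}
    (hy : D y = 0) (ty : t y ≠ 0) (v : V) : ∃ u, t u = 0 ∧ D u = v := by
  obtain ⟨u, rfl⟩ := hD v
  refine ⟨u - (t u / t y) • y, ?_, by simp [hy]⟩
  rw [map_sub, map_smul, smul_eq_mul, div_mul_cancel₀ _ ty, sub_self]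

/-- Two projections with kernels transverse to a hyperplane induce an isomorphism of the targets. -/
theorem exists_equiv_of_horizontal [FiniteDimensional ℝ E] {D : E →L[ℝ] V} {D' : E →L[ℝ] V'}
    {t : E →L[ℝ] ℝ} (hD : Function.Surjective D)
    (hE : Module.finrank ℝ E = Module.finrank ℝ V + 1) {y : E} (hy : D y = 0) (ty : t y ≠ 0)
    (hD' : Function.Surjective D') (hE' : Module.finrank ℝ E = Module.finrank ℝ V' + 1) {y' : E}
    (hy' : D' y' = 0) (ty' : t y' ≠ 0) :
    ∃ e : V ≃ₗ[ℝ] V', ∀ u, t u = 0 → e (D u) = D' u := by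
  let L : LinearMap.ker t.toLinearMap →ₗ[ℝ] V := D.toLinearMap.domRestrict _
  let L' : LinearMap.ker t.toLinearMap →ₗ[ℝ] V' := D'.toLinearMap.domRestrict _
  have hL : Function.Bijective L := by
    refine ⟨(injective_iff_map_eq_zero L).2 fun u hu ↦ Subtype.ext ?_, fun v ↦ ?_⟩
    · exact eq_zero_of_horizontal hD hE hy ty hu u.2
    · obtain ⟨u, hu, rfl⟩ := exists_horizontal hD hy ty v
      exact ⟨⟨u, hu⟩, rfl⟩
  have hL' : Function.Bijective L' := by
    refine ⟨(injective_iff_map_eq_zero L').2 fun u hu ↦ Subtype.ext ?_, fun v ↦ ?_⟩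
    · exact eq_zero_of_horizontal hD' hE' hy' ty' hu u.2
    · obtain ⟨u, hu, rfl⟩ := exists_horizontal hD' hy' ty' v
      exact ⟨⟨u, hu⟩, rfl⟩
  refine ⟨(LinearEquiv.ofBijective L hL).symm.trans (LinearEquiv.ofBijective L' hL'),
    fun u hu ↦ ?_⟩
  have : (LinearEquiv.ofBijective L hL).symm (D u) = ⟨u, hu⟩ := by
    rw [LinearEquiv.symm_apply_eq]
    rfl
  rw [LinearEquiv.trans_apply, this]
  rfl

theorem alternating_two_sub_smul (η : V [⋀^Fin 2]→L[ℝ] ℝ) (x y z : V) (s t : ℝ) :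
    η ![x - s • z, y - t • z] = η ![x, y] - s * η ![z, y] + t * η ![z, x] := by
  have c1 : ∀ (x x' y : V) (s : ℝ), η ![x - s • x', y] = η ![x, y] - s * η ![x', y] := by
    intro x x' y s
    have e1 : η ![x + (-s) • x', y] = η ![x, y] + η ![(-s) • x', y] := η.cons_add ![y] x _
    have e2 : η ![(-s) • x', y] = -s * η ![x', y] := η.cons_smul ![y] (-s) x'
    rw [sub_eq_add_neg, ← neg_smul, e1, e2]
    ring
  have hz : η ![z, z] = 0 := by linarith [alternating_two_swap η z z]
  rw [c1, alternating_two_swap η x, alternating_two_swap η z (y - t • z), c1, c1,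
    alternating_two_swap η y x, alternating_two_swap η y z, hz]
  ring

theorem HyperHermitianForm.of_equiv {g : V →L[ℝ] V →L[ℝ] ℝ} {I J K : V →L[ℝ] V}
    {g' : V' →L[ℝ] V' →L[ℝ] ℝ} {I' J' K' : V' →L[ℝ] V'} (h : HyperHermitianForm g I J K)
    (e : V ≃ₗ[ℝ] V') (hg : ∀ u v, g' (e u) (e v) = g u v) (hI : ∀ u, I' (e u) = e (I u))
    (hJ : ∀ u, J' (e u) = e (J u)) (hK : ∀ u, K' (e u) = e (K u)) :
    HyperHermitianForm g' I' J' K' where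
  symm := e.surjective.forall₂.2 fun u v ↦ by rw [hg, hg, h.symm]
  nondegenerate := e.surjective.forall.2 fun u hu ↦ by
    rw [h.nondegenerate u fun v ↦ by rw [← hg, hu], map_zero]
  sq_I := e.surjective.forall.2 fun u ↦ by rw [hI, hI, h.sq_I, map_neg]
  sq_J := e.surjective.forall.2 fun u ↦ by rw [hJ, hJ, h.sq_J, map_neg]
  sq_K := e.surjective.forall.2 fun u ↦ by rw [hK, hK, h.sq_K, map_neg]
  herm_I := e.surjective.forall₂.2 fun u v ↦ by rw [hI, hI, hg, hg, h.herm_I]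
  herm_J := e.surjective.forall₂.2 fun u v ↦ by rw [hJ, hJ, hg, hg, h.herm_J]
  herm_K := e.surjective.forall₂.2 fun u v ↦ by rw [hK, hK, hg, hg, h.herm_K]
  I_J := e.surjective.forall.2 fun u ↦ by rw [hJ, hI, hK, h.I_J]
  J_I := e.surjective.forall.2 fun u ↦ by rw [hI, hJ, hK, h.J_I, map_neg]

end HorizontalSpaces

/-! ### Generators of actions and quotient maps. -/

section Quotients

variable {m n : ℕ} {P : Type*} [TopologicalSpace P] [ChartedSpace (Model m) P]
  [IsManifold 𝓘(ℝ, Model m) ∞ P] {B : Type*} [TopologicalSpace B] [ChartedSpace (Model n) B]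

/-- The projection to the quotient by an action kills the generating vector field. -/
theorem IsSmoothQuotient.dMap_generator {T : ℝ} {φ : ℝ → P → P} {Y : VField m P} {π : P → B}
    (hφ : IsCircleAction T φ Y) (hπ : IsSmoothQuotient (m := m) (n := n) φ π) (p : P) :
    dMap (m := m) (n := n) π p (Y.val p) = 0 := by
  have h1 := hφ.generator p 0
  have e : φ 0 p = p := hφ.zero p
  have h2 : HasMFDerivAt 𝓘(ℝ, Model m) 𝓘(ℝ, Model n) π (φ 0 p)
      (mfderiv 𝓘(ℝ, Model m) 𝓘(ℝ, Model n) π (φ 0 p)) :=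
    ((hπ.smooth _).mdifferentiableAt (by simp)).hasMFDerivAt
  have h3 := HasMFDerivAt.comp (0 : ℝ) h2 h1
  have h4 : π ∘ (fun t ↦ φ t p) = fun _ : ℝ ↦ π p :=
    funext fun t ↦ ((hπ.fibre p (φ t p)).2 ⟨t, rfl⟩).symm
  have h5 : HasMFDerivAt 𝓘(ℝ, ℝ) 𝓘(ℝ, Model n) (π ∘ fun t ↦ φ t p) 0
      (0 : TangentSpace 𝓘(ℝ, ℝ) (0 : ℝ) →L[ℝ]
        TangentSpace 𝓘(ℝ, Model n) ((π ∘ fun t ↦ φ t p) 0)) := by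
    have h6 := hasMFDerivAt_const (I := 𝓘(ℝ, ℝ)) (I' := 𝓘(ℝ, Model n)) (π p) (0 : ℝ)
    -- The type of the derivative depends on the curve, so the curve is made a variable before it is
    -- identified with the constant one.
    have : ∀ ξ : ℝ → B, ξ = (fun _ ↦ π p) → HasMFDerivAt 𝓘(ℝ, ℝ) 𝓘(ℝ, Model n) ξ 0
        (0 : TangentSpace 𝓘(ℝ, ℝ) (0 : ℝ) →L[ℝ] TangentSpace 𝓘(ℝ, Model n) (ξ 0)) := by
      rintro _ rfl
      exact h6
    exact this _ h4
  have h7 := hasMFDerivAt_unique h3 h5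
  have h8 : dMap (m := m) (n := n) π (φ 0 p) ((1 : ℝ) • Y.val (φ 0 p)) = 0 :=
    DFunLike.congr_fun h7 (1 : ℝ)
  rw [one_smul, e] at h8
  exact h8

end Quotients

/-! ### Comparing tensors on the base, the total space and the twist. -/

section TwistGeometry

variable {n : ℕ} {M P W : Type*}
    [TopologicalSpace M] [ChartedSpace (Model n) M] [IsManifold 𝓘(ℝ, Model n) ∞ M]
    [TopologicalSpace P] [ChartedSpace (Model (n + 1)) P] [IsManifold 𝓘(ℝ, Model (n + 1)) ∞ P]
    [TopologicalSpace W] [ChartedSpace (Model n) W] [IsManifold 𝓘(ℝ, Model n) ∞ W]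
    {X : VField n M} {a : M → ℝ} {F : KForm n M 2}

namespace Twist

variable (τ : Twist M P W X a F)

/-- The differential of the projection to `M`. -/
def dM (p : P) : Model (n + 1) →L[ℝ] Model n := dMap τ.πM p

/-- The differential of the projection to `W`. -/
def dW (p : P) : Model (n + 1) →L[ℝ] Model n := dMap τ.πW p

/-- The generator `X̃ + aZ` of the lifted action. -/
def lift (p : P) : Model (n + 1) := τ.Xtilde.val p + a (τ.πM p) • τ.Z.val p

theorem dM_surjective (p : P) : Function.Surjective (τ.dM p) := τ.principal_quotient.submersion p

theorem dW_surjective (p : P) : Function.Surjective (τ.dW p) := τ.lifted_quotient.submersion p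

theorem dM_Z (p : P) : τ.dM p (τ.Z.val p) = 0 :=
  τ.principal_quotient.dMap_generator τ.principal_action p

theorem dW_lift (p : P) : τ.dW p (τ.lift p) = 0 :=
  τ.lifted_quotient.dMap_generator τ.lifted_action p

theorem θ_val_Z (p : P) : τ.θ.val p (τ.Z.val p) = 1 := τ.θ_Z p

theorem θ_lift (p : P) : τ.θ.val p (τ.lift p) = a (τ.πM p) := by
  have h : τ.θ.val p (τ.Xtilde.val p) = 0 := τ.Xtilde_horizontal p
  unfold lift
  rw [map_add, map_smul, τ.θ_val_Z, h]
  simp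

theorem dM_lift (p : P) : τ.dM p (τ.lift p) = X.val (τ.πM p) := by
  have h : τ.dM p (τ.Xtilde.val p) = X.val (τ.πM p) := τ.Xtilde_lift p
  unfold lift
  rw [map_add, map_smul, τ.dM_Z, h]
  simp

theorem exists_horizontal_M (p : P) (v : Model n) : ∃ u, τ.θ.val p u = 0 ∧ τ.dM p u = v :=
  exists_horizontal (τ.dM_surjective p) (τ.dM_Z p) (by rw [τ.θ_val_Z]; exact one_ne_zero) v

theorem exists_horizontal_W (p : P) (v : Model n) : ∃ u, τ.θ.val p u = 0 ∧ τ.dW p u = v :=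
  exists_horizontal (τ.dW_surjective p) (τ.dW_lift p) (by rw [τ.θ_lift]; exact τ.a_ne_zero _) v

/-- Both projections restrict to isomorphisms on `ker θ`. On the side of `W` this needs `a ≠ 0`, as
`θ` takes the value `a` on the generator spanning the vertical line. -/
theorem exists_equiv (p : P) :
    ∃ e : Model n ≃ₗ[ℝ] Model n, ∀ u, τ.θ.val p u = 0 → e (τ.dM p u) = τ.dW p u :=
  exists_equiv_of_horizontal (τ.dM_surjective p) (by simp) (τ.dM_Z p)
    (by rw [τ.θ_val_Z]; exact one_ne_zero) (τ.dW_surjective p) (by simp) (τ.dW_lift p)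
    (by rw [τ.θ_lift]; exact τ.a_ne_zero _)

variable {τ}

theorem RelatedBilin.val {gW : BilinField n W} {g : BilinField n M} (h : τ.RelatedBilin gW g)
    {p : P} {u v : Model (n + 1)} (hu : τ.θ.val p u = 0) (hv : τ.θ.val p v = 0) :
    gW.val (τ.πW p) (τ.dW p u) (τ.dW p v) = g.val (τ.πM p) (τ.dM p u) (τ.dM p v) :=
  h p u v hu hv

theorem RelatedEnd.exists_val {AW : EndField n W} {A : EndField n M} (h : τ.RelatedEnd AW A)
    {p : P} {u : Model (n + 1)} (hu : τ.θ.val p u = 0) : ∃ v, τ.θ.val p v = 0 ∧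
      τ.dM p v = A.val (τ.πM p) (τ.dM p u) ∧ τ.dW p v = AW.val (τ.πW p) (τ.dW p u) := by
  obtain ⟨v, hv, e⟩ := τ.exists_horizontal_M p (A.val (τ.πM p) (τ.dM p u))
  exact ⟨v, hv, e, h p u v hu hv e⟩

theorem RelatedBilin.equiv {gW : BilinField n W} {g : BilinField n M} (h : τ.RelatedBilin gW g)
    {p : P} {e : Model n ≃ₗ[ℝ] Model n} (he : ∀ u, τ.θ.val p u = 0 → e (τ.dM p u) = τ.dW p u)
    (u v : Model n) : gW.val (τ.πW p) (e u) (e v) = g.val (τ.πM p) u v := by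
  obtain ⟨u, hu, rfl⟩ := τ.exists_horizontal_M p u
  obtain ⟨v, hv, rfl⟩ := τ.exists_horizontal_M p v
  rw [he u hu, he v hv, h.val hu hv]

theorem RelatedEnd.equiv {AW : EndField n W} {A : EndField n M} (h : τ.RelatedEnd AW A)
    {p : P} {e : Model n ≃ₗ[ℝ] Model n} (he : ∀ u, τ.θ.val p u = 0 → e (τ.dM p u) = τ.dW p u)
    (u : Model n) : AW.val (τ.πW p) (e u) = e (A.val (τ.πM p) u) := by
  obtain ⟨u, hu, rfl⟩ := τ.exists_horizontal_M p u
  obtain ⟨v, hv, h1, h2⟩ := h.exists_val hu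
  rw [he u hu, ← h1, he v hv, h2]

/-- Hyper-Hermitian structures correspond under `ℋ`-relatedness. -/
theorem hyperHermitianForm_iff {gW : BilinField n W} {g : BilinField n M} {IW JW KW : EndField n W}
    {I J K : EndField n M} (hg : τ.RelatedBilin gW g) (hI : τ.RelatedEnd IW I)
    (hJ : τ.RelatedEnd JW J) (hK : τ.RelatedEnd KW K) :
    (∀ q, HyperHermitianForm (gW.val q) (IW.val q) (JW.val q) (KW.val q)) ↔
      ∀ x, HyperHermitianForm (g.val x) (I.val x) (J.val x) (K.val x) := by
  constructor
  · intro h x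
    obtain ⟨p, rfl⟩ := τ.principal_quotient.surjective x
    obtain ⟨e, he⟩ := τ.exists_equiv p
    refine (h (τ.πW p)).of_equiv e.symm (e.surjective.forall₂.2 fun u v ↦ ?_)
      (e.surjective.forall.2 fun u ↦ ?_) (e.surjective.forall.2 fun u ↦ ?_)
      (e.surjective.forall.2 fun u ↦ ?_)
    · rw [hg.equiv he, e.symm_apply_apply, e.symm_apply_apply]
    · rw [hI.equiv he, e.symm_apply_apply, e.symm_apply_apply]
    · rw [hJ.equiv he, e.symm_apply_apply, e.symm_apply_apply]
    · rw [hK.equiv he, e.symm_apply_apply, e.symm_apply_apply]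
  · intro h q
    obtain ⟨p, rfl⟩ := τ.lifted_quotient.surjective q
    obtain ⟨e, he⟩ := τ.exists_equiv p
    exact (h (τ.πM p)).of_equiv e (hg.equiv he) (hI.equiv he) (hJ.equiv he) (hK.equiv he)

/-- Two-forms on `W` and `M` that agree on the horizontal distribution. -/
def RelatedForm (τ : Twist M P W X a F) (ΩW : KForm n W 2) (Ω : KForm n M 2) : Prop :=
  ∀ (p : P) (u v : Model (n + 1)), τ.θ.val p u = 0 → τ.θ.val p v = 0 →
    ΩW.val (τ.πW p) ![τ.dW p u, τ.dW p v] = Ω.val (τ.πM p) ![τ.dM p u, τ.dM p v]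

theorem relatedForm_kahlerForm {gW : BilinField n W} {g : BilinField n M} {IW : EndField n W}
    {I : EndField n M} (hg : τ.RelatedBilin gW g) (hI : τ.RelatedEnd IW I) :
    τ.RelatedForm (kahlerForm gW IW) (kahlerForm g I) := by
  intro p u v hu hv
  obtain ⟨u', hu', h1, h2⟩ := hI.exists_val hu
  obtain ⟨v', hv', h3, h4⟩ := hI.exists_val hv
  rw [kahlerForm_val, kahlerForm_val, ← h1, ← h2, ← h3, ← h4, hg.val hu' hv, hg.val hv' hu]

/-- The pull-back of a covector field to the total space. -/
def pullCov (τ : Twist M P W X a F) (β : CovField n M) : CovField (n + 1) P :=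
  fun p ↦ (β.val (τ.πM p)).comp (τ.dM p)

theorem pullback_toForm (β : CovField n M) :
    β.toForm.pullback τ.πM = (τ.pullCov β).toForm := by
  funext p
  rfl

/-- Subtracting `θ(u)/a` times the lifted generator makes `u` horizontal. The projection to `W` does
not see this correction, while the projection to `M` sees a multiple of `X`. The hypothesis on `X ⌟
Ω` turns the correction terms into `-k θ ∧ β`. -/
theorem RelatedForm.pullback_eq {ΩW : KForm n W 2} {Ω : KForm n M 2} (h : τ.RelatedForm ΩW Ω)
    {k : M → ℝ} {β : CovField n M}
    (hβ : ∀ x v, Ω.val x ![X.val x, v] = k x * a x * β.val x v) :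
    ΩW.pullback τ.πW = fun p ↦ Ω.pullback τ.πM p
      + (-k (τ.πM p)) • τ.θ.wedge (τ.pullCov β) p := by
  funext p
  refine alternating_two_ext (E := Model (n + 1)) fun u v ↦ ?_
  have ha := τ.a_ne_zero (τ.πM p)
  set s := τ.θ.val p u / a (τ.πM p)
  set t := τ.θ.val p v / a (τ.πM p)
  have hs : s * a (τ.πM p) = τ.θ.val p u := div_mul_cancel₀ _ ha
  have ht : t * a (τ.πM p) = τ.θ.val p v := div_mul_cancel₀ _ ha
  have h1 := h p (u - s • τ.lift p) (v - t • τ.lift p)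
    (by rw [map_sub, map_smul, τ.θ_lift, smul_eq_mul, hs, sub_self])
    (by rw [map_sub, map_smul, τ.θ_lift, smul_eq_mul, ht, sub_self])
  simp only [map_sub, map_smul, τ.dW_lift, τ.dM_lift, smul_zero, sub_zero] at h1
  have hL : ΩW.pullback τ.πW p ![u, v] = ΩW.val (τ.πW p) ![τ.dW p u, τ.dW p v] := by
    refine (KForm.pullback_apply ΩW τ.πW p ![u, v]).trans (congrArg _ ?_)
    funext i; fin_cases i <;> rfl
  have hR : Ω.pullback τ.πM p ![u, v] = Ω.val (τ.πM p) ![τ.dM p u, τ.dM p v] := by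
    refine (KForm.pullback_apply Ω τ.πM p ![u, v]).trans (congrArg _ ?_)
    funext i; fin_cases i <;> rfl
  have hw : τ.θ.wedge (τ.pullCov β) p ![u, v] = τ.θ.val p u * β.val (τ.πM p) (τ.dM p v)
      - τ.θ.val p v * β.val (τ.πM p) (τ.dM p u) := wedge_apply _ _ _
  refine (hL.trans h1).trans ?_
  refine Eq.trans ?_ (congrArg₂ (fun x y ↦ x + -k (τ.πM p) * y) hR hw).symm
  rw [alternating_two_sub_smul, hβ, hβ, ← hs, ← ht]
  ring

end Twist

end TwistGeometry

/-! ### Exterior derivatives across the twist. -/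

section TwistGeometry

variable {n : ℕ} {M P W : Type*}
    [TopologicalSpace M] [ChartedSpace (Model n) M] [IsManifold 𝓘(ℝ, Model n) ∞ M]
    [TopologicalSpace P] [ChartedSpace (Model (n + 1)) P] [IsManifold 𝓘(ℝ, Model (n + 1)) ∞ P]
    [TopologicalSpace W] [ChartedSpace (Model n) W] [IsManifold 𝓘(ℝ, Model n) ∞ W]
    {X : VField n M} {a : M → ℝ} {F : KForm n M 2}

theorem KForm.pullback_apply_two {m n : ℕ} {M P : Type*} [TopologicalSpace M]
    [ChartedSpace (Model n) M] [TopologicalSpace P] [ChartedSpace (Model m) P] (η : KForm n M 2)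
    (φ : P → M) (p : P) (u v : Model m) :
    (η.pullback φ).val p ![u, v] = η.val (φ p) ![dMap φ p u, dMap φ p v] := by
  refine (KForm.pullback_apply η φ p ![u, v]).trans (congrArg _ ?_)
  funext i; fin_cases i <;> rfl

theorem KForm.pullback_apply_three {m n : ℕ} {M P : Type*} [TopologicalSpace M]
    [ChartedSpace (Model n) M] [TopologicalSpace P] [ChartedSpace (Model m) P] (η : KForm n M 3)
    (φ : P → M) (p : P) (u v w : Model m) :
    (η.pullback φ).val p ![u, v, w] = η.val (φ p) ![dMap φ p u, dMap φ p v, dMap φ p w] := by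
  refine (KForm.pullback_apply η φ p ![u, v, w]).trans (congrArg _ ?_)
  funext i; fin_cases i <;> rfl

namespace Twist

theorem contMDiffAt_πM (τ : Twist M P W X a F) (p : P) :
    ContMDiffAt 𝓘(ℝ, Model (n + 1)) 𝓘(ℝ, Model n) ∞ τ.πM p := τ.principal_quotient.smooth p

theorem contMDiffAt_πW (τ : Twist M P W X a F) (p : P) :
    ContMDiffAt 𝓘(ℝ, Model (n + 1)) 𝓘(ℝ, Model n) ∞ τ.πW p := τ.lifted_quotient.smooth p

theorem eventually_πM (τ : Twist M P W X a F) (p : P) : ∀ᶠ q in 𝓝 p,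
    MDifferentiableAt 𝓘(ℝ, Model (n + 1)) 𝓘(ℝ, Model n) τ.πM q :=
  Filter.Eventually.of_forall fun q ↦ (τ.contMDiffAt_πM q).mdifferentiableAt (by simp)

theorem eventually_πW (τ : Twist M P W X a F) (p : P) : ∀ᶠ q in 𝓝 p,
    MDifferentiableAt 𝓘(ℝ, Model (n + 1)) 𝓘(ℝ, Model n) τ.πW q :=
  Filter.Eventually.of_forall fun q ↦ (τ.contMDiffAt_πW q).mdifferentiableAt (by simp)

theorem θ_smoothAt (τ : Twist M P W X a F) (p : P) : τ.θ.toForm.SmoothAt p :=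
  (CovField.toForm_smoothAt_iff _ p).2 (τ.smooth_θ.contDiffAt p)

theorem d_θ_val (τ : Twist M P W X a F) (p : P) (u v : Model (n + 1)) :
    τ.θ.toForm.d.val p ![u, v] = F.val (τ.πM p) ![τ.dM p u, τ.dM p v] :=
  (DFunLike.congr_fun (τ.curvature p) ![u, v]).trans (KForm.pullback_apply_two F τ.πM p u v)

variable {τ : Twist M P W X a F}

/-- The exterior derivative of a form on `W`, in terms of the related form on `M`. -/
theorem RelatedForm.d_apply {ΩW : KForm n W 2} {Ω : KForm n M 2} (h : τ.RelatedForm ΩW Ω)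
    {k : M → ℝ} {β : CovField n M}
    (hβ : ∀ x v, Ω.val x ![X.val x, v] = k x * a x * β.val x v)
    (hΩW : ∀ q, ΩW.SmoothAt q) (hΩ : ∀ x, Ω.SmoothAt x)
    (hk : ∀ x, ContMDiffAt 𝓘(ℝ, Model n) 𝓘(ℝ, ℝ) ∞ k x) (hβs : ∀ x, β.toForm.SmoothAt x)
    (hβd : ∀ x, β.toForm.d x = 0) {p : P} {u v w : Model (n + 1)} (hu : τ.θ.val p u = 0)
    (hv : τ.θ.val p v = 0) (hw : τ.θ.val p w = 0) :
    ΩW.d.val (τ.πW p) ![τ.dW p u, τ.dW p v, τ.dW p w]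
      = Ω.d.val (τ.πM p) ![τ.dM p u, τ.dM p v, τ.dM p w]
        - k (τ.πM p) * (F.val (τ.πM p) ![τ.dM p u, τ.dM p v] * β.val (τ.πM p) (τ.dM p w)
          - F.val (τ.πM p) ![τ.dM p u, τ.dM p w] * β.val (τ.πM p) (τ.dM p v)
          + F.val (τ.πM p) ![τ.dM p v, τ.dM p w] * β.val (τ.πM p) (τ.dM p u)) := by
  have hc : ContMDiffAt 𝓘(ℝ, Model (n + 1)) 𝓘(ℝ, ℝ) ∞ (fun q ↦ -k (τ.πM q)) p :=
    ((hk (τ.πM p)).comp p (τ.contMDiffAt_πM p)).neg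
  have hβp : (τ.pullCov β).toForm.SmoothAt p := by
    rw [← pullback_toForm]
    exact (hβs _).pullback (τ.contMDiffAt_πM p) (τ.eventually_πM p)
  have hβpd : (τ.pullCov β).toForm.d p = 0 := by
    rw [← pullback_toForm, KForm.d_pullback (hβs _) (τ.contMDiffAt_πM p) (τ.eventually_πM p)]
    unfold KForm.pullback
    rw [hβd]
    rfl
  have hwedge := CovField.wedge_smoothAt (τ.θ_smoothAt p) hβp
  have h1 : ΩW.d.pullback τ.πW p = Ω.d.pullback τ.πM p
      + KForm.d (fun q ↦ (-k (τ.πM q)) • τ.θ.wedge (τ.pullCov β) q) p := by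
    rw [← KForm.d_pullback (hΩW _) (τ.contMDiffAt_πW p) (τ.eventually_πW p),
      ← KForm.d_pullback (hΩ _) (τ.contMDiffAt_πM p) (τ.eventually_πM p), h.pullback_eq hβ]
    exact KForm.d_add ((hΩ _).pullback (τ.contMDiffAt_πM p) (τ.eventually_πM p)) (hwedge.smul hc)
  have h2 := DFunLike.congr_fun h1 ![u, v, w]
  refine ((KForm.pullback_apply_three ΩW.d τ.πW p u v w).symm.trans h2).trans ?_
  refine (congrArg₂ (· + ·) (KForm.pullback_apply_three Ω.d τ.πM p u v w)
    (KForm.d_smul_two hc hwedge u v w)).trans ?_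
  -- In `d(-k θ ∧ β) = -dk ∧ θ ∧ β - k dθ ∧ β + k θ ∧ dβ` the first term vanishes on horizontal
  -- vectors and the last one because `dβ = 0`. The middle one is `-k F ∧ β`.
  rw [KForm.d_wedge (τ.θ_smoothAt p) hβp]
  have e0 : ∀ u v, (τ.pullCov β).toForm.d.val p ![u, v] = 0 := fun u v ↦
    DFunLike.congr_fun hβpd _
  have e1 : ∀ u v, (τ.θ.wedge (τ.pullCov β)).val p ![u, v]
      = τ.θ.val p u * (τ.pullCov β).val p v - τ.θ.val p v * (τ.pullCov β).val p u :=
    fun u v ↦ wedge_apply _ _ _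
  have e2 : ∀ u, (τ.pullCov β).val p u = β.val (τ.πM p) (τ.dM p u) := fun _ ↦ rfl
  rw [e1, e1, e1, e0, e0, e0, hu, hv, hw, τ.d_θ_val, τ.d_θ_val, τ.d_θ_val, e2, e2, e2]
  unfold dM
  ring

/-- Horizontal vectors project onto every tangent space of `M` and of `W`, so the formula on `ker θ`
can be read in either direction. -/
theorem RelatedForm.closed_iff {ΩW : KForm n W 2} {Ω : KForm n M 2} (h : τ.RelatedForm ΩW Ω)
    {k : M → ℝ} {β : CovField n M}
    (hβ : ∀ x v, Ω.val x ![X.val x, v] = k x * a x * β.val x v)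
    (hΩW : ∀ q, ΩW.SmoothAt q) (hΩ : ∀ x, Ω.SmoothAt x)
    (hk : ∀ x, ContMDiffAt 𝓘(ℝ, Model n) 𝓘(ℝ, ℝ) ∞ k x) (hβs : ∀ x, β.toForm.SmoothAt x)
    (hβd : ∀ x, β.toForm.d x = 0) :
    (∀ q, ΩW.d q = 0) ↔ ∀ x u v w, Ω.d.val x ![u, v, w] = k x * (F.val x ![u, v] * β.val x w
      - F.val x ![u, w] * β.val x v + F.val x ![v, w] * β.val x u) := by
  constructor
  · intro H x u v w
    obtain ⟨p, rfl⟩ := τ.principal_quotient.surjective x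
    obtain ⟨u, hu, rfl⟩ := τ.exists_horizontal_M p u
    obtain ⟨v, hv, rfl⟩ := τ.exists_horizontal_M p v
    obtain ⟨w, hw, rfl⟩ := τ.exists_horizontal_M p w
    have h1 := h.d_apply hβ hΩW hΩ hk hβs hβd hu hv hw
    have h2 : ΩW.d.val (τ.πW p) ![τ.dW p u, τ.dW p v, τ.dW p w] = 0 :=
      DFunLike.congr_fun (H _) _
    linarith
  · intro H q
    obtain ⟨p, rfl⟩ := τ.lifted_quotient.surjective q
    refine alternating_three_ext (E := Model n) fun u v w ↦ ?_
    obtain ⟨u, hu, rfl⟩ := τ.exists_horizontal_W p u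
    obtain ⟨v, hv, rfl⟩ := τ.exists_horizontal_W p v
    obtain ⟨w, hw, rfl⟩ := τ.exists_horizontal_W p w
    refine (h.d_apply hβ hΩW hΩ hk hβs hβd hu hv hw).trans ?_
    rw [H]
    exact sub_self _

/-- The curvature of the twist is closed. -/
theorem d_curvature (τ : Twist M P W X a F) (x : M) : F.d x = 0 := by
  obtain ⟨p, rfl⟩ := τ.principal_quotient.surjective x
  refine alternating_three_ext (E := Model n) fun u v w ↦ ?_
  obtain ⟨u, rfl⟩ := τ.dM_surjective p u
  obtain ⟨v, rfl⟩ := τ.dM_surjective p v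
  obtain ⟨w, rfl⟩ := τ.dM_surjective p w
  refine (KForm.pullback_apply_three F.d τ.πM p u v w).symm.trans ?_
  -- The pull-back of `F` is exact, hence closed, and the projection to `M` is a surjective
  -- submersion, so closedness descends.
  have h1 : τ.θ.toForm.d = F.pullback (m := n + 1) τ.πM := funext τ.curvature
  have h2 : F.d.pullback (m := n + 1) τ.πM p = 0 := by
    rw [← KForm.d_pullback (τ.smooth_F.smoothAt _) (τ.contMDiffAt_πM p) (τ.eventually_πM p), ← h1]
    exact KForm.d_d τ.θ_smoothAt p
  exact DFunLike.congr_fun h2 _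

end Twist

end TwistGeometry

/-! ### Fundamental forms of elementary deformations. -/

section Deformation

variable {n : ℕ} {M : Type*} [TopologicalSpace M] [ChartedSpace (Model n) M]
  {g : BilinField n M} {I J K : EndField n M} {X : VField n M}

theorem AlmostHyperHermitian.hyperHermitianForm [IsManifold 𝓘(ℝ, Model n) ∞ M]
    (h : AlmostHyperHermitian g I J K) (x : M) :
    HyperHermitianForm (g.val x) (I.val x) (J.val x) (K.val x) :=
  ⟨h.symm x, h.nondegenerate x, h.sq_I x, h.sq_J x, h.sq_K x, h.herm_I x, h.herm_J x, h.herm_K x,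
    h.I_J x, h.J_I x⟩

theorem AlmostHyperHermitian.of_hyperHermitianForm [IsManifold 𝓘(ℝ, Model n) ∞ M]
    (hg : SmoothBilin g) (hI : SmoothEnd I) (hJ : SmoothEnd J) (hK : SmoothEnd K)
    (h : ∀ x, HyperHermitianForm (g.val x) (I.val x) (J.val x) (K.val x)) :
    AlmostHyperHermitian g I J K :=
  ⟨hg, hI, hJ, hK, fun x ↦ (h x).symm, fun x ↦ (h x).nondegenerate, fun x ↦ (h x).sq_I,
    fun x ↦ (h x).sq_J, fun x ↦ (h x).sq_K, fun x ↦ (h x).herm_I, fun x ↦ (h x).herm_J,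
    fun x ↦ (h x).herm_K, fun x ↦ (h x).I_J, fun x ↦ (h x).J_I⟩

theorem elemDeformation_rotate (f h : M → ℝ) (g : BilinField n M) (I J K : EndField n M)
    (X : VField n M) : elemDeformation f h g J K I X = elemDeformation f h g I J K X := by
  funext x
  unfold elemDeformation gHX
  congr 2
  abel

theorem elemDeformation_val (f h : M → ℝ) (x : M) (u v : Model n) :
    (elemDeformation f h g I J K X).val x u v = f x * g.val x u v
      + h x * (g.val x (X.val x) u * g.val x (X.val x) v
        + g.val x (I.val x (X.val x)) u * g.val x (I.val x (X.val x)) v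
        + g.val x (J.val x (X.val x)) u * g.val x (J.val x (X.val x)) v
        + g.val x (K.val x (X.val x)) u * g.val x (K.val x (X.val x)) v) := rfl

/-- The fundamental two-form of an elementary deformation. -/
theorem kahlerForm_elemDeformation (hA : ∀ x, HyperHermitianForm (g.val x) (I.val x) (J.val x)
    (K.val x)) (f h : M → ℝ) :
    kahlerForm (elemDeformation f h g I J K X) I = fun x ↦ f x • kahlerForm g I x
      + h x • ((flat g X).wedge (flat g (I.app X)) x
        + (flat g (J.app X)).wedge (flat g (K.app X)) x) := by
  funext x
  refine alternating_two_ext (E := Model n) fun u v ↦ ?_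
  have H := hA x
  have e1 := kahlerForm_val (elemDeformation f h g I J K X) I x u v
  have e2 := kahlerForm_val g I x u v
  have e3 : (flat g X).wedge (flat g (I.app X)) x ![u, v]
      = g.val x (X.val x) u * g.val x (I.val x (X.val x)) v
        - g.val x (X.val x) v * g.val x (I.val x (X.val x)) u := wedge_apply _ _ _
  have e4 : (flat g (J.app X)).wedge (flat g (K.app X)) x ![u, v]
      = g.val x (J.val x (X.val x)) u * g.val x (K.val x (X.val x)) v
        - g.val x (J.val x (X.val x)) v * g.val x (K.val x (X.val x)) u := wedge_apply _ _ _
  refine e1.trans (Eq.trans ?_ (congrArg₂ (fun r s ↦ f x * r + h x * s) e2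
    (congrArg₂ (· + ·) e3 e4)).symm)
  -- Precomposition with `I` sends `α₀, α_I` to `-α_I, α₀` and `α_J, α_K` to `-α_K, α_J`. Hence the
  -- four squares in `g_{ℍX}` turn into the two wedge products.
  have h0 : ∀ u, g.val x (X.val x) (I.val x u) = - g.val x (I.val x (X.val x)) u := fun u ↦ by
    rw [H.skew_I, neg_neg]
  have hJ : ∀ u, g.val x (J.val x (X.val x)) (I.val x u) = - g.val x (K.val x (X.val x)) u :=
    fun u ↦ by
      rw [← H.I_J, H.skew_I, neg_neg]
  have hK : ∀ u, g.val x (K.val x (X.val x)) (I.val x u) = g.val x (J.val x (X.val x)) u :=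
    fun u ↦ by
      rw [← H.I_J, H.herm_I]
  simp only [elemDeformation_val, h0, hJ, hK, H.herm_I]
  ring

end Deformation

/-! ### Differentials of functions and constancy on connected manifolds. -/

section Functions

variable {n : ℕ} {M : Type*} [TopologicalSpace M] [ChartedSpace (Model n) M]

theorem dFun_mul {s t : M → ℝ} {x : M} (hs : MDifferentiableAt 𝓘(ℝ, Model n) 𝓘(ℝ, ℝ) s x)
    (ht : MDifferentiableAt 𝓘(ℝ, Model n) 𝓘(ℝ, ℝ) t x) (v : Model n) :
    dFun (n := n) (fun y ↦ s y * t y) x v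
      = s x * dFun (n := n) t x v + t x * dFun (n := n) s x v :=
  DFunLike.congr_fun (hs.hasMFDerivAt.mul ht.hasMFDerivAt).mfderiv v

theorem dFun_add {s t : M → ℝ} {x : M} (hs : MDifferentiableAt 𝓘(ℝ, Model n) 𝓘(ℝ, ℝ) s x)
    (ht : MDifferentiableAt 𝓘(ℝ, Model n) 𝓘(ℝ, ℝ) t x) (v : Model n) :
    dFun (n := n) (fun y ↦ s y + t y) x v = dFun (n := n) s x v + dFun (n := n) t x v :=
  DFunLike.congr_fun (hs.hasMFDerivAt.add ht.hasMFDerivAt).mfderiv v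

theorem dFun_const (c : ℝ) (x : M) (v : Model n) : dFun (n := n) (fun _ : M ↦ c) x v = 0 :=
  DFunLike.congr_fun (hasMFDerivAt_const (I := 𝓘(ℝ, Model n)) (I' := 𝓘(ℝ, ℝ)) c x).mfderiv v

theorem dFun_const_mul (c : ℝ) {s : M → ℝ} {x : M}
    (hs : MDifferentiableAt 𝓘(ℝ, Model n) 𝓘(ℝ, ℝ) s x) (v : Model n) :
    dFun (n := n) (fun y ↦ c * s y) x v = c * dFun (n := n) s x v :=
  (dFun_mul (s := fun _ ↦ c) mdifferentiableAt_const hs v).trans (by rw [dFun_const]; ring)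

variable [IsManifold 𝓘(ℝ, Model n) ∞ M]

/-- The function is constant on the preimage of a ball in each chart, hence locally constant. -/
theorem eq_of_dFun_eq_zero [ConnectedSpace M] {s : M → ℝ}
    (hs : ∀ x, MDifferentiableAt 𝓘(ℝ, Model n) 𝓘(ℝ, ℝ) s x)
    (hd : ∀ x v, dFun (n := n) s x v = 0) (x y : M) : s x = s y := by
  have := isManifold_one (n := n) (M := M)
  refine IsLocallyConstant.apply_eq_of_isPreconnected (s := Set.univ) ?_ isPreconnected_univ
    trivial trivial
  refine (IsLocallyConstant.iff_exists_open s).2 fun x ↦ ?_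
  set e := extChartAt 𝓘(ℝ, Model n) x
  obtain ⟨r, hr, hball⟩ := Metric.mem_nhds_iff.1 (extChartAt_target_mem_nhds_model (n := n) x)
  have hdiff : ∀ y ∈ Metric.ball (e x) r, HasFDerivAt (fun z ↦ s (e.symm z))
      (0 : Model n →L[ℝ] ℝ) y := by
    intro y hy
    have h1 : MDifferentiableAt 𝓘(ℝ, Model n) 𝓘(ℝ, Model n) e.symm y :=
      ((contMDiffOn_extChartAt_symm (I := 𝓘(ℝ, Model n)) (n := 1) x).contMDiffAt
        (extChartAt_target_mem_nhds' (hball hy))).mdifferentiableAt (by simp)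
    have h2 := (hs (e.symm y)).hasMFDerivAt.comp y h1.hasMFDerivAt
    have h3 : mfderiv 𝓘(ℝ, Model n) 𝓘(ℝ, ℝ) s (e.symm y) = 0 :=
      ContinuousLinearMap.ext fun v ↦ hd (e.symm y) v
    rw [h3] at h2
    have h4 := hasMFDerivAt_iff_hasFDerivAt.1 h2
    refine h4.congr_fderiv ?_
    ext
    rfl
  refine ⟨e.source ∩ e ⁻¹' Metric.ball (e x) r, ?_, ⟨mem_extChartAt_source x,
    Metric.mem_ball_self hr⟩, fun y hy ↦ ?_⟩
  · exact (continuousOn_extChartAt x).isOpen_inter_preimage (isOpen_extChartAt_source x)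
      Metric.isOpen_ball
  · have h := Metric.isOpen_ball.is_const_of_fderiv_eq_zero (convex_ball (e x) r).isPreconnected
      (fun y hy ↦ (hdiff y hy).differentiableAt.differentiableWithinAt)
      (fun y hy ↦ (hdiff y hy).fderiv) hy.2 (Metric.mem_ball_self hr)
    simpa only [e.left_inv hy.1, e.left_inv (mem_extChartAt_source x)] using h

end Functions

/-! ### Non-degeneracy of the deformed metric. -/

section Deformation

variable {E : Type*} [NormedAddCommGroup E] [NormedSpace ℝ E]

/-- An elementary deformation `s g + t g_{ℍX}` is again hyper-Hermitian. -/
theorem HyperHermitianForm.deformation {g g' : E →L[ℝ] E →L[ℝ] ℝ} {I J K : E →L[ℝ] E}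
    (H : HyperHermitianForm g I J K) {X : E} {s t : ℝ} (hs : s ≠ 0) (hst : s + t * g X X ≠ 0)
    (hg' : ∀ u v, g' u v = s * g u v + t * (g X u * g X v + g (I X) u * g (I X) v
      + g (J X) u * g (J X) v + g (K X) u * g (K X) v)) : HyperHermitianForm g' I J K := by
  have hI := H.skew_I
  have hJ := H.rotate.skew_I
  have hK := H.rotate.rotate.skew_I
  have hKI := H.rotate.J_K
  have hIK := H.rotate.K_J
  refine ⟨fun u v ↦ ?_, fun u hu ↦ ?_, H.sq_I, H.sq_J, H.sq_K, fun u v ↦ ?_, fun u v ↦ ?_,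
    fun u v ↦ ?_, H.I_J, H.J_I⟩
  · rw [hg', hg', H.symm u v]
    ring
  · have z1 := H.self_I X
    have z2 := H.rotate.self_I X
    have z3 := H.rotate.rotate.self_I X
    -- `X, IX, JX, KX` are mutually orthogonal and have the same square. Pairing a null direction
    -- `u` of `g'` with each of them gives `s + t g(X, X)` times one of the four covectors at `u`.
    -- Once all four vanish, `g'(u, v) = s g(u, v)`.
    have key : ∀ r, (s + t * g X X) * r = 0 → r = 0 := fun r hr ↦
      (mul_eq_zero.1 hr).resolve_left hst
    have a0 : g X u = 0 := key _ <| by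
      have := hu X
      rw [hg', hI, hJ, hK, hI X X, hJ X X, hK X X, z1, z2, z3, H.symm u X] at this
      linarith
    have a1 : g (I X) u = 0 := key _ <| by
      have := hu (I X)
      rw [hg', z1, H.herm_I, hJ X (I X), H.J_I, map_neg, z3, hK X (I X), hKI, z2,
        H.symm u (I X)] at this
      linarith
    have a2 : g (J X) u = 0 := key _ <| by
      have := hu (J X)
      rw [hg', z2, H.herm_J, hI X (J X), H.I_J, z3, hK X (J X), H.K_J, map_neg, z1,
        H.symm u (J X)] at this
      linarith
    have a3 : g (K X) u = 0 := key _ <| by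
      have := hu (K X)
      rw [hg', z3, H.herm_K, hI X (K X), hIK, map_neg, z2, hJ X (K X), H.J_K, z1,
        H.symm u (K X)] at this
      linarith
    refine H.nondegenerate u fun v ↦ (mul_eq_zero.1 ?_).resolve_left hs
    have := hu v
    rw [hg', a0, a1, a2, a3] at this
    linarith
  · simp only [hg', hI, hJ, hK, H.sq_I, H.J_I, hKI, map_neg]
    ring
  · simp only [hg', hI, hJ, hK, H.sq_J, H.I_J, H.K_J, map_neg]
    ring
  · simp only [hg', hI, hJ, hK, H.sq_K, hIK, H.J_K, map_neg]
    ring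

end Deformation

/-! ### Closedness of the twisted fundamental forms. -/

section ClosedForms

variable {n : ℕ} {M P W : Type*}
    [TopologicalSpace M] [ChartedSpace (Model n) M] [IsManifold 𝓘(ℝ, Model n) ∞ M]
    [TopologicalSpace P] [ChartedSpace (Model (n + 1)) P] [IsManifold 𝓘(ℝ, Model (n + 1)) ∞ P]
    [TopologicalSpace W] [ChartedSpace (Model n) W] [IsManifold 𝓘(ℝ, Model n) ∞ W]
    {g : BilinField n M} {I J K : EndField n M} {X : VField n M}

theorem flat_app_smoothAt (hg : SmoothBilin g) (hI : SmoothEnd I) (hX : SmoothVField X) (x : M) :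
    (flat g (I.app X)).toForm.SmoothAt x :=
  (d_contraction (kahlerChart_contDiffAt hg hI x) (hX x).contDiffAt (flat_app_inChart g I X x)).1

/-- Since `ω_I`, `α_I`, `α_J`, `α_K` are closed, only the terms with `df`, `dh` and `dα₀` survive.
-/
theorem d_kahlerForm_elemDeformation (hM : IsPseudoHyperKahler g I J K)
    (hX : IsTriholomorphicIsometry g I J K X) {f h : M → ℝ} {x : M}
    (hf : ContMDiffAt 𝓘(ℝ, Model n) 𝓘(ℝ, ℝ) ∞ f x) (hh : ContMDiffAt 𝓘(ℝ, Model n) 𝓘(ℝ, ℝ) ∞ h x)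
    (u v w : Model n) :
    (kahlerForm (elemDeformation f h g I J K X) I).d.val x ![u, v, w]
      = dFun (n := n) f x u * g.val x (I.val x v) w - dFun (n := n) f x v * g.val x (I.val x u) w
        + dFun (n := n) f x w * g.val x (I.val x u) v
        + (dFun (n := n) h x u * ((flat g X).wedge (flat g (I.app X)) x ![v, w]
            + (flat g (J.app X)).wedge (flat g (K.app X)) x ![v, w])
          - dFun (n := n) h x v * ((flat g X).wedge (flat g (I.app X)) x ![u, w]
            + (flat g (J.app X)).wedge (flat g (K.app X)) x ![u, w])
          + dFun (n := n) h x w * ((flat g X).wedge (flat g (I.app X)) x ![u, v]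
            + (flat g (J.app X)).wedge (flat g (K.app X)) x ![u, v]))
        + h x * ((flat g X).toForm.d.val x ![u, v] * (flat g (I.app X)).val x w
          - (flat g X).toForm.d.val x ![u, w] * (flat g (I.app X)).val x v
          + (flat g X).toForm.d.val x ![v, w] * (flat g (I.app X)).val x u) := by
  have hA := hM.almostHyperHermitian
  have s0 := flat_smoothAt hA.smooth_g hX.smooth x
  have sI := flat_app_smoothAt hA.smooth_g hA.smooth_I hX.smooth x
  have sJ := flat_app_smoothAt hA.smooth_g hA.smooth_J hX.smooth x
  have sK := flat_app_smoothAt hA.smooth_g hA.smooth_K hX.smooth x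
  have s0I := CovField.wedge_smoothAt s0 sI
  have sJK := CovField.wedge_smoothAt sJ sK
  have sω := kahlerForm_smoothAt hA.smooth_g hA.smooth_I x
  have dI : ∀ u v, (flat g (I.app X)).toForm.d.val x ![u, v] = 0 := fun u v ↦
    DFunLike.congr_fun (d_flat_app hM hX x) _
  have dJ : ∀ u v, (flat g (J.app X)).toForm.d.val x ![u, v] = 0 := fun u v ↦
    DFunLike.congr_fun (d_flat_app hM.rotate hX.rotate x) _
  have dK : ∀ u v, (flat g (K.app X)).toForm.d.val x ![u, v] = 0 := fun u v ↦
    DFunLike.congr_fun (d_flat_app hM.rotate.rotate hX.rotate.rotate x) _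
  have e1 : (kahlerForm (elemDeformation f h g I J K X) I).d x
      = KForm.d (fun x ↦ f x • kahlerForm g I x) x
        + KForm.d (fun x ↦ h x • ((flat g X).wedge (flat g (I.app X)) x
          + (flat g (J.app X)).wedge (flat g (K.app X)) x)) x := by
    rw [kahlerForm_elemDeformation hA.hyperHermitianForm]
    exact KForm.d_add (sω.smul hf) ((s0I.add sJK).smul hh)
  have e2 : KForm.d (fun x ↦ (flat g X).wedge (flat g (I.app X)) x
      + (flat g (J.app X)).wedge (flat g (K.app X)) x) x
      = ((flat g X).wedge (flat g (I.app X))).d x + ((flat g (J.app X)).wedge (flat g (K.app X))).d x :=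
    KForm.d_add s0I sJK
  have e3 : KForm.val (KForm.d (fun x ↦ (flat g X).wedge (flat g (I.app X)) x
      + (flat g (J.app X)).wedge (flat g (K.app X)) x)) x ![u, v, w]
      = ((flat g X).wedge (flat g (I.app X))).d.val x ![u, v, w]
        + ((flat g (J.app X)).wedge (flat g (K.app X))).d.val x ![u, v, w] :=
    DFunLike.congr_fun e2 _
  have e4 : (kahlerForm g I).d.val x ![u, v, w] = 0 := DFunLike.congr_fun (hM.d_kahlerForm x) _
  have e5 : ∀ u v, KForm.val (fun x ↦ (flat g X).wedge (flat g (I.app X)) x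
      + (flat g (J.app X)).wedge (flat g (K.app X)) x) x ![u, v]
      = (flat g X).wedge (flat g (I.app X)) x ![u, v]
        + (flat g (J.app X)).wedge (flat g (K.app X)) x ![u, v] := fun _ _ ↦ rfl
  refine (DFunLike.congr_fun e1 ![u, v, w]).trans ?_
  refine (congrArg₂ (· + ·) (KForm.d_smul_two hf sω u v w)
    (KForm.d_smul_two hh (s0I.add sJK) u v w)).trans ?_
  rw [e3, KForm.d_wedge s0 sI, KForm.d_wedge sJ sK, hA.kahlerForm_I, hA.kahlerForm_I,
    hA.kahlerForm_I, e4, dI, dI, dI, dJ, dJ, dJ, dK, dK, dK]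
  rw [e5, e5, e5]
  ring

/-- `α₀(X) = ‖X‖²`, and `α_I, α_J, α_K` vanish on `X`. This supplies the contraction needed in
`Twist.RelatedForm.closed_iff`. -/
theorem kahlerForm_elemDeformation_X (hA : AlmostHyperHermitian g I J K) (f h : M → ℝ) (x : M)
    (v : Model n) : (kahlerForm (elemDeformation f h g I J K X) I).val x ![X.val x, v]
      = (f x + h x * normSq g X x) * (flat g (I.app X)).val x v := by
  have H := hA.hyperHermitianForm x
  have z1 := H.self_I (X.val x)
  have z2 := H.rotate.self_I (X.val x)
  have z3 := H.rotate.rotate.self_I (X.val x)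
  have e3 : (flat g X).wedge (flat g (I.app X)) x ![X.val x, v]
      = g.val x (X.val x) (X.val x) * g.val x (I.val x (X.val x)) v
        - g.val x (X.val x) v * g.val x (I.val x (X.val x)) (X.val x) := wedge_apply _ _ _
  have e4 : (flat g (J.app X)).wedge (flat g (K.app X)) x ![X.val x, v]
      = g.val x (J.val x (X.val x)) (X.val x) * g.val x (K.val x (X.val x)) v
        - g.val x (J.val x (X.val x)) v * g.val x (K.val x (X.val x)) (X.val x) :=
    wedge_apply _ _ _
  rw [H.symm (I.val x (X.val x)) (X.val x), z1] at e3
  rw [H.symm (J.val x (X.val x)) (X.val x), z2, H.symm (K.val x (X.val x)) (X.val x), z3] at e4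
  rw [kahlerForm_elemDeformation hA.hyperHermitianForm]
  refine (congrArg₂ (fun r s ↦ f x * r + h x * s) (hA.kahlerForm_I x (X.val x) v)
    (congrArg₂ (· + ·) e3 e4)).trans ?_
  have e5 : normSq g X x = g.val x (X.val x) (X.val x) := rfl
  have e6 : (flat g (I.app X)).val x v = g.val x (I.val x (X.val x)) v := rfl
  rw [e5, e6]
  ring

variable {a : M → ℝ} {F : KForm n M 2} {τ : Twist M P W X a F}

/-- The twisted fundamental two-form is closed precisely when the twist equation holds. -/
theorem kahlerForm_closed_iff (hM : IsPseudoHyperKahler g I J K)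
    (hX : IsTriholomorphicIsometry g I J K X) {f h k : M → ℝ} (hf : SmoothFun (n := n) f)
    (hh : SmoothFun (n := n) h) (hk : SmoothFun (n := n) k)
    (hka : ∀ x, k x * a x = f x + h x * normSq g X x) {gW : BilinField n W} {IW : EndField n W}
    (hgW : SmoothBilin gW) (hIW : SmoothEnd IW)
    (rel_g : τ.RelatedBilin gW (elemDeformation f h g I J K X)) (rel_I : τ.RelatedEnd IW I) :
    (∀ q, (kahlerForm gW IW).d q = 0) ↔ ∀ x,
      TwistEquation ((g.val x).comp (I.val x)) ((flat g X).val x) ((flat g (I.app X)).val x)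
        ((flat g (J.app X)).val x) ((flat g (K.app X)).val x) (CovField.val (n := n) (dFun f) x)
        (CovField.val (n := n) (dFun h) x) (h x) (k x) ((flat g X).toForm.d.val x) (F.val x) := by
  have hA := hM.almostHyperHermitian
  have s0 := flat_smoothAt hA.smooth_g hX.smooth
  have sI := flat_app_smoothAt hA.smooth_g hA.smooth_I hX.smooth
  have sJ := flat_app_smoothAt hA.smooth_g hA.smooth_J hX.smooth
  have sK := flat_app_smoothAt hA.smooth_g hA.smooth_K hX.smooth
  have sω := kahlerForm_smoothAt hA.smooth_g hA.smooth_I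
  have sΩ : ∀ x, (kahlerForm (elemDeformation f h g I J K X) I).SmoothAt x := by
    rw [kahlerForm_elemDeformation hA.hyperHermitianForm]
    exact fun x ↦ ((sω x).smul (hf x)).add
      (((CovField.wedge_smoothAt (s0 x) (sI x)).add
        (CovField.wedge_smoothAt (sJ x) (sK x))).smul (hh x))
  rw [(Twist.relatedForm_kahlerForm rel_g rel_I).closed_iff (k := k) (β := flat g (I.app X))
    (fun x v ↦ by rw [hka, kahlerForm_elemDeformation_X hA]) (kahlerForm_smoothAt hgW hIW) sΩ
    (fun x ↦ hk x) sI (d_flat_app hM hX)]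
  refine forall_congr' fun x ↦ forall_congr' fun u ↦ forall_congr' fun v ↦ forall_congr' fun w ↦ ?_
  rw [d_kahlerForm_elemDeformation hM hX (hf x) (hh x)]
  rfl

end ClosedForms

/-! ### The two directions of the theorem. -/

section MainTheorem

variable {n : ℕ} {M P W : Type*}
    [TopologicalSpace M] [ChartedSpace (Model n) M] [IsManifold 𝓘(ℝ, Model n) ∞ M]
    [TopologicalSpace P] [ChartedSpace (Model (n + 1)) P] [IsManifold 𝓘(ℝ, Model (n + 1)) ∞ P]
    [TopologicalSpace W] [ChartedSpace (Model n) W] [IsManifold 𝓘(ℝ, Model n) ∞ W]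
    {g : BilinField n M} {I J K : EndField n M} {X : VField n M}
    {a : M → ℝ} {F : KForm n M 2} {τ : Twist M P W X a F}
    {gW : BilinField n W} {IW JW KW : EndField n W}

/-- A twist is pseudo-hyperKähler as soon as the deformed metric is non-degenerate and the three
twist equations hold. -/
theorem isPseudoHyperKahler_twist_iff (hM : IsPseudoHyperKahler g I J K)
    (hX : IsTriholomorphicIsometry g I J K X) {f h k : M → ℝ} (hf : SmoothFun (n := n) f)
    (hh : SmoothFun (n := n) h) (hk : SmoothFun (n := n) k)
    (hka : ∀ x, k x * a x = f x + h x * normSq g X x)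
    (hgW : SmoothBilin gW) (hIW : SmoothEnd IW) (hJW : SmoothEnd JW) (hKW : SmoothEnd KW)
    (rel_g : τ.RelatedBilin gW (elemDeformation f h g I J K X))
    (rel_I : τ.RelatedEnd IW I) (rel_J : τ.RelatedEnd JW J) (rel_K : τ.RelatedEnd KW K) :
    IsPseudoHyperKahler gW IW JW KW ↔ ∀ x,
      HyperHermitianForm ((elemDeformation f h g I J K X).val x) (I.val x) (J.val x) (K.val x) ∧
      TwistEquation ((g.val x).comp (I.val x)) ((flat g X).val x) ((flat g (I.app X)).val x)
        ((flat g (J.app X)).val x) ((flat g (K.app X)).val x) (CovField.val (n := n) (dFun f) x)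
        (CovField.val (n := n) (dFun h) x) (h x) (k x) ((flat g X).toForm.d.val x) (F.val x) ∧
      TwistEquation ((g.val x).comp (J.val x)) ((flat g X).val x) ((flat g (J.app X)).val x)
        ((flat g (K.app X)).val x) ((flat g (I.app X)).val x) (CovField.val (n := n) (dFun f) x)
        (CovField.val (n := n) (dFun h) x) (h x) (k x) ((flat g X).toForm.d.val x) (F.val x) ∧
      TwistEquation ((g.val x).comp (K.val x)) ((flat g X).val x) ((flat g (K.app X)).val x)
        ((flat g (I.app X)).val x) ((flat g (J.app X)).val x) (CovField.val (n := n) (dFun f) x)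
        (CovField.val (n := n) (dFun h) x) (h x) (k x) ((flat g X).toForm.d.val x) (F.val x) := by
  have rel_g' : τ.RelatedBilin gW (elemDeformation f h g J K I X) := by
    rwa [elemDeformation_rotate]
  have rel_g'' : τ.RelatedBilin gW (elemDeformation f h g K I J X) := by
    rwa [elemDeformation_rotate, elemDeformation_rotate]
  have cI := kahlerForm_closed_iff hM hX hf hh hk hka hgW hIW rel_g rel_I
  have cJ := kahlerForm_closed_iff hM.rotate hX.rotate hf hh hk hka hgW hJW rel_g' rel_J
  have cK := kahlerForm_closed_iff hM.rotate.rotate hX.rotate.rotate hf hh hk hka hgW hKW rel_g''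
    rel_K
  have cH := Twist.hyperHermitianForm_iff rel_g rel_I rel_J rel_K
  constructor
  · intro hW x
    exact ⟨cH.1 hW.almostHyperHermitian.hyperHermitianForm x, cI.1 hW.d_kahlerForm x,
      cJ.1 hW.rotate.d_kahlerForm x, cK.1 hW.rotate.rotate.d_kahlerForm x⟩
  · intro H
    exact (AlmostHyperHermitian.of_hyperHermitianForm hgW hIW hJW hKW
      (cH.2 fun x ↦ (H x).1)).isPseudoHyperKahler (cI.2 fun x ↦ (H x).2.1)
      (cJ.2 fun x ↦ (H x).2.2.1) (cK.2 fun x ↦ (H x).2.2.2)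

/-- Here `f = c` and `h = c h₁`, so `k = c/l` is constant, and the formula for `F` becomes the one
required by `twistEquation_of_formula`. -/
theorem isPseudoHyperKahler_of_twist (hM : IsPseudoHyperKahler g I J K)
    (hX : IsTriholomorphicIsometry g I J K X)
    (hgW : SmoothBilin gW) (hIW : SmoothEnd IW) (hJW : SmoothEnd JW) (hKW : SmoothEnd KW)
    {c l : ℝ} {h₁ : M → ℝ} {σ : KForm n M 2} (hc : c ≠ 0) (hl : l ≠ 0)
    (hh₁ : SmoothFun (n := n) h₁)
    (rel_g : τ.RelatedBilin gW (elemDeformation (fun _ ↦ c) (fun x ↦ c * h₁ x) g I J K X))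
    (rel_I : τ.RelatedEnd IW I) (rel_J : τ.RelatedEnd JW J) (rel_K : τ.RelatedEnd KW K)
    (ha : ∀ x, a x = l * (1 + h₁ x * normSq g X x))
    (hσ : IsStarThree (flat g (I.app X)) (flat g (J.app X)) (flat g (K.app X)) (dFun h₁) σ)
    (hF : ∀ x, F x = l • (CovField.toForm (fun y ↦ h₁ y • flat g X y)).d x + l • σ x) :
    IsPseudoHyperKahler gW IW JW KW := by
  have hA := hM.almostHyperHermitian
  have hcf : SmoothFun (n := n) (fun _ : M ↦ c) := contMDiff_const
  have hkf : SmoothFun (n := n) (fun _ : M ↦ c / l) := contMDiff_const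
  have hch : SmoothFun (n := n) (fun x ↦ c * h₁ x) := hcf.mul hh₁
  refine (isPseudoHyperKahler_twist_iff (k := fun _ ↦ c / l) hM hX hcf hch hkf (fun x ↦ ?_) hgW hIW
    hJW hKW rel_g rel_I rel_J rel_K).2 fun x ↦ ?_
  · rw [ha]
    field_simp
  have hdc : CovField.val (n := n) (dFun fun _ : M ↦ c) x = 0 :=
    ContinuousLinearMap.ext fun v ↦ dFun_const c x v
  have hdh : ∀ v, CovField.val (n := n) (dFun fun x ↦ c * h₁ x) x v
      = c * dFun (n := n) h₁ x v := dFun_const_mul c ((hh₁ x).mdifferentiableAt (by simp))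
  obtain ⟨p, q, r, h1, h2⟩ := hσ x
  have h1v : ∀ v : Model n, dFun (n := n) h₁ x v = p * (flat g (I.app X)).val x v
      + q * (flat g (J.app X)).val x v + r * (flat g (K.app X)).val x v := fun v ↦
    DFunLike.congr_fun h1 v
  have h2v : ∀ u v : Model n, σ.val x ![u, v]
      = p * wedge ((flat g (J.app X)).val x) ((flat g (K.app X)).val x) ![u, v]
        + q * wedge ((flat g (K.app X)).val x) ((flat g (I.app X)).val x) ![u, v]
        + r * wedge ((flat g (I.app X)).val x) ((flat g (J.app X)).val x) ![u, v] := fun u v ↦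
    DFunLike.congr_fun h2 _
  have hFv : ∀ u v : Model n, F.val x ![u, v]
      = l * (CovField.toForm (fun y ↦ h₁ y • flat g X y)).d.val x ![u, v] + l * σ.val x ![u, v] :=
    fun u v ↦ DFunLike.congr_fun (hF x) _
  have hdv : ∀ u v : Model n, (CovField.toForm (fun y ↦ h₁ y • flat g X y)).d.val x ![u, v]
      = dFun (n := n) h₁ x u * (flat g X).val x v - dFun (n := n) h₁ x v * (flat g X).val x u
        + h₁ x * (flat g X).toForm.d.val x ![u, v] :=
    KForm.d_smul_one (η := (flat g X).toForm) (hh₁ x) (flat_smoothAt hA.smooth_g hX.smooth x)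
  have key : ∀ u v, c / l * F.val x ![u, v] = c * h₁ x * (flat g X).toForm.d.val x ![u, v]
      + wedge (CovField.val (n := n) (dFun fun x ↦ c * h₁ x) x) ((flat g X).val x) ![u, v]
      + (c * p * wedge ((flat g (J.app X)).val x) ((flat g (K.app X)).val x) ![u, v]
        + c * q * wedge ((flat g (K.app X)).val x) ((flat g (I.app X)).val x) ![u, v]
        + c * r * wedge ((flat g (I.app X)).val x) ((flat g (J.app X)).val x) ![u, v]) := by
    intro u v
    have e : wedge (CovField.val (n := n) (dFun fun x ↦ c * h₁ x) x) ((flat g X).val x) ![u, v]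
        = c * dFun (n := n) h₁ x u * (flat g X).val x v
          - c * dFun (n := n) h₁ x v * (flat g X).val x u := by
      refine (wedge_apply _ _ _).trans ?_
      exact congrArg₂ (fun r s ↦ r * (flat g X).val x v - s * (flat g X).val x u) (hdh u) (hdh v)
    rw [e, hFv, hdv, h2v]
    field_simp
    ring
  -- The equations for `J` and `K` use the coefficients of `dh` rotated cyclically, in step with the
  -- covectors.
  refine ⟨(hA.hyperHermitianForm x).deformation (X := X.val x) hc (t := c * h₁ x) ?_
    (elemDeformation_val _ _ x), twistEquation_of_formula hdc (p := c * p) (q := c * q)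
      (r := c * r) (fun v ↦ ?_) key, twistEquation_of_formula hdc (p := c * q) (q := c * r)
      (r := c * p) (fun v ↦ ?_) fun u v ↦ ?_, twistEquation_of_formula hdc (p := c * r)
      (q := c * p) (r := c * q) (fun v ↦ ?_) fun u v ↦ ?_⟩
  -- Non-degeneracy comes from `a ≠ 0`, because `c + c h₁‖X‖² = (c/l) a`.
  · have h3 := τ.a_ne_zero x
    rw [ha] at h3
    have h4 : c + c * h₁ x * g.val x (X.val x) (X.val x) = c * (1 + h₁ x * normSq g X x) := by
      have : normSq g X x = g.val x (X.val x) (X.val x) := rfl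
      rw [this]
      ring
    rw [h4]
    exact mul_ne_zero hc (right_ne_zero_of_mul h3)
  · rw [hdh, h1v]
    ring
  · rw [hdh, h1v]
    ring
  · rw [key]
    ring
  · rw [hdh, h1v]
    ring
  · rw [key]
    ring

theorem exists_formula_of_isPseudoHyperKahler [ConnectedSpace M] (hn : 4 < n)
    (hM : IsPseudoHyperKahler g I J K)
    (hX : IsTriholomorphicIsometry g I J K X) (hX_free : ∀ x, X x ≠ 0) {f h : M → ℝ}
    (hf : SmoothFun (n := n) f) (hh : SmoothFun (n := n) h)
    (hgW : SmoothBilin gW) (hIW : SmoothEnd IW) (hJW : SmoothEnd JW) (hKW : SmoothEnd KW)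
    (rel_g : τ.RelatedBilin gW (elemDeformation f h g I J K X))
    (rel_I : τ.RelatedEnd IW I) (rel_J : τ.RelatedEnd JW J) (rel_K : τ.RelatedEnd KW K)
    (hW : IsPseudoHyperKahler gW IW JW KW) :
    ∃ (c l : ℝ) (h₁ : M → ℝ) (σ : KForm n M 2),
      c ≠ 0 ∧ l ≠ 0 ∧ SmoothFun (n := n) h₁ ∧
      (∀ x, elemDeformation f h g I J K X x = c • (g x + h₁ x • gHX g I J K X x)) ∧
      (∀ x, a x = l * (1 + h₁ x * normSq g X x)) ∧
      IsStarThree (flat g (I.app X)) (flat g (J.app X)) (flat g (K.app X)) (dFun h₁) σ ∧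
      (∀ x, F x = l • (CovField.toForm (fun y ↦ h₁ y • flat g X y)).d x + l • σ x) ∧
      (∀ x, σ.d x = 0) := by
  have hA := hM.almostHyperHermitian
  have hN : SmoothFun (n := n) (normSq g X) := normSq_smoothAt hA.smooth_g hX.smooth
  set k : M → ℝ := fun x ↦ (f x + h x * normSq g X x) / a x
  have hk : SmoothFun (n := n) k := fun x ↦
    ((hf.add (hh.mul hN)) x).div₀ (τ.smooth_a x) (τ.a_ne_zero x)
  have hka : ∀ x, k x * a x = f x + h x * normSq g X x := fun x ↦
    div_mul_cancel₀ _ (τ.a_ne_zero x)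
  have H := (isPseudoHyperKahler_twist_iff hM hX hf hh hk hka hgW hIW hJW hKW rel_g rel_I rel_J
    rel_K).1 hW
  have hfin : Module.finrank ℝ (Model n) = n := by simp
  have hXv : ∀ x, X.val x ≠ 0 := hX_free
  have hz : ∀ x, g.val x (X.val x) (I.val x (X.val x)) = 0 ∧
      g.val x (X.val x) (J.val x (X.val x)) = 0 ∧ g.val x (X.val x) (K.val x (X.val x)) = 0 :=
    fun x ↦ ⟨(hA.hyperHermitianForm x).self_I _, (hA.hyperHermitianForm x).rotate.self_I _,
      (hA.hyperHermitianForm x).rotate.rotate.self_I _⟩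
  have bX : ∀ x, (flat g (I.app X)).val x (X.val x) = 0 := fun x ↦
    (hA.symm x _ _).trans (hz x).1
  have cX : ∀ x, (flat g (J.app X)).val x (X.val x) = 0 := fun x ↦
    (hA.symm x _ _).trans (hz x).2.1
  have dX : ∀ x, (flat g (K.app X)).val x (X.val x) = 0 := fun x ↦
    (hA.symm x _ _).trans (hz x).2.2
  -- The deformed metric pairs `X` with `v` to `(f + h‖X‖²) g(X, v)`, so a zero of the factor would
  -- put `X` in its kernel.
  have hfN : ∀ x, f x + h x * normSq g X x ≠ 0 := by
    intro x h0
    refine hXv x ((H x).1.nondegenerate _ fun v ↦ ?_)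
    have b := bX x
    have c := cX x
    have d := dX x
    change g.val x (I.val x (X.val x)) (X.val x) = 0 at b
    change g.val x (J.val x (X.val x)) (X.val x) = 0 at c
    change g.val x (K.val x (X.val x)) (X.val x) = 0 at d
    change f x + h x * g.val x (X.val x) (X.val x) = 0 at h0
    rw [elemDeformation_val, b, c, d]
    linear_combination h0 * g.val x (X.val x) v
  -- In dimension above 4 there is a non-zero `w` on which all four covectors vanish. On it the
  -- deformed metric is `f g(w, ·)`.
  have hf0 : ∀ x, f x ≠ 0 := by
    intro x h0
    obtain ⟨w, hw, w0, w1, w2, w3⟩ := exists_ne_zero_of_four_lt_finrank (by rwa [hfin])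
      (g.val x (X.val x)) (g.val x (I.val x (X.val x))) (g.val x (J.val x (X.val x)))
      (g.val x (K.val x (X.val x)))
    refine hw ((H x).1.nondegenerate w fun v ↦ ?_)
    rw [elemDeformation_val, w0, w1, w2, w3, h0]
    ring
  have sol : ∀ x, CovField.val (n := n) (dFun f) x = 0 ∧ ∃ p q r : ℝ,
      (∀ v : Model n, CovField.val (n := n) (dFun h) x v = p * (flat g (I.app X)).val x v
        + q * (flat g (J.app X)).val x v + r * (flat g (K.app X)).val x v) ∧
      ∀ u v : Model n, k x * F.val x ![u, v] = h x * (flat g X).toForm.d.val x ![u, v]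
        + wedge (CovField.val (n := n) (dFun h) x) ((flat g X).val x) ![u, v]
        + (p * wedge ((flat g (J.app X)).val x) ((flat g (K.app X)).val x) ![u, v]
          + q * wedge ((flat g (K.app X)).val x) ((flat g (I.app X)).val x) ![u, v]
          + r * wedge ((flat g (I.app X)).val x) ((flat g (J.app X)).val x) ![u, v]) := by
    intro x
    have Hx := hA.hyperHermitianForm x
    obtain ⟨D⟩ := Hx.exists_dualFrame (hXv x)
    have h8 := Hx.eight_le_finrank (by rwa [hfin]) (hXv x)
    -- Each `ω_A` is non-degenerate because `A² = -1` makes `A` injective.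
    have hB : ∀ (A : Model n →L[ℝ] Model n), (∀ u, A (A u) = -u) → ∀ u,
        (∀ v, ((g.val x).comp A) u v = 0) → u = 0 := by
      intro A hA2 u hu
      have h1 : A u = 0 := Hx.nondegenerate _ hu
      have h2 := hA2 u
      rw [h1, map_zero] at h2
      exact neg_eq_zero.1 h2.symm
    exact DualFrame.solve_twistEquations (a := (flat g X).val x) (b := (flat g (I.app X)).val x)
      (c := (flat g (J.app X)).val x) (d := (flat g (K.app X)).val x) D h8
      (hB _ Hx.sq_I) (hB _ Hx.sq_J) (H x).2.1 (H x).2.2.1 (H x).2.2.2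
  obtain ⟨x₀⟩ : Nonempty M := inferInstance
  have hfc : ∀ x, f x = f x₀ := fun x ↦ eq_of_dFun_eq_zero
    (fun x ↦ (hf x).mdifferentiableAt (by simp)) (fun x v ↦ DFunLike.congr_fun (sol x).1 v) x x₀
  set c := f x₀
  have hc : c ≠ 0 := hf0 x₀
  have md : ∀ {s : M → ℝ}, SmoothFun (n := n) s → ∀ x,
      MDifferentiableAt 𝓘(ℝ, Model n) 𝓘(ℝ, ℝ) s x := fun hs x ↦ (hs x).mdifferentiableAt (by simp)
  have hdk : ∀ x (v : Model n), dFun (n := n) k x v = 0 := by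
    intro x v
    obtain ⟨-, p, q, r, hp, hF⟩ := sol x
    -- The formula for `kF` is contracted with `X`, using `X ⌟ F = -da` and `X ⌟ dα₀ = -d‖X‖²`.
    -- Since `ka = c + h‖X‖²`, the right-hand side is also `d(ka)`, which leaves `a dk = 0`.
    have e1 : k x * dFun (n := n) a x v
        = h x * dFun (n := n) (normSq g X) x v + normSq g X x * dFun (n := n) h x v := by
      have h1 := hF (X.val x) v
      have h2 : dFun (n := n) a x v = - F.val x ![X.val x, v] := τ.da_eq x v
      have h3 := hp (X.val x)
      rw [bX, cX, dX] at h3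
      rw [d_flat_apply hA.smooth_g hA.symm hX.smooth hX.killing] at h1
      simp only [wedge_apply, Matrix.cons_val_zero, Matrix.cons_val_one, bX, cX, dX, h3] at h1
      have h4 : (flat g X).val x (X.val x) = normSq g X x := rfl
      have h5 : CovField.val (n := n) (dFun h) x v = dFun (n := n) h x v := rfl
      rw [h4, h5] at h1
      rw [h2]
      linear_combination -h1
    have e2 : (fun x ↦ k x * a x) = fun x ↦ c + h x * normSq g X x := by
      funext x
      rw [hka, hfc]
    have e3 := dFun_mul (md hk x) (md τ.smooth_a x) v
    rw [e2] at e3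
    have e4 := dFun_add (t := fun x ↦ h x * normSq g X x) (md (contMDiff_const : SmoothFun (n := n) fun _ : M ↦ c) x)
      (md (hh.mul hN) x) v
    have e5 := dFun_mul (md hh x) (md hN x) v
    rw [dFun_const] at e4
    refine (mul_eq_zero.1 ?_).resolve_left (τ.a_ne_zero x)
    linarith
  have hkc : ∀ x, k x = k x₀ := fun x ↦ eq_of_dFun_eq_zero (md hk) hdk x x₀
  have hk0 : k x₀ ≠ 0 := div_ne_zero (hfN x₀) (τ.a_ne_zero x₀)
  set κ := k x₀
  have hh₁ : SmoothFun (n := n) (fun x ↦ c⁻¹ * h x) :=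
    (contMDiff_const : SmoothFun (n := n) fun _ : M ↦ c⁻¹).mul hh
  set η : KForm n M 1 := CovField.toForm (fun y ↦ (c⁻¹ * h y) • flat g X y)
  have hη : ∀ x, η.SmoothAt x := fun x ↦
    KForm.SmoothAt.smul (η := (flat g X).toForm) (hh₁ x) (flat_smoothAt hA.smooth_g hX.smooth x)
  have hηd : ∀ x (u v : Model n), η.d.val x ![u, v]
      = dFun (n := n) (fun x ↦ c⁻¹ * h x) x u * (flat g X).val x v
        - dFun (n := n) (fun x ↦ c⁻¹ * h x) x v * (flat g X).val x u
        + c⁻¹ * h x * (flat g X).toForm.d.val x ![u, v] := fun x ↦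
    KForm.d_smul_one (η := (flat g X).toForm) (hh₁ x) (flat_smoothAt hA.smooth_g hX.smooth x)
  have hdh₁ : ∀ x (v : Model n), dFun (n := n) (fun x ↦ c⁻¹ * h x) x v = c⁻¹ * dFun (n := n) h x v := fun x ↦
    dFun_const_mul c⁻¹ (md hh x)
  -- The constant `c / κ` comes from `κ a = c + h‖X‖² = c (1 + h₁‖X‖²)`. The form `σ` is defined as
  -- what the formula for `F` leaves over, so its content is the identification with `*₃dh₁`.
  refine ⟨c, c / κ, fun x ↦ c⁻¹ * h x, fun x ↦ (κ / c) • F x + (-1 : ℝ) • η.d x, hc,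
    div_ne_zero hc hk0, hh₁, fun x ↦ ?_, fun x ↦ ?_, fun x ↦ ?_, fun x ↦ ?_, fun x ↦ ?_⟩
  · unfold elemDeformation
    rw [hfc x]
    refine (congrArg (c • g x + ·) ?_).trans (smul_add c (g x) _).symm
    exact (congrArg (· • gHX g I J K X x) (mul_inv_cancel_left₀ hc (h x)).symm).trans
      (mul_smul _ _ _)
  · have h1 := hka x
    rw [hkc x, hfc x] at h1
    field_simp
    linarith
  · obtain ⟨-, p, q, r, hp, hF⟩ := sol x
    refine ⟨c⁻¹ * p, c⁻¹ * q, c⁻¹ * r, ContinuousLinearMap.ext fun v ↦ ?_,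
      alternating_two_ext (E := Model n) fun u v ↦ ?_⟩
    · refine (hdh₁ x v).trans ?_
      have h1 := hp v
      change dFun (n := n) h x v = _ at h1
      rw [h1]
      change _ = c⁻¹ * p * (flat g (I.app X)).val x v + c⁻¹ * q * (flat g (J.app X)).val x v
        + c⁻¹ * r * (flat g (K.app X)).val x v
      ring
    · change κ / c * F.val x ![u, v] + -1 * η.d.val x ![u, v]
        = c⁻¹ * p * wedge ((flat g (J.app X)).val x) ((flat g (K.app X)).val x) ![u, v]
          + c⁻¹ * q * wedge ((flat g (K.app X)).val x) ((flat g (I.app X)).val x) ![u, v]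
          + c⁻¹ * r * wedge ((flat g (I.app X)).val x) ((flat g (J.app X)).val x) ![u, v]
      have h1 := hF u v
      have h2 : wedge (CovField.val (n := n) (dFun h) x) ((flat g X).val x) ![u, v]
          = dFun (n := n) h x u * (flat g X).val x v
            - dFun (n := n) h x v * (flat g X).val x u := wedge_apply _ _ _
      rw [h2, hkc x] at h1
      rw [hηd, hdh₁, hdh₁]
      linear_combination c⁻¹ * h1
  · change F x = (c / κ) • η.d x + (c / κ) • ((κ / c) • F x + (-1 : ℝ) • η.d x)
    have h1 : c / κ * (κ / c) = 1 := by field_simp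
    rw [smul_add, smul_smul, smul_smul, h1, one_smul]
    module
  -- `σ` is a constant multiple of the closed form `F` minus an exact form.
  · have h1 : ∀ x, F.SmoothAt x := τ.smooth_F.smoothAt
    have h2 : ∀ (s : ℝ) {ζ : KForm n M 2}, (∀ x, ζ.SmoothAt x) →
        KForm.SmoothAt (fun x ↦ s • ζ x) x := fun s ζ hζ ↦
      KForm.SmoothAt.smul (s := fun _ ↦ s) contMDiffAt_const (hζ x)
    refine (KForm.d_add (h2 (κ / c) h1) (h2 (-1) (KForm.SmoothAt.d hη))).trans ?_
    rw [KForm.d_const_smul, KForm.d_const_smul, τ.d_curvature, KForm.d_d hη, smul_zero, smul_zero,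
      add_zero]

end MainTheorem

end PHKTwist

end

theorem theorem6p1 {n : ℕ} (hn : 4 < n)
    {M : Type*} [TopologicalSpace M] [T2Space M] [SecondCountableTopology M] [ConnectedSpace M]
    [ChartedSpace (Model n) M] [IsManifold 𝓘(ℝ, Model n) ∞ M]
    {P : Type*} [TopologicalSpace P] [T2Space P] [SecondCountableTopology P]
    [ChartedSpace (Model (n + 1)) P] [IsManifold 𝓘(ℝ, Model (n + 1)) ∞ P]
    {W : Type*} [TopologicalSpace W] [T2Space W] [SecondCountableTopology W]
    [ChartedSpace (Model n) W] [IsManifold 𝓘(ℝ, Model n) ∞ W]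
    (g : BilinField n M) (I J K : EndField n M) (hM : IsPseudoHyperKahler g I J K)
    (X : VField n M) (hX : IsTriholomorphicIsometry g I J K X) (hX_free : ∀ x, X x ≠ 0)
    (f h : M → ℝ) (hf : SmoothFun (n := n) f) (hh : SmoothFun (n := n) h)
    (a : M → ℝ) (F : KForm n M 2) (τ : Twist M P W X a F)
    (gW : BilinField n W) (IW JW KW : EndField n W)
    (hgW : SmoothBilin gW) (hIW : SmoothEnd IW) (hJW : SmoothEnd JW) (hKW : SmoothEnd KW)
    (rel_g : τ.RelatedBilin gW (elemDeformation f h g I J K X))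
    (rel_I : τ.RelatedEnd IW I) (rel_J : τ.RelatedEnd JW J) (rel_K : τ.RelatedEnd KW K) :
    IsPseudoHyperKahler gW IW JW KW ↔
      ∃ (c l : ℝ) (h₁ : M → ℝ) (σ : KForm n M 2),
        c ≠ 0 ∧ l ≠ 0 ∧ SmoothFun (n := n) h₁ ∧
        (∀ x, elemDeformation f h g I J K X x = c • (g x + h₁ x • gHX g I J K X x)) ∧
        (∀ x, a x = l * (1 + h₁ x * normSq g X x)) ∧
        IsStarThree (flat g (I.app X)) (flat g (J.app X)) (flat g (K.app X)) (dFun h₁) σ ∧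
        (∀ x, F x = l • (CovField.toForm (fun y ↦ h₁ y • flat g X y)).d x + l • σ x) ∧
        (∀ x, σ.d x = 0) := by
  constructor
  · exact exists_formula_of_isPseudoHyperKahler hn hM hX hX_free hf hh hgW hIW hJW hKW rel_g rel_I
      rel_J rel_K
  · rintro ⟨c, l, h₁, σ, hc, hl, hh₁, hg, ha, hσ, hF, -⟩
    have e : elemDeformation f h g I J K X
        = elemDeformation (fun _ ↦ c) (fun x ↦ c * h₁ x) g I J K X := by
      funext x
      refine (hg x).trans ((smul_add c (g x) _).trans (congrArg (c • g x + ·) ?_))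
      exact smul_smul c (h₁ x) (gHX g I J K X x)
    rw [e] at rel_g
    exact isPseudoHyperKahler_of_twist hM hX hgW hIW hJW hKW hc hl hh₁ rel_g rel_I rel_J rel_K ha hσ
      hF
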